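/- For $n\ge 1$ let $C_n=\{X^n+Y^n=Z^n\}\subset\mathbb{P}^2$ be the Fermat curve over $\mathbb{Q}$, let $x=X/Z$, $y=Y/Z$, and let $\pi\colon C_n\to\mathbb{P}^1$, $[X:Y:Z]\mapsto[X^n:Z^n]$. Let $h$ be the absolute logarithmic Weil height on $\mathbb{P}^1(\overline{\mathbb{Q}})$. Every rational function $f$ on $C_n$ defined over $\mathbb{Q}$ has a presentation, unique up to the signs of the pairs $(a_i,q_i)$, $$f=\sum_{i=0}^{n-1}\frac{a_i(x)}{q_i(x)}\,y^i,$$ where $a_i,q_i\in\mathbb{Z}[x]$, $q_i\neq 0$, the coefficients of $a_i$ and $q_i$ taken together have no common factor, and $a_i$ and $q_i$ have no common complex root. The height of a nonzero polynomial is the logarithmic Weil height of its coefficient vector as a point of a projective space (the zero polynomial has height $0$); the height of a pair of polynomials, not both zero, is the height of the vector of the coefficients of both taken together. There is a computable function $B\colon\mathbb{N}^3\to\mathbb{N}$ such that the following holds for all integers $n\ge 1$, $d\ge 0$ and all real $H$, where $b=B(n,d,\max(0,\lceil H\rceil))$. Let $S\subset\mathbb{P}^1(\overline{\mathbb{Q}})$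 be a set with $[\mathbb{Q}(P):\mathbb{Q}]\le d$ and $h(P)\le H$ for all $P\in S$. Then there is a nonconstant rational function $f\colon C_n\to\mathbb{P}^1$, defined over $\mathbb{Q}$, such that: 1. $f$ is unramified at every point of $C_n(\overline{\mathbb{Q}})$ outside $f^{-1}\{0,1,\infty\}$; 2. $f(\pi^{-1}(S))\cap\{0,1,\infty\}=\emptyset$; 3. in the presentation of $f$, the degrees and heights of all the polynomials $a_i,q_i$, and also the heights of all the pairs $(a_i,q_i)$, are at most $b$; 4. the degree of $f$ is at most $b$, and $h(\pi(Q))\le b$ for every $Q\in C_n(\overline{\mathbb{Q}})$ with $f(Q)\in\{0,1,\infty\}$. -/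

import Mathlib

noncomputable section

namespace FermatCurve

/-- The field of algebraic numbers. -/
abbrev Qbar : Type := AlgebraicClosure ℚ

/-! ### The projective line over the algebraic numbers: degrees and heights

`P¹(Qbar)` is `OnePoint Qbar`: the affine points `α = [α : 1]` and the point `∞ = [1 : 0]`. -/

instance isAlgebraic_Qbar : Algebra.IsAlgebraic ℚ Qbar := AlgebraicClosure.isAlgebraic ℚ

instance numberField_adjoin (α : Qbar) : NumberField (IntermediateField.adjoin ℚ {α}) where
  to_charZero := inferInstance
  to_finiteDimensional :=
    IntermediateField.adjoin.finiteDimensional (Algebra.IsIntegral.isIntegral α)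

/-- The degree `[ℚ(P) : ℚ]` of a point of the projective line. -/
def pointDegree (P : OnePoint Qbar) : ℕ :=
  P.elim 1 fun α => Module.finrank ℚ (IntermediateField.adjoin ℚ {α})

/-- The absolute logarithmic Weil height of a point of the projective line. Mathlib's `logHeight₁`
is relative to the number field, so it is divided by the degree of `ℚ(α)`. -/
def pointHeight (P : OnePoint Qbar) : ℝ :=
  P.elim 0 fun α =>
    Height.logHeight₁ (IntermediateField.AdjoinSimple.gen ℚ α) /
      Module.finrank ℚ (IntermediateField.adjoin ℚ {α})

/-- The three points `0, 1, ∞` of the projective line. -/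
def threePoints : Set (OnePoint Qbar) :=
  {((0 : Qbar) : OnePoint Qbar), ((1 : Qbar) : OnePoint Qbar), OnePoint.infty}

/-! ### The Fermat curve and its function field -/

/-- The affine equation `y ^ n + (x ^ n - 1)` of the Fermat curve, as a polynomial in `y` over
`Qbar[x]`. -/
def equation (n : ℕ) : Polynomial (Polynomial Qbar) :=
  Polynomial.X ^ n + Polynomial.C (Polynomial.X ^ n - 1)

theorem equation_irreducible (n : ℕ) [NeZero n] : Irreducible (equation n) := by
  have hn : n ≠ 0 := NeZero.ne n
  have hmonic : (equation n).Monic := Polynomial.monic_X_pow_add_C _ hn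
  have hdeg : (equation n).degree = n := Polynomial.degree_X_pow_add_C (Nat.pos_of_ne_zero hn) _
  have hcoeff : ∀ k : ℕ, k < n →
      (equation n).coeff k = if k = 0 then Polynomial.X ^ n - 1 else 0 := by
    intro k hk
    rw [equation, Polynomial.coeff_add, Polynomial.coeff_X_pow, if_neg hk.ne, zero_add,
      Polynomial.coeff_C]
  have hprime : (Ideal.span {(Polynomial.X - Polynomial.C 1 : Polynomial Qbar)}).IsPrime :=
    (Ideal.span_singleton_prime (Polynomial.X_sub_C_ne_zero 1)).mpr (Polynomial.prime_X_sub_C 1)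
  refine Polynomial.irreducible_of_eisenstein_criterion hprime ?_ ?_ ?_ ?_ hmonic.isPrimitive
  · rw [hmonic.leadingCoeff]
    exact fun h => hprime.ne_top ((Ideal.eq_top_iff_one _).mpr h)
  · intro k hk
    rw [hdeg, Nat.cast_lt] at hk
    rw [hcoeff k hk]
    split_ifs
    · rw [Ideal.mem_span_singleton, Polynomial.dvd_iff_isRoot]
      simp
    · exact zero_mem _
  · rw [hdeg]
    exact_mod_cast Nat.pos_of_ne_zero hn
  · rw [hcoeff 0 (Nat.pos_of_ne_zero hn), if_pos rfl, Ideal.span_singleton_pow,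
      Ideal.mem_span_singleton]
    rintro ⟨p, hp⟩
    have h := congrArg (fun r => Polynomial.eval 1 (Polynomial.derivative r)) hp
    simp [Polynomial.derivative_pow] at h
    exact hn h

/-- The coordinate ring `Qbar[x, y] / (x ^ n + y ^ n - 1)`. -/
abbrev CoordinateRing (n : ℕ) : Type := AdjoinRoot (equation n)

instance coordinateRing_isDomain (n : ℕ) [NeZero n] : IsDomain (CoordinateRing n) :=
  AdjoinRoot.isDomain_of_prime (equation_irreducible n).prime

/-- The function field `Qbar(C_n)` of the Fermat curve. -/
abbrev FunctionField (n : ℕ) : Type := FractionRing (CoordinateRing n)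

/-- The rational function `x = X / Z`. -/
def x (n : ℕ) : FunctionField n :=
  algebraMap (CoordinateRing n) (FunctionField n) (AdjoinRoot.of (equation n) Polynomial.X)

/-- The rational function `y = Y / Z`. -/
def y (n : ℕ) : FunctionField n :=
  algebraMap (CoordinateRing n) (FunctionField n) (AdjoinRoot.root (equation n))

/-- The points over `Qbar` of the projective Fermat curve `X ^ n + Y ^ n = Z ^ n`. -/
def Point (n : ℕ) : Type :=
  {P : Projectivization Qbar (Fin 3 → Qbar) // P.rep 0 ^ n + P.rep 1 ^ n = P.rep 2 ^ n}

/-- Homogeneous coordinates `(X, Y, Z)` of a point. -/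
def Point.coords {n : ℕ} (P : Point n) : Fin 3 → Qbar := P.1.rep

open Classical in
/-- The map `π : [X : Y : Z] ↦ [X ^ n : Z ^ n]` to the projective line. -/
def piMap {n : ℕ} (P : Point n) : OnePoint Qbar :=
  if P.coords 2 = 0 then OnePoint.infty
  else ((P.coords 0 ^ n / P.coords 2 ^ n : Qbar) : OnePoint Qbar)

/-- `g = A / B` as rational functions on the curve, where `A` and `B` are forms of the same degree
in `X, Y, Z`, and `B` does not vanish at the point `P`. -/
def IsFractionAt {n : ℕ} (P : Point n) (g : FunctionField n) (A B : MvPolynomial (Fin 3) Qbar) :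
    Prop :=
  (∃ m : ℕ, A.IsHomogeneous m ∧ B.IsHomogeneous m) ∧ MvPolynomial.eval P.coords B ≠ 0 ∧
    g * MvPolynomial.aeval ![x n, y n, 1] B = MvPolynomial.aeval ![x n, y n, 1] A

theorem IsFractionAt.add {n : ℕ} {P : Point n} {g g' : FunctionField n}
    {A B A' B' : MvPolynomial (Fin 3) Qbar} (h : IsFractionAt P g A B)
    (h' : IsFractionAt P g' A' B') : IsFractionAt P (g + g') (A * B' + A' * B) (B * B') := by
  obtain ⟨⟨m, hA, hB⟩, h0, h1⟩ := h
  obtain ⟨⟨m', hA', hB'⟩, h0', h1'⟩ := h'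
  refine ⟨⟨m + m', (hA.mul hB').add ?_, hB.mul hB'⟩, ?_, ?_⟩
  · rw [add_comm m m']
    exact hA'.mul hB
  · rw [map_mul]
    exact mul_ne_zero h0 h0'
  · rw [map_add, map_mul, map_mul, map_mul, ← h1, ← h1']
    ring

theorem IsFractionAt.mul {n : ℕ} {P : Point n} {g g' : FunctionField n}
    {A B A' B' : MvPolynomial (Fin 3) Qbar} (h : IsFractionAt P g A B)
    (h' : IsFractionAt P g' A' B') : IsFractionAt P (g * g') (A * A') (B * B') := by
  obtain ⟨⟨m, hA, hB⟩, h0, h1⟩ := h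
  obtain ⟨⟨m', hA', hB'⟩, h0', h1'⟩ := h'
  refine ⟨⟨m + m', hA.mul hA', hB.mul hB'⟩, ?_, ?_⟩
  · rw [map_mul]
    exact mul_ne_zero h0 h0'
  · rw [map_mul, map_mul, ← h1, ← h1']
    ring

theorem IsFractionAt.const {n : ℕ} (P : Point n) (c : Qbar) :
    IsFractionAt P (algebraMap Qbar (FunctionField n) c) (MvPolynomial.C c) 1 := by
  refine ⟨⟨0, MvPolynomial.isHomogeneous_C _ _, MvPolynomial.isHomogeneous_one _ _⟩, ?_, ?_⟩
  · simp
  · simp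

/-- The local ring of the curve at `P`. -/
def localRing {n : ℕ} (P : Point n) : Subalgebra Qbar (FunctionField n) where
  carrier := {g | ∃ A B, IsFractionAt P g A B}
  add_mem' := by
    rintro g g' ⟨A, B, h⟩ ⟨A', B', h'⟩
    exact ⟨_, _, h.add h'⟩
  mul_mem' := by
    rintro g g' ⟨A, B, h⟩ ⟨A', B', h'⟩
    exact ⟨_, _, h.mul h'⟩
  algebraMap_mem' c := ⟨_, _, IsFractionAt.const P c⟩

/-- The maximal ideal of the local ring at `P`: the functions that vanish at `P`. -/
def maxIdeal {n : ℕ} (P : Point n) : Ideal (localRing P) where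
  carrier := {g | ∃ A B, IsFractionAt P (g : FunctionField n) A B ∧
    MvPolynomial.eval P.coords A = 0}
  add_mem' := by
    rintro g g' ⟨A, B, h, h0⟩ ⟨A', B', h', h0'⟩
    exact ⟨_, _, h.add h', by simp [h0, h0']⟩
  zero_mem' := ⟨0, 1, by simpa using IsFractionAt.const P 0, by simp⟩
  smul_mem' := by
    rintro ⟨g, A, B, h⟩ g' ⟨A', B', h', h0'⟩
    exact ⟨_, _, h.mul h', by simp [h0']⟩

open Classical in
/-- The value `f(P)` in the projective line: `c` if `f - c` vanishes at `P`, and `∞` if there is no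
such `c`. -/
def evalAt {n : ℕ} (f : FunctionField n) (P : Point n) : OnePoint Qbar :=
  if h : ∃ c : Qbar, ∃ g ∈ maxIdeal P, (g : FunctionField n) = f - algebraMap Qbar _ c then
    ((h.choose : Qbar) : OnePoint Qbar)
  else OnePoint.infty

/-- The pullback under `f` of the standard local parameter of the projective line at `f(P)`:
`f - f(P)`, or `1 / f` if `f(P) = ∞`. -/
def pullbackParameter {n : ℕ} [NeZero n] (f : FunctionField n) (P : Point n) : FunctionField n :=
  (evalAt f P).elim f⁻¹ fun c => f - algebraMap Qbar _ c

/-- `f` is unramified at `P` (it has ramification index one there): a local parameter at `f(P)`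
pulls back to an element of the maximal ideal at `P` that is not in its square. -/
def IsUnramifiedAt {n : ℕ} [NeZero n] (f : FunctionField n) (P : Point n) : Prop :=
  ∃ g ∈ maxIdeal P, g ∉ maxIdeal P ^ 2 ∧ (g : FunctionField n) = pullbackParameter f P

/-- `f` is a constant function. -/
def IsConstant {n : ℕ} (f : FunctionField n) : Prop :=
  f ∈ Set.range (algebraMap Qbar (FunctionField n))

/-- `f` is defined over `ℚ`: it lies in `ℚ(C_n) = ℚ(x, y)`. -/
def IsDefinedOverRat {n : ℕ} [NeZero n] (f : FunctionField n) : Prop :=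
  f ∈ Subfield.closure {x n, y n}

/-- The degree `[Qbar(C_n) : Qbar(f)]` of a nonconstant rational function. -/
def degree {n : ℕ} [NeZero n] (f : FunctionField n) : ℕ :=
  Module.finrank (IntermediateField.adjoin Qbar {f}) (FunctionField n)

/-! ### Presentations of rational functions -/

/-- The presentation `f = ∑ i, a i (x) / q i (x) * y ^ i` with integral polynomials. For every `i`,
`q i ≠ 0`, the pair `(a i, q i)` is primitive (the coefficients of both polynomials taken together
have no common factor), and `a i` and `q i` have no common complex root. -/
structure IsPresentation {n : ℕ} [NeZero n] (f : FunctionField n)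
    (a q : Fin n → Polynomial ℤ) : Prop where
  den_ne_zero : ∀ i, q i ≠ 0
  primitive : ∀ i, ∀ r : ℤ, Polynomial.C r ∣ a i → Polynomial.C r ∣ q i → IsUnit r
  no_common_root : ∀ i, ∀ z : ℂ, ¬ (Polynomial.aeval z (a i) = 0 ∧ Polynomial.aeval z (q i) = 0)
  eq_sum : f = ∑ i, Polynomial.aeval (x n) (a i) / Polynomial.aeval (x n) (q i) * y n ^ (i : ℕ)

/-- The vector of the coefficients of an integral polynomial. -/
def coeffVector (p : Polynomial ℤ) : Fin (p.natDegree + 1) → ℚ := fun k => (p.coeff k : ℚ)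

/-- The height of a polynomial: the logarithmic Weil height of its coefficient vector as a point of
a projective space (and `0` for the zero polynomial). -/
def polyHeight (p : Polynomial ℤ) : ℝ := Height.logHeight (coeffVector p)

/-- The height of a pair of polynomials: the logarithmic Weil height of the vector of all
coefficients of both. It bounds the height of each, and for a primitive pair it is the logarithm of
the largest absolute value of a coefficient. -/
def pairHeight (p r : Polynomial ℤ) : ℝ :=
  Height.logHeight (Sum.elim (coeffVector p) (coeffVector r))

/-- The degrees and heights of the polynomials of a presentation are at most `b`. -/
structure ComplexityLE {n : ℕ} (a q : Fin n → Polynomial ℤ) (b : ℝ) : Prop where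
  natDegree_num : ∀ i, ((a i).natDegree : ℝ) ≤ b
  natDegree_den : ∀ i, ((q i).natDegree : ℝ) ≤ b
  height_num : ∀ i, polyHeight (a i) ≤ b
  height_den : ∀ i, polyHeight (q i) ≤ b
  height_pair : ∀ i, pairHeight (a i) (q i) ≤ b

end FermatCurve

end

/-! This is Belyi's construction in its noncritical form, with every bound made explicit. The set
`S` enters only through `n`, `d` and `H`: with `N = n + d + ⌈H⌉₊` (natural ceiling), one function
`f` serves all points `P` of the curve for which `π(P)` has degree and height at most `N`. Call
these points marked.

Poles at the marked points. There is an integral polynomial `σ` of bounded size, with simple roots,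
that vanishes at all algebraic numbers of degree and height at most `N` other than `0` and `1`
(`exists_squarefree_poly`). The function `G = x + 1/x + 1/y + 1/σ(x ^ n)` then has a simple pole at
every marked point. Its finite critical values are roots of integral polynomials of bounded size
(`exists_pole_function`).

Separation. For a large integer `m`, the transformation `z ↦ m z / (z - m)` sends `∞` to `m` and the
finite critical values into a disc of much smaller radius `R` (`exists_stage`). The marked points
are now unramified with a common integral value `t`, far outside the disc that contains the critical
values.

Descent. Composition with one of the polynomials `p` whose roots are critical values sends those
roots to `0`. The new critical values are `0`, the images of the other old ones, and the values of
`p` at the roots of `p'`; the total excess degree therefore drops (`exists_stage_step`). By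
Gauss–Lucas the roots of `p'` lie in the same disc, so `t` is not critical for `p`, and `p(t)`
remains far outside the new disc. After boundedly many steps all critical values are rational
(`Stage.exists_linear`).

Three points. An affine map moves the critical values to integers in `[0, k]`, with `k` even, and
`t` to an integer `T > k`. The function `∏ j ≤ k, (z - j) ^ ((-1) ^ j * choose k j)` has logarithmic
derivative `k! / ∏ (z - j)`, so away from the nodes it has no finite critical point; it sends the
nodes to `0` and `∞`, and `∞` to `1`. On `(k, ∞)` it is positive and increases strictly to `1`, so
its value at `T` is not `0`, `1` or `∞` (`eval_nodePoly_ne`, `exists_belyi_function`).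

Ramification is read off from first-order jets, that is, from values at points over the dual
numbers. For the bounds, each function is a quotient of two polynomials in `x, y` whose size is a
primitive recursive function of `N` (`IsFrac`). Multiplication matrices in the basis `1, y, …, y ^
(n - 1)` convert such a quotient into the presentation (`exists_presentation`), into an equation
between `x` and `f` that bounds the degree (`exists_degree_bound`), and into a norm in `x` that
bounds the heights of the points over `0, 1, ∞` (`exists_height_bound`). -/

noncomputable section

namespace FermatCurve

open Polynomial

/-! ### Sizes of integral polynomials -/

/-- A natural-valued submultiplicative size function on a commutative ring. -/
class SizeRing (R : Type*) [CommRing R] where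
  /-- The size of an element. -/
  size : R → ℕ
  size_zero : size 0 = 0
  size_one : size 1 = 1
  size_neg : ∀ a, size (-a) = size a
  size_add_le : ∀ a b, size (a + b) ≤ size a + size b
  size_mul_le : ∀ a b, size (a * b) ≤ size a * size b

open SizeRing

section SizeRing

variable {R : Type*} [CommRing R] [SizeRing R]

theorem size_sub_le (a b : R) : size (a - b) ≤ size a + size b := by
  rw [sub_eq_add_neg, ← size_neg b]
  exact size_add_le _ _

theorem size_sum_le {ι : Type*} (s : Finset ι) (f : ι → R) :
    size (∑ i ∈ s, f i) ≤ ∑ i ∈ s, size (f i) :=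
  Finset.le_sum_of_subadditive size size_zero.le size_add_le s f

theorem size_prod_le {ι : Type*} (s : Finset ι) (f : ι → R) :
    size (∏ i ∈ s, f i) ≤ ∏ i ∈ s, size (f i) := by
  classical
  induction s using Finset.induction_on with
  | empty => simp [size_one]
  | insert a s ha ih =>
    rw [Finset.prod_insert ha, Finset.prod_insert ha]
    exact (size_mul_le _ _).trans (Nat.mul_le_mul_left _ ih)

theorem size_pow_le (a : R) (k : ℕ) : size (a ^ k) ≤ size a ^ k := by
  have := size_prod_le (Finset.range k) fun _ => a
  simpa using this

instance sizeRingInt : SizeRing ℤ where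
  size := Int.natAbs
  size_zero := rfl
  size_one := rfl
  size_neg := Int.natAbs_neg
  size_add_le := Int.natAbs_add_le
  size_mul_le a b := (Int.natAbs_mul a b).le

theorem size_int (a : ℤ) : size a = a.natAbs := rfl

/-- The sum of the sizes of the coefficients with weights `2 ^ i`; it bounds both the degree and
the coefficients. -/
def polySize (p : R[X]) : ℕ := p.sum fun i a => size a * 2 ^ i

theorem polySize_eq_sum_of_subset {p : R[X]} {s : Finset ℕ} (h : p.support ⊆ s) :
    polySize p = ∑ i ∈ s, size (p.coeff i) * 2 ^ i := by
  rw [polySize, Polynomial.sum_def]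
  refine Finset.sum_subset h fun i _ hi => ?_
  rw [notMem_support_iff.mp hi, size_zero, zero_mul]

theorem polySize_add_le (p q : R[X]) : polySize (p + q) ≤ polySize p + polySize q := by
  classical
  rw [polySize_eq_sum_of_subset (support_add (p := p) (q := q)),
    polySize_eq_sum_of_subset (p := p) (s := p.support ∪ q.support) Finset.subset_union_left,
    polySize_eq_sum_of_subset (p := q) (s := p.support ∪ q.support) Finset.subset_union_right,
    ← Finset.sum_add_distrib]
  refine Finset.sum_le_sum fun i _ => ?_
  rw [← add_mul, coeff_add]
  exact Nat.mul_le_mul_right _ (size_add_le _ _)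

theorem polySize_zero : polySize (0 : R[X]) = 0 := by simp [polySize]

theorem polySize_monomial (i : ℕ) (a : R) : polySize (monomial i a) = size a * 2 ^ i := by
  rw [polySize, sum_monomial_index]
  rw [size_zero, zero_mul]

theorem polySize_mul_le (p q : R[X]) : polySize (p * q) ≤ polySize p * polySize q := by
  rw [mul_eq_sum_sum, polySize.eq_def p, Polynomial.sum_def p, Finset.sum_mul]
  have hsum : ∀ (s : Finset ℕ) (f : ℕ → R[X]),
      polySize (∑ i ∈ s, f i) ≤ ∑ i ∈ s, polySize (f i) := fun s f =>
    Finset.le_sum_of_subadditive polySize polySize_zero.le polySize_add_le s f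
  refine (hsum _ _).trans (Finset.sum_le_sum fun i _ => ?_)
  rw [Polynomial.sum_def, polySize.eq_def q, Polynomial.sum_def q, Finset.mul_sum]
  refine (hsum _ _).trans (Finset.sum_le_sum fun j _ => ?_)
  rw [polySize_monomial, pow_add]
  calc size (p.coeff i * q.coeff j) * (2 ^ i * 2 ^ j)
      ≤ size (p.coeff i) * size (q.coeff j) * (2 ^ i * 2 ^ j) :=
        Nat.mul_le_mul_right _ (size_mul_le _ _)
    _ = _ := by ring

/-- The construction iterates: starting from `ℤ` it gives sizes on `ℤ[X]` and on `ℤ[X][X]`, so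
determinants over both rings are estimated by the same `size_det_le`. -/
instance sizeRingPolynomial : SizeRing R[X] where
  size := polySize
  size_zero := polySize_zero
  size_one := by
    rw [← monomial_zero_one, polySize_monomial, size_one, pow_zero, mul_one]
  size_neg p := by
    rw [polySize, polySize, Polynomial.sum_def, Polynomial.sum_def, support_neg]
    exact Finset.sum_congr rfl fun i _ => by rw [coeff_neg, size_neg]
  size_add_le := polySize_add_le
  size_mul_le := polySize_mul_le

theorem size_monomial (i : ℕ) (a : R) : size (monomial i a) = size a * 2 ^ i :=
  polySize_monomial i a

theorem size_C (a : R) : size (C a) = size a := by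
  rw [← monomial_zero_left, size_monomial, pow_zero, mul_one]

theorem size_X : size (X : R[X]) = 2 := by
  rw [← monomial_one_one_eq_X, size_monomial, size_one, one_mul, pow_one]

theorem size_poly_eq_sum {p : R[X]} {s : Finset ℕ} (h : p.support ⊆ s) :
    size p = ∑ i ∈ s, size (p.coeff i) * 2 ^ i :=
  polySize_eq_sum_of_subset h

theorem size_coeff_mul_le (p : R[X]) (i : ℕ) : size (p.coeff i) * 2 ^ i ≤ size p := by
  rw [size_poly_eq_sum (Finset.subset_insert i p.support)]
  exact Finset.single_le_sum (f := fun i => size (p.coeff i) * 2 ^ i) (fun _ _ => Nat.zero_le _)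
    (Finset.mem_insert_self _ _)

theorem size_coeff_le (p : R[X]) (i : ℕ) : size (p.coeff i) ≤ size p :=
  (Nat.le_mul_of_pos_right _ (by positivity)).trans (size_coeff_mul_le p i)

theorem size_le_of_natDegree_le {p : R[X]} {d c : ℕ} (hd : p.natDegree ≤ d)
    (hc : ∀ i, size (p.coeff i) ≤ c) : size p ≤ (d + 1) * (c * 2 ^ d) := by
  have hs : p.support ⊆ Finset.range (d + 1) := fun i hi =>
    Finset.mem_range_succ_iff.mpr ((le_natDegree_of_mem_supp i hi).trans hd)
  rw [size_poly_eq_sum hs]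
  refine (Finset.sum_le_card_nsmul _ _ (c * 2 ^ d) fun i hi => ?_).trans (by simp)
  exact Nat.mul_le_mul (hc i) (Nat.pow_le_pow_right (by norm_num) (Finset.mem_range_succ_iff.mp hi))

theorem size_det_le {m : ℕ} (M : Matrix (Fin m) (Fin m) R) {c : ℕ} (h : ∀ i j, size (M i j) ≤ c) :
    size M.det ≤ m.factorial * c ^ m := by
  rw [Matrix.det_apply]
  refine (size_sum_le _ _).trans ((Finset.sum_le_card_nsmul _ _ (c ^ m) fun σ _ => ?_).trans ?_)
  · have : size (Equiv.Perm.sign σ • ∏ i, M (σ i) i) = size (∏ i, M (σ i) i) := by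
      rcases Int.units_eq_one_or (Equiv.Perm.sign σ) with h | h <;> simp [h, size_neg]
    rw [this]
    refine (size_prod_le _ _).trans ((Finset.prod_le_pow_card _ _ c fun i _ => h _ _).trans ?_)
    simp
  · simp [Fintype.card_perm]

end SizeRing

theorem natAbs_coeff_le_size (p : ℤ[X]) (i : ℕ) : (p.coeff i).natAbs ≤ size p :=
  size_coeff_le p i

theorem size_pos {p : ℤ[X]} (hp : p ≠ 0) : 0 < size p :=
  (Int.natAbs_pos.mpr (leadingCoeff_ne_zero.mpr hp)).trans_le (natAbs_coeff_le_size p _)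

/-- The leading coefficient has size at least one and carries the weight `2 ^ deg`, which exceeds
the degree. -/
theorem natDegree_le_size (p : ℤ[X]) : p.natDegree ≤ size p := by
  rcases eq_or_ne p 0 with rfl | hp
  · simp
  have h := size_coeff_mul_le p p.natDegree
  have h1 : 1 ≤ size (p.coeff p.natDegree) := Int.natAbs_pos.mpr (leadingCoeff_ne_zero.mpr hp)
  calc p.natDegree ≤ 2 ^ p.natDegree := Nat.lt_two_pow_self.le
    _ ≤ size (p.coeff p.natDegree) * 2 ^ p.natDegree := Nat.le_mul_of_pos_left _ h1
    _ ≤ size p := h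

/-- There are finitely many integral polynomials of size at most `N`. -/
theorem exists_finset_size_le (N : ℕ) :
    ∃ s : Finset ℤ[X], (∀ p, size p ≤ N ↔ p ∈ s) ∧ s.card ≤ (2 * N + 1) ^ (N + 1) := by
  classical
  let F : (Fin (N + 1) → ℤ) → ℤ[X] := fun c => ∑ i : Fin (N + 1), monomial (i : ℕ) (c i)
  let box : Finset (Fin (N + 1) → ℤ) := Fintype.piFinset fun _ => Finset.Icc (-(N : ℤ)) N
  refine ⟨(box.image F).filter fun p => size p ≤ N, fun p => ?_, ?_⟩
  · rw [Finset.mem_filter, Finset.mem_image]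
    refine ⟨fun h => ⟨⟨fun i => p.coeff i, ?_, ?_⟩, h⟩, And.right⟩
    · refine Fintype.mem_piFinset.mpr fun i => ?_
      have := (natAbs_coeff_le_size p i).trans h
      rw [Finset.mem_Icc]
      omega
    · have hd : p.natDegree < N + 1 := Nat.lt_succ_of_le ((natDegree_le_size p).trans h)
      simp only [F]
      rw [Fin.sum_univ_eq_sum_range (fun i => monomial i (p.coeff i)) (N + 1)]
      exact (as_sum_range' p (N + 1) hd).symm
  · refine (Finset.card_filter_le _ _).trans (Finset.card_image_le.trans ?_)
    rw [Fintype.card_piFinset]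
    simp only [Int.card_Icc, Finset.prod_const, Finset.card_univ, Fintype.card_fin]
    refine Nat.pow_le_pow_left ?_ _
    omega

/-! ### Closure properties of primitive recursive functions -/

section Primrec

theorem primrec_nat_add {f g : ℕ → ℕ} (hf : Primrec f) (hg : Primrec g) :
    Primrec fun k => f k + g k := Primrec.nat_add.comp hf hg

theorem primrec_nat_mul {f g : ℕ → ℕ} (hf : Primrec f) (hg : Primrec g) :
    Primrec fun k => f k * g k := Primrec.nat_mul.comp hf hg

theorem primrec_nat_iterate {f g h : ℕ → ℕ} (hf : Primrec f) (hg : Primrec g) (hh : Primrec h) :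
    Primrec fun k => f^[g k] (h k) := Primrec.nat_iterate hg hh (hf.comp₂ Primrec₂.right)

theorem primrec_nat_pow {f g : ℕ → ℕ} (hf : Primrec f) (hg : Primrec g) :
    Primrec fun k => f k ^ g k := by
  have h : Primrec fun k => (fun m => f k * m)^[g k] 1 :=
    Primrec.nat_iterate (h := fun k m => f k * m) hg (Primrec.const 1)
      (Primrec.nat_mul.comp (hf.comp Primrec.fst) Primrec.snd)
  refine h.of_eq fun k => ?_
  simp [mul_left_iterate]

end Primrec

/-! ### Algebraic numbers of bounded complexity -/

/-- The degree, a denominator and all conjugates of the algebraic number `α` are at most `N`. -/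
structure IsBdd (N : ℕ) (α : Qbar) : Prop where
  degree : (minpoly ℚ α).natDegree ≤ N
  den : ∃ c : ℕ, c ≠ 0 ∧ c ≤ N ∧ IsIntegral ℤ ((c : Qbar) * α)
  norm : ∀ φ : Qbar →+* ℂ, ‖φ α‖ ≤ N

theorem isIntegral_rat_Qbar (α : Qbar) : IsIntegral ℚ α := Algebra.IsIntegral.isIntegral α

theorem natDegree_minpoly_le_of_mem {E : IntermediateField ℚ Qbar} [FiniteDimensional ℚ E]
    {α : Qbar} (h : α ∈ E) : (minpoly ℚ α).natDegree ≤ Module.finrank ℚ E := by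
  have e := IntermediateField.minpoly_eq (K := ℚ) (S := E) ⟨α, h⟩
  rw [← show _ = minpoly ℚ α from e]
  exact minpoly.natDegree_le _

theorem natDegree_minpoly_le_of_mem_adjoin {α β : Qbar} (h : β ∈ IntermediateField.adjoin ℚ {α}) :
    (minpoly ℚ β).natDegree ≤ (minpoly ℚ α).natDegree := by
  rw [← IntermediateField.adjoin.finrank (isIntegral_rat_Qbar α)]
  exact natDegree_minpoly_le_of_mem h

theorem natDegree_minpoly_le_mul {α β γ : Qbar}
    (h : γ ∈ IntermediateField.adjoin ℚ {α} ⊔ IntermediateField.adjoin ℚ {β}) :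
    (minpoly ℚ γ).natDegree ≤ (minpoly ℚ α).natDegree * (minpoly ℚ β).natDegree := by
  rw [← IntermediateField.adjoin.finrank (isIntegral_rat_Qbar α),
    ← IntermediateField.adjoin.finrank (isIntegral_rat_Qbar β)]
  have : FiniteDimensional ℚ
      (IntermediateField.adjoin ℚ {α} ⊔ IntermediateField.adjoin ℚ {β} :
        IntermediateField ℚ Qbar) :=
    IntermediateField.finiteDimensional_sup _ _
  exact (natDegree_minpoly_le_of_mem h).trans (IntermediateField.finrank_sup_le _ _)

theorem IsBdd.mono {M N : ℕ} {α : Qbar} (h : IsBdd M α) (hMN : M ≤ N) : IsBdd N α where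
  degree := h.degree.trans hMN
  den := by
    obtain ⟨c, h0, h1, h2⟩ := h.den
    exact ⟨c, h0, h1.trans hMN, h2⟩
  norm φ := (h.norm φ).trans (by exact_mod_cast hMN)

theorem IsBdd.pos {N : ℕ} {α : Qbar} (h : IsBdd N α) : 1 ≤ N := by
  obtain ⟨c, h0, h1, -⟩ := h.den
  omega

/-- Cauchy's bound; the leading coefficient is a nonzero integer, so dividing by it does not
increase the other coefficients. -/
theorem norm_le_size_of_root {p : ℤ[X]} (hp : p ≠ 0) {z : ℂ} (h : aeval z p = 0) :
    ‖z‖ ≤ size p + 1 := by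
  have hinj : Function.Injective (algebraMap ℤ ℂ) := (algebraMap ℤ ℂ).injective_int
  have hp' : p.map (algebraMap ℤ ℂ) ≠ 0 := (Polynomial.map_ne_zero_iff hinj).mpr hp
  have hr : (p.map (algebraMap ℤ ℂ)).IsRoot z := by rwa [IsRoot, eval_map_algebraMap]
  have h1 := (IsRoot.norm_lt_cauchyBound hp' hr).le
  have h2 : (cauchyBound (p.map (algebraMap ℤ ℂ)) : ℝ) ≤ size p + 1 := by
    rw [cauchyBound]
    push_cast
    gcongr
    refine div_le_of_le_mul₀ (by positivity) (by positivity) ?_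
    have hl : (1 : ℝ) ≤ ‖(p.map (algebraMap ℤ ℂ)).leadingCoeff‖ := by
      rw [leadingCoeff_map_of_injective hinj]
      simp only [algebraMap_int_eq, eq_intCast, Complex.norm_intCast]
      exact_mod_cast Int.one_le_abs (leadingCoeff_ne_zero.mpr hp)
    refine le_trans ?_ (le_mul_of_one_le_right (by positivity) hl)
    have : (Finset.range (p.map (algebraMap ℤ ℂ)).natDegree).sup
        (fun i => ‖(p.map (algebraMap ℤ ℂ)).coeff i‖₊) ≤ ((size p : ℕ) : NNReal) := by
      refine Finset.sup_le fun i _ => ?_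
      rw [← NNReal.coe_le_coe, coe_nnnorm, coeff_map]
      simp only [algebraMap_int_eq, eq_intCast, Complex.norm_intCast, NNReal.coe_natCast]
      have := natAbs_coeff_le_size p i
      rw [← Int.cast_abs, Int.abs_eq_natAbs]
      exact_mod_cast this
    exact_mod_cast this
  exact le_trans (by exact_mod_cast h1) h2

/-- The leading coefficient is a denominator of `α`, and all conjugates are roots of `p`; the `+ 1`
is the one in Cauchy's bound. -/
theorem IsBdd.of_root {N : ℕ} {α : Qbar} {p : ℤ[X]} (hp : p ≠ 0) (hN : size p ≤ N)
    (h : aeval α p = 0) : IsBdd (N + 1) α where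
  degree := by
    have hp' : p.map (algebraMap ℤ ℚ) ≠ 0 :=
      (Polynomial.map_ne_zero_iff (algebraMap ℤ ℚ).injective_int).mpr hp
    have hd : minpoly ℚ α ∣ p.map (algebraMap ℤ ℚ) := minpoly.dvd _ _ (by rwa [aeval_map_algebraMap])
    calc _ ≤ (p.map (algebraMap ℤ ℚ)).natDegree := natDegree_le_of_dvd hd hp'
      _ ≤ p.natDegree := natDegree_map_le
      _ ≤ N + 1 := ((natDegree_le_size p).trans hN).trans (Nat.le_succ N)
  den := by
    refine ⟨p.leadingCoeff.natAbs, by simpa using hp,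
      ((natAbs_coeff_le_size p _).trans hN).trans (Nat.le_succ N), ?_⟩
    have h1 := isIntegral_leadingCoeff_smul p α h
    rw [zsmul_eq_mul] at h1
    rcases Int.natAbs_eq p.leadingCoeff with h2 | h2
    · rw [h2] at h1
      simpa using h1
    · rw [h2] at h1
      simpa using h1.neg
  norm φ := by
    have h1 : aeval (φ α) p = 0 := by
      have := congrArg φ h
      rw [map_zero, aeval_def, hom_eval₂, RingHom.ext_int (φ.comp (algebraMap ℤ Qbar))
        (algebraMap ℤ ℂ)] at this
      exact this
    refine (norm_le_size_of_root hp h1).trans ?_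
    push_cast
    gcongr

/-- If `c` is a denominator of `α` and `m` the minimal polynomial of `c α` over `ℤ`, then the roots
of `m` have absolute value at most `N * N`. This bounds the coefficients of the monic polynomial
`m`, and `m(c X)` is the polynomial sought. Since `m` is irreducible over `ℚ`, a rational root of it
must be `c α`; this gives the last two conclusions, which keep the product in
`exists_squarefree_poly` nonzero at `0` and `1`. -/
theorem IsBdd.exists_poly : ∃ F : ℕ → ℕ, Primrec F ∧ ∀ (N : ℕ) (α : Qbar), IsBdd N α →
    ∃ p : ℤ[X], p ≠ 0 ∧ size p ≤ F N ∧ aeval α p = 0 ∧ (p.eval 0 = 0 → α = 0) ∧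
      (p.eval 1 = 0 → α = 1) := by
  refine ⟨fun N => (N + 1) * ((N * N) ^ N * 2 ^ N * N ^ N * 2 ^ N), ?_, fun N α h => ?_⟩
  · apply_rules [primrec_nat_mul, primrec_nat_add, primrec_nat_pow, Primrec.id, Primrec.const]
  obtain ⟨c, hc0, hcN, hInt⟩ := h.den
  have hN := h.pos
  have hcQ : (c : Qbar) ≠ 0 := Nat.cast_ne_zero.mpr hc0
  set m := minpoly ℤ ((c : Qbar) * α) with hm
  have hmon : m.Monic := minpoly.monic hInt
  have hmQ : minpoly ℚ ((c : Qbar) * α) = m.map (algebraMap ℤ ℚ) :=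
    minpoly.isIntegrallyClosed_eq_field_fractions' ℚ hInt
  have hdeg : m.natDegree ≤ N := by
    rw [← natDegree_map_eq_of_injective (algebraMap ℤ ℚ).injective_int, ← hmQ]
    refine (natDegree_minpoly_le_of_mem_adjoin ?_).trans h.degree
    exact mul_mem (natCast_mem _ c) (IntermediateField.mem_adjoin_simple_self ℚ α)
  have hroot : ∀ r : ℤ, m.eval r = 0 → (r : Qbar) = c * α := by
    intro r hr
    have : (minpoly ℚ ((c : Qbar) * α)).IsRoot (r : ℚ) := by
      rw [hmQ, IsRoot, ← eq_intCast (algebraMap ℤ ℚ) r, eval_map_algebraMap,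
        aeval_algebraMap_apply_eq_algebraMap_eval, hr, map_zero]
    have := minpoly.root (isIntegral_rat_Qbar _) this
    simpa using this
  have hcoeff : ∀ i, (m.coeff i).natAbs ≤ (N * N) ^ N * 2 ^ N := by
    intro i
    have hb := coeff_bdd_of_roots_le (B := (N * N : ℕ)) (d := N) (algebraMap ℤ ℂ) hmon
      (IsAlgClosed.splits _) hdeg (by
        intro z hz
        have hz' : z ∈ (minpoly ℚ ((c : Qbar) * α)).rootSet ℂ := by
          rw [mem_rootSet, hmQ, aeval_map_algebraMap]
          rw [mem_roots', IsRoot, eval_map_algebraMap] at hz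
          exact ⟨(hmon.map _).ne_zero, hz.2⟩
        rw [← Algebra.IsAlgebraic.range_eval_eq_rootSet_minpoly] at hz'
        obtain ⟨ψ, rfl⟩ := hz'
        have h1 := h.norm (ψ : Qbar →+* ℂ)
        simp only [map_mul, map_natCast, norm_mul, Complex.norm_natCast, Nat.cast_mul]
        gcongr
        exact h1) i
    rw [coeff_map] at hb
    simp only [algebraMap_int_eq, eq_intCast, Complex.norm_intCast] at hb
    have h1 : (max ((N * N : ℕ) : ℝ) 1) = ((N * N : ℕ) : ℝ) :=
      max_eq_left (by exact_mod_cast Nat.mul_pos hN hN)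
    rw [h1, ← Int.cast_abs, Int.abs_eq_natAbs] at hb
    have hb' : (m.coeff i).natAbs ≤ (N * N) ^ N * N.choose (N / 2) := by exact_mod_cast hb
    exact hb'.trans (Nat.mul_le_mul_left _ (Nat.choose_le_two_pow _ _))
  have hev : ∀ r : ℤ, (m.comp (C (c : ℤ) * X)).eval r = m.eval (c * r) := by
    intro r
    simp [eval_comp]
  refine ⟨m.comp (C (c : ℤ) * X), ?_, ?_, ?_, ?_, ?_⟩
  · intro h0
    rw [comp_C_mul_X_eq_zero_iff] at h0
    · exact hmon.ne_zero h0
    · simpa using hc0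
  · refine (size_le_of_natDegree_le (d := N) (c := (N * N) ^ N * 2 ^ N * N ^ N) ?_ ?_).trans
      (le_of_eq (by ring))
    · refine natDegree_comp_le.trans ?_
      have : (C (c : ℤ) * X : ℤ[X]).natDegree ≤ 1 := (natDegree_C_mul_le _ _).trans natDegree_X_le
      nlinarith
    · intro i
      rw [comp_C_mul_X_coeff]
      rcases lt_or_ge N i with hi | hi
      · rw [coeff_eq_zero_of_natDegree_lt (hdeg.trans_lt hi), zero_mul, size_zero]
        exact Nat.zero_le _
      · refine (size_mul_le _ _).trans (Nat.mul_le_mul (hcoeff i) ?_)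
        refine (size_pow_le _ _).trans ?_
        rw [size_int, Int.natAbs_natCast]
        exact (Nat.pow_le_pow_left hcN i).trans (Nat.pow_le_pow_right hN hi)
  · rw [aeval_comp]
    simpa only [map_mul, aeval_C, aeval_X, map_natCast] using minpoly.aeval ℤ ((c : Qbar) * α)
  · intro h0
    rw [hev, mul_zero] at h0
    have := hroot _ h0
    simpa [hcQ] using this.symm
  · intro h0
    rw [hev, mul_one] at h0
    have := hroot _ h0
    rw [Int.cast_natCast] at this
    exact (mul_left_cancel₀ hcQ (by rw [mul_one]; exact this)).symm

theorem IsBdd.add {N : ℕ} {α β : Qbar} (ha : IsBdd N α) (hb : IsBdd N β) :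
    IsBdd (2 * (N * N)) (α + β) where
  degree := by
    refine (natDegree_minpoly_le_mul (α := α) (β := β) ?_).trans
      ((Nat.mul_le_mul ha.degree hb.degree).trans (Nat.le_mul_of_pos_left _ two_pos))
    exact add_mem
      ((le_sup_left : _ ≤ IntermediateField.adjoin ℚ {α} ⊔ _)
        (IntermediateField.mem_adjoin_simple_self ℚ α))
      ((le_sup_right : _ ≤ _ ⊔ IntermediateField.adjoin ℚ {β})
        (IntermediateField.mem_adjoin_simple_self ℚ β))
  den := by
    obtain ⟨c, h0, h1, h2⟩ := ha.den
    obtain ⟨c', h0', h1', h2'⟩ := hb.den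
    refine ⟨c * c', mul_ne_zero h0 h0',
      (Nat.mul_le_mul h1 h1').trans (Nat.le_mul_of_pos_left _ two_pos), ?_⟩
    have hnat : ∀ k : ℕ, IsIntegral ℤ (k : Qbar) := fun k => by
      simpa using isIntegral_algebraMap (R := ℤ) (A := Qbar) (x := (k : ℤ))
    have e : ((c * c' : ℕ) : Qbar) * (α + β) = c' * (c * α) + c * (c' * β) := by
      push_cast
      ring
    rw [e]
    exact ((hnat c').mul h2).add ((hnat c).mul h2')
  norm φ := by
    rw [map_add]
    have hN : (1 : ℝ) ≤ N := by exact_mod_cast ha.pos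
    refine (norm_add_le _ _).trans ((add_le_add (ha.norm φ) (hb.norm φ)).trans ?_)
    push_cast
    nlinarith

theorem IsBdd.pow {N : ℕ} {α : Qbar} (ha : IsBdd N α) (k : ℕ) : IsBdd (N ^ k + N) (α ^ k) where
  degree := (natDegree_minpoly_le_of_mem_adjoin
    (pow_mem (IntermediateField.mem_adjoin_simple_self ℚ α) k)).trans
      (ha.degree.trans (Nat.le_add_left _ _))
  den := by
    obtain ⟨c, h0, h1, h2⟩ := ha.den
    refine ⟨c ^ k, pow_ne_zero _ h0, (Nat.pow_le_pow_left h1 k).trans (Nat.le_add_right _ _), ?_⟩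
    rw [Nat.cast_pow, ← mul_pow]
    exact h2.pow k
  norm φ := by
    rw [map_pow, norm_pow]
    push_cast
    exact (pow_le_pow_left₀ (norm_nonneg _) (ha.norm φ) k).trans
      (le_add_of_nonneg_right (Nat.cast_nonneg _))

theorem size_reverse_le (p : ℤ[X]) : size p.reverse ≤ (size p + 1) * (size p * 2 ^ size p) := by
  refine size_le_of_natDegree_le ((reverse_natDegree_le p).trans (natDegree_le_size p)) fun i => ?_
  rw [coeff_reverse]
  exact size_coeff_le p _

theorem IsBdd.inv : ∃ F : ℕ → ℕ, Primrec F ∧ ∀ (N : ℕ) (α : Qbar), IsBdd N α →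
    IsBdd (F N) α⁻¹ := by
  obtain ⟨F, hF, h⟩ := IsBdd.exists_poly
  refine ⟨fun N => (F N + 1) * (F N * 2 ^ F N) + 1 + N, ?_, fun N α hα => ?_⟩
  · apply_rules [primrec_nat_mul, primrec_nat_add, primrec_nat_pow, Primrec.id, Primrec.const]
  -- The summand `N` in the bound serves `α = 0`, whose inverse is `0`; otherwise the reversed
  -- polynomial vanishes at `α⁻¹`.
  rcases eq_or_ne α 0 with rfl | h0
  · rw [inv_zero]
    exact hα.mono (Nat.le_add_left _ _)
  obtain ⟨p, hp, hs, hr, -, -⟩ := h N α hα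
  refine (IsBdd.of_root (p := p.reverse) (by simpa using hp)
    ((size_reverse_le p).trans ?_) ?_).mono (Nat.le_add_right _ _)
  · gcongr; norm_num
  · let := invertibleOfNonzero h0
    rw [aeval_def, ← invOf_eq_inv α, eval₂_reverse_eq_zero_iff]
    exact hr

theorem size_expand_le {p : ℤ[X]} {n N : ℕ} (hn : n ≠ 0) (hN : n ≤ N) (hp : size p ≤ N) :
    size (expand ℤ n p) ≤ (N * N + 1) * (N * 2 ^ (N * N)) := by
  refine size_le_of_natDegree_le ?_ fun i => ?_
  · rw [natDegree_expand]
    exact Nat.mul_le_mul ((natDegree_le_size p).trans hp) hN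
  · rw [coeff_expand (Nat.pos_of_ne_zero hn)]
    split_ifs
    · exact (size_coeff_le p _).trans hp
    · rw [size_zero]
      exact Nat.zero_le _

theorem IsBdd.of_pow : ∃ F : ℕ → ℕ, Primrec F ∧ ∀ (N n : ℕ) (α : Qbar), n ≠ 0 → n ≤ N →
    IsBdd N (α ^ n) → IsBdd (F N) α := by
  obtain ⟨F, hF, h⟩ := IsBdd.exists_poly
  refine ⟨fun N => ((F N + N) * (F N + N) + 1) * ((F N + N) * 2 ^ ((F N + N) * (F N + N))) + 1, ?_,
    fun N n α hn hnN hα => ?_⟩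
  · apply_rules [primrec_nat_mul, primrec_nat_add, primrec_nat_pow, Primrec.id, Primrec.const]
  obtain ⟨p, hp, hs, hr, -, -⟩ := h N _ hα
  refine IsBdd.of_root (p := expand ℤ n p) ?_
    (size_expand_le hn (hnN.trans (Nat.le_add_left _ _)) (hs.trans (Nat.le_add_right _ _))) ?_
  · rwa [Ne, expand_eq_zero (Nat.pos_of_ne_zero hn)]
  · rwa [expand_aeval]

theorem IsBdd.aeval {N : ℕ} {α : Qbar} (ha : IsBdd N α) {p : ℤ[X]} (hp : size p ≤ N) :
    IsBdd (N * N ^ N + N) (aeval α p) where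
  degree := (natDegree_minpoly_le_of_mem_adjoin (by
    rw [aeval_eq_sum_range]
    exact sum_mem fun i _ => zsmul_mem
      (pow_mem (IntermediateField.mem_adjoin_simple_self ℚ α) i) _)).trans
      (ha.degree.trans (Nat.le_add_left _ _))
  den := by
    obtain ⟨c, h0, h1, h2⟩ := ha.den
    refine ⟨c ^ N, pow_ne_zero _ h0, ?_, ?_⟩
    · refine (Nat.pow_le_pow_left h1 N).trans ?_
      have := Nat.le_mul_of_pos_left (N ^ N) ha.pos
      omega
    · rw [aeval_eq_sum_range, Finset.mul_sum]
      refine IsIntegral.sum _ fun i hi => ?_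
      have hi' : i ≤ N := (Finset.mem_range_succ_iff.mp hi).trans ((natDegree_le_size p).trans hp)
      have hz : ∀ k : ℤ, IsIntegral ℤ (k : Qbar) := fun k => by
        simpa using isIntegral_algebraMap (R := ℤ) (A := Qbar) (x := k)
      have := (hz (p.coeff i * c ^ (N - i))).mul (h2.pow i)
      convert this using 1
      rw [zsmul_eq_mul, mul_pow]
      push_cast
      have : (c : Qbar) ^ N = c ^ (N - i) * c ^ i := by rw [← pow_add, Nat.sub_add_cancel hi']
      rw [this]
      ring
  norm φ := by
    have hN : (1 : ℝ) ≤ N := by exact_mod_cast ha.pos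
    rw [aeval_eq_sum_range, map_sum]
    refine (norm_sum_le _ _).trans ?_
    have : ∀ i ∈ Finset.range (p.natDegree + 1), ‖φ (p.coeff i • α ^ i)‖ ≤
        ((size (p.coeff i) * 2 ^ i : ℕ) : ℝ) * (N : ℝ) ^ N := by
      intro i hi
      have hi' : i ≤ N := (Finset.mem_range_succ_iff.mp hi).trans ((natDegree_le_size p).trans hp)
      rw [zsmul_eq_mul, map_mul, map_pow, map_intCast, norm_mul, norm_pow, Complex.norm_intCast]
      refine mul_le_mul ?_ ?_ (by positivity) (by positivity)
      · rw [← Int.cast_abs, Int.abs_eq_natAbs, Int.cast_natCast]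
        exact_mod_cast Nat.le_mul_of_pos_right _ (by positivity)
      · exact (pow_le_pow_left₀ (norm_nonneg _) (ha.norm φ) i).trans (pow_le_pow_right₀ hN hi')
    refine (Finset.sum_le_sum this).trans ?_
    rw [← Finset.sum_mul, ← Nat.cast_sum, ← size_poly_eq_sum (p := p)]
    · push_cast
      refine le_trans ?_ (le_add_of_nonneg_right (Nat.cast_nonneg _))
      gcongr
    · intro i hi
      exact Finset.mem_range_succ_iff.mpr (le_natDegree_of_mem_supp i hi)

/-! ### Heights -/

section NumberField

open NumberField Height

variable {K : Type*} [Field K] [NumberField K]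

/-- An integral element has absolute value at most one at all finite places, and the multiplicities
of the infinite places add up to the degree. -/
theorem mulHeight₁_le_of_isIntegral {β : K} (hβ : IsIntegral ℤ β) {B : ℝ} (hB : 1 ≤ B)
    (h : ∀ v : InfinitePlace K, v β ≤ B) : mulHeight₁ β ≤ B ^ Module.finrank ℚ K := by
  have hfin : ∏ᶠ v : FinitePlace K, max (v β) 1 = 1 := by
    refine finprod_eq_one_of_forall_eq_one fun v => max_eq_right ?_
    rw [← FinitePlace.norm_embedding_eq]
    exact FinitePlace.norm_le_one K v.maximalIdeal (⟨β, hβ⟩ : 𝓞 K)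
  rw [NumberField.mulHeight₁_eq, hfin, mul_one, ← InfinitePlace.sum_mult_eq,
    ← Finset.prod_pow_eq_pow_sum]
  exact Finset.prod_le_prod (fun v _ => by positivity) fun v _ =>
    pow_le_pow_left₀ (by positivity) (max_le (h v) hB) _

theorem infinitePlace_le_mulHeight₁ (β : K) (v : InfinitePlace K) : v β ≤ mulHeight₁ β := by
  rw [NumberField.mulHeight₁_eq]
  have h1 : ∀ w : InfinitePlace K, 1 ≤ max (w β) 1 ^ w.mult := fun w =>
    one_le_pow₀ (le_max_right _ _)
  have hprod : ∀ s : Finset (InfinitePlace K), 1 ≤ ∏ w ∈ s, max (w β) 1 ^ w.mult := fun s =>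
    Finset.prod_induction _ (fun r : ℝ => 1 ≤ r)
      (fun a b ha hb => one_le_mul_of_one_le_of_one_le ha hb) le_rfl fun w _ => h1 w
  have h2 : (1 : ℝ) ≤ ∏ᶠ v : FinitePlace K, max (v β) 1 := by
    refine finprod_induction (fun r : ℝ => 1 ≤ r) le_rfl
      (fun a b ha hb => one_le_mul_of_one_le_of_one_le ha hb) fun w => le_max_right _ _
  have h3 : v β ≤ ∏ w : InfinitePlace K, max (w β) 1 ^ w.mult := by
    classical
    rw [← Finset.mul_prod_erase _ _ (Finset.mem_univ v)]
    refine le_trans ((le_max_left _ _).trans (le_self_pow₀ (le_max_right _ _) v.mult_ne_zero))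
      (le_mul_of_one_le_right (zero_le_one.trans (h1 v)) (hprod _))
  exact h3.trans (le_mul_of_one_le_right
    (zero_le_one.trans (hprod _)) h2)

end NumberField

/-- Write `α` as the quotient of the algebraic integers `c α` and `c`. Their multiplicative heights,
per degree, are at most `N ^ 2` and `N`, so that of `α` is at most `N ^ 3`; finally `log N ≤ N`. -/
theorem pointHeight_le {N : ℕ} {α : Qbar} {c : ℕ} (hc0 : c ≠ 0) (hc : c ≤ N)
    (hInt : IsIntegral ℤ ((c : Qbar) * α)) (h : ∀ φ : Qbar →+* ℂ, ‖φ α‖ ≤ N) :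
    pointHeight (α : OnePoint Qbar) ≤ 3 * N := by
  set K := IntermediateField.adjoin ℚ {α} with hK
  set β : K := IntermediateField.AdjoinSimple.gen ℚ α with hβ
  have hN : (1 : ℝ) ≤ N := by exact_mod_cast (Nat.one_le_iff_ne_zero.mpr hc0).trans hc
  have hcK : (c : K) ≠ 0 := Nat.cast_ne_zero.mpr hc0
  have hcv : ∀ v : NumberField.InfinitePlace K, v (c : K) ≤ N := by
    intro v
    rw [← NumberField.InfinitePlace.norm_embedding_eq, map_natCast, Complex.norm_natCast]
    exact_mod_cast hc
  have hβv : ∀ v : NumberField.InfinitePlace K, v β ≤ N := by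
    intro v
    -- The hypothesis concerns embeddings of `Qbar`, so the embedding of `ℚ(α)` attached to `v` is
    -- extended to `Qbar`.
    let ψ : Qbar →+* ℂ :=
      letI := v.embedding.toAlgebra
      (IsAlgClosed.lift (R := K) (S := Qbar) (M := ℂ)).toRingHom
    have hψ : ψ α = v.embedding β := by
      let := v.embedding.toAlgebra
      exact (IsAlgClosed.lift (R := K) (S := Qbar) (M := ℂ)).commutes β
    rw [← NumberField.InfinitePlace.norm_embedding_eq, ← hψ]
    exact h ψ
  have hInt' : IsIntegral ℤ ((c : K) * β) := by
    have hinj : Function.Injective (algebraMap K Qbar) := (algebraMap K Qbar).injective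
    rw [← isIntegral_algebraMap_iff (R := ℤ) hinj]
    simpa [hβ] using hInt
  have hIntc : IsIntegral ℤ (c : K) := by
    simpa using isIntegral_algebraMap (R := ℤ) (A := K) (x := (c : ℤ))
  have h1 : Height.mulHeight₁ ((c : K) * β) ≤ ((N : ℝ) * N) ^ Module.finrank ℚ K := by
    refine mulHeight₁_le_of_isIntegral hInt' (by nlinarith) fun v => ?_
    rw [map_mul]
    exact mul_le_mul (hcv v) (hβv v) (apply_nonneg v _) (by positivity)
  have h2 : Height.mulHeight₁ (c : K) ≤ (N : ℝ) ^ Module.finrank ℚ K :=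
    mulHeight₁_le_of_isIntegral hIntc hN hcv
  have h3 : Height.mulHeight₁ β ≤ ((N : ℝ) ^ 3) ^ Module.finrank ℚ K := by
    have : β = (c : K) * β * (c : K)⁻¹ := by field_simp
    rw [this]
    refine (Height.mulHeight₁_mul_le _ _).trans ?_
    rw [Height.mulHeight₁_inv]
    refine (mul_le_mul h1 h2 (Height.mulHeight₁_nonneg _) (by positivity)).trans_eq ?_
    rw [← mul_pow]
    ring
  have hpos : (0 : ℝ) < Module.finrank ℚ K := by exact_mod_cast Module.finrank_pos
  change Height.logHeight₁ β / Module.finrank ℚ K ≤ 3 * N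
  rw [div_le_iff₀ hpos, Height.logHeight₁_eq_log_mulHeight₁]
  refine (Real.log_le_log (Height.mulHeight₁_pos _) h3).trans ?_
  rw [Real.log_pow, Real.log_pow]
  have := Real.log_le_self (zero_le_one.trans hN)
  push_cast
  nlinarith

theorem IsBdd.pointHeight_le {N : ℕ} {α : Qbar} (h : IsBdd N α) :
    pointHeight (α : OnePoint Qbar) ≤ 3 * N := by
  obtain ⟨c, h0, h1, h2⟩ := h.den
  exact FermatCurve.pointHeight_le h0 h1 h2 h.norm

/-- The relative logarithmic height is at most `N * N`, so the multiplicative one is at most `e ^ (N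
* N) ≤ 3 ^ (N * N)`. It dominates a suitable denominator and every archimedean absolute value. -/
theorem IsBdd.of_pointHeight_le {N : ℕ} {α : Qbar} (hd : pointDegree (α : OnePoint Qbar) ≤ N)
    (hh : pointHeight (α : OnePoint Qbar) ≤ N) : IsBdd (3 ^ (N * N) + N) α := by
  set K := IntermediateField.adjoin ℚ {α} with hK
  set β : K := IntermediateField.AdjoinSimple.gen ℚ α with hβ
  change Module.finrank ℚ K ≤ N at hd
  change Height.logHeight₁ β / Module.finrank ℚ K ≤ N at hh
  have hpos : (0 : ℝ) < Module.finrank ℚ K := by exact_mod_cast Module.finrank_pos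
  have hM : Height.mulHeight₁ β ≤ ((3 ^ (N * N) : ℕ) : ℝ) := by
    rw [div_le_iff₀ hpos] at hh
    have h1 : Height.logHeight₁ β ≤ (N * N : ℕ) := by
      refine hh.trans ?_
      push_cast
      gcongr
    rw [Height.logHeight₁_eq_log_mulHeight₁, Real.log_le_iff_le_exp (Height.mulHeight₁_pos _)] at h1
    refine h1.trans ?_
    rw [← Real.exp_one_pow]
    push_cast
    exact pow_le_pow_left₀ (Real.exp_pos _).le (Real.exp_one_lt_three.le) _
  refine ⟨?_, ?_, fun φ => ?_⟩
  · rw [← IntermediateField.adjoin.finrank (isIntegral_rat_Qbar α)]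
    exact hd.trans (Nat.le_add_left _ _)
  · obtain ⟨c, h0, h1, h2⟩ := NumberField.exists_nat_le_mulHeight₁ β
    refine ⟨c, h0, ?_, ?_⟩
    · have : c ≤ 3 ^ (N * N) := by exact_mod_cast h1.trans hM
      omega
    · have := h2.map (algebraMap K Qbar).toIntAlgHom
      simpa [hβ] using this
  · have h1 := infinitePlace_le_mulHeight₁ β
      (NumberField.InfinitePlace.mk (φ.comp (algebraMap K Qbar)))
    rw [NumberField.InfinitePlace.apply] at h1
    have h2 : (φ.comp (algebraMap K Qbar)) β = φ α := rfl
    rw [h2] at h1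
    refine (h1.trans hM).trans ?_
    exact_mod_cast Nat.le_add_right _ _

/-- Dividing a nonzero vector by the gcd of its entries does not change the height and does not
enlarge the entries; for a primitive vector the height is the logarithm of the largest entry. -/
theorem logHeight_intCast_le {ι : Type*} [Fintype ι] [Nonempty ι] {N : ℕ} (z : ι → ℤ)
    (h : ∀ i, (z i).natAbs ≤ N) : Height.logHeight (fun i => (z i : ℚ)) ≤ N := by
  obtain ⟨w, hw, hg⟩ := Finset.extract_gcd z Finset.univ_nonempty
  set g := Finset.univ.gcd z
  have hz : (fun i => (z i : ℚ)) = (g : ℚ) • (((↑) : ℤ → ℚ) ∘ w) := by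
    funext i
    simp [hw i (Finset.mem_univ i)]
  rcases eq_or_ne g 0 with h0 | h0
  · rw [hz, h0]
    simp [Height.logHeight_zero]
  rw [hz, Height.logHeight_smul_eq_logHeight _ (Int.cast_ne_zero.mpr h0),
    Rat.logHeight_eq_max_abs_of_gcd_eq_one hg]
  have hle : (⨆ i, |w i|) ≤ (N : ℤ) := by
    refine ciSup_le fun i => ?_
    have h1 := h i
    rw [hw i (Finset.mem_univ i), Int.natAbs_mul] at h1
    have h2 : 1 ≤ g.natAbs := Int.natAbs_pos.mpr h0
    rw [Int.abs_eq_natAbs]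
    exact_mod_cast (Nat.le_mul_of_pos_left _ h2).trans h1
  have h0' : 0 ≤ ⨆ i, |w i| := by
    obtain ⟨i⟩ := ‹Nonempty ι›
    exact (abs_nonneg (w i)).trans (Finite.le_ciSup (fun i => |w i|) i)
  refine (Real.log_le_self (by exact_mod_cast h0')).trans ?_
  exact_mod_cast hle

theorem polyHeight_le {p : ℤ[X]} {N : ℕ} (h : size p ≤ N) : polyHeight p ≤ N :=
  logHeight_intCast_le (fun k : Fin (p.natDegree + 1) => p.coeff k) fun _ =>
    (natAbs_coeff_le_size p _).trans h

theorem pairHeight_le {p r : ℤ[X]} {N : ℕ} (hp : size p ≤ N) (hr : size r ≤ N) :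
    pairHeight p r ≤ N := by
  have := logHeight_intCast_le (Sum.elim (fun k : Fin (p.natDegree + 1) => p.coeff k)
    fun k : Fin (r.natDegree + 1) => r.coeff k) (by
      rintro (k | k)
      · exact (natAbs_coeff_le_size p _).trans hp
      · exact (natAbs_coeff_le_size r _).trans hr)
  convert this using 1
  refine congrArg Height.logHeight (funext fun k => ?_)
  rcases k with k | k <;> rfl

/-! ### Reduced fractions and squarefree polynomials of bounded size -/

/-- Take the primitive part of the minimal polynomial after clearing denominators; by Gauss's lemma,
divisibility over `ℚ` descends to `ℤ`. Through this, coprimality in `ℤ[X]` excludes common complex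
roots. -/
theorem exists_isPrimitive_dvd_of_root {z : ℂ} (hz : IsIntegral ℚ z) :
    ∃ m : ℤ[X], aeval z m = 0 ∧ ∀ p : ℤ[X], aeval z p = 0 → m ∣ p := by
  set M := IsLocalization.integerNormalization (nonZeroDivisors ℤ) (minpoly ℚ z) with hM
  obtain ⟨b, hbM, hb⟩ := IsLocalization.integerNormalization_spec (nonZeroDivisors ℤ) (minpoly ℚ z)
  have hb0 : (b : ℚ) ≠ 0 := Int.cast_ne_zero.mpr (nonZeroDivisors.ne_zero hbM)
  have hm0 : minpoly ℚ z ≠ 0 := minpoly.ne_zero hz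
  have hb' : M.map (algebraMap ℤ ℚ) = C (b : ℚ) * minpoly ℚ z := by
    rw [hM, hb]
    ext i
    simp
  have hM0 : M ≠ 0 := by
    intro h
    rw [h, Polynomial.map_zero] at hb'
    exact mul_ne_zero (C_ne_zero.mpr hb0) hm0 hb'.symm
  have hc0 : ((M.content : ℤ) : ℚ) ≠ 0 := Int.cast_ne_zero.mpr (by rwa [Ne, content_eq_zero_iff])
  have hprim : M.primPart.map (algebraMap ℤ ℚ) =
      C ((M.content : ℚ)⁻¹ * (b : ℚ)) * minpoly ℚ z := by
    have h1 : C ((M.content : ℤ) : ℚ) * M.primPart.map (algebraMap ℤ ℚ) =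
        C (b : ℚ) * minpoly ℚ z := by
      rw [← hb']
      conv_rhs => rw [M.eq_C_content_mul_primPart]
      simp
    rw [C_mul, mul_assoc, ← h1, ← mul_assoc, ← C_mul, inv_mul_cancel₀ hc0, C_1, one_mul]
  refine ⟨M.primPart, ?_, fun p hp => ?_⟩
  · rw [← aeval_map_algebraMap ℚ, hprim, map_mul, minpoly.aeval, mul_zero]
  · refine (IsPrimitive.Int.dvd_iff_map_cast_dvd_map_cast _ _ M.isPrimitive_primPart).mpr ?_
    change M.primPart.map (algebraMap ℤ ℚ) ∣ p.map (algebraMap ℤ ℚ)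
    have hu : IsUnit (C ((M.content : ℚ)⁻¹ * (b : ℚ))) :=
      isUnit_C.mpr (mul_ne_zero (inv_ne_zero hc0) hb0).isUnit
    rw [hprim, hu.mul_left_dvd]
    exact minpoly.dvd _ _ (by rwa [aeval_map_algebraMap])

/-- The Mahler measure is multiplicative and at least one on nonzero integral polynomials, so that
of the factor `g` is at most that of `p`, hence at most the sum of the absolute values of the
coefficients of `p`. The coefficients of `g` are bounded by its Mahler measure times binomial
coefficients. -/
theorem size_le_of_dvd {p g : ℤ[X]} (hp : p ≠ 0) (h : g ∣ p) :
    size g ≤ (size p + 1) * ((2 ^ size p * size p) * 2 ^ size p) := by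
  obtain ⟨r, rfl⟩ := h
  have hr : r ≠ 0 := right_ne_zero_of_mul hp
  have hd : g.natDegree ≤ size (g * r) := (natDegree_le_of_dvd (dvd_mul_right g r) hp).trans
    (natDegree_le_size _)
  refine size_le_of_natDegree_le hd fun i => ?_
  have h1 := norm_coeff_le_choose_mul_mahlerMeasure_of_one_le_mahlerMeasure i
    (g.map (Int.castRingHom ℂ)) (r.map (Int.castRingHom ℂ)) (one_le_mahlerMeasure_of_ne_zero hr)
  rw [← Polynomial.map_mul, coeff_map, eq_intCast, Complex.norm_intCast] at h1
  have h2 : ((g * r).map (Int.castRingHom ℂ)).mahlerMeasure ≤ size (g * r) := by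
    refine (mahlerMeasure_le_sum_norm_coeff _).trans ?_
    rw [Polynomial.sum_def, size_poly_eq_sum (s := (g * r).support) subset_rfl, Nat.cast_sum]
    refine (Finset.sum_le_sum_of_subset_of_nonneg (support_map_subset _ _)
      fun _ _ _ => norm_nonneg _).trans (Finset.sum_le_sum fun j _ => ?_)
    rw [coeff_map, eq_intCast, Complex.norm_intCast, ← Int.cast_abs, Int.abs_eq_natAbs,
      Int.cast_natCast]
    exact_mod_cast Nat.le_mul_of_pos_right _ (by positivity)
  have h3 : ((g.map (Int.castRingHom ℂ)).natDegree.choose i : ℝ) ≤ 2 ^ size (g * r) := by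
    have : (g.map (Int.castRingHom ℂ)).natDegree.choose i ≤ 2 ^ size (g * r) :=
      (Nat.choose_le_two_pow _ _).trans
        (Nat.pow_le_pow_right two_pos (natDegree_map_le.trans hd))
    exact_mod_cast this
  have h4 : |((g.coeff i : ℤ) : ℝ)| ≤ 2 ^ size (g * r) * size (g * r) :=
    h1.trans (mul_le_mul h3 h2 (mahlerMeasure_nonneg _) (by positivity))
  rw [← Int.cast_abs, Int.abs_eq_natAbs, Int.cast_natCast] at h4
  exact_mod_cast h4

/-- Cancel the greatest common divisor in the factorial ring `ℤ[X]`. As this includes common integer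
factors, the pair becomes primitive; and as `a` and `q` divide `p` and `Q`, their sizes are
controlled by `size_le_of_dvd`. -/
theorem exists_reduced_fraction : ∃ F : ℕ → ℕ, Primrec F ∧ ∀ (N : ℕ) (p Q : ℤ[X]), Q ≠ 0 →
    size p ≤ N → size Q ≤ N → ∃ a q : ℤ[X], q ≠ 0 ∧ q ∣ Q ∧ p * q = a * Q ∧
      (∀ r : ℤ, C r ∣ a → C r ∣ q → IsUnit r) ∧
      (∀ z : ℂ, ¬ (aeval z a = 0 ∧ aeval z q = 0)) ∧ size a ≤ F N ∧ size q ≤ F N := by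
  refine ⟨fun N => (N + 1) * ((2 ^ N * N) * 2 ^ N), ?_, fun N p Q hQ hp hQN => ?_⟩
  · apply_rules [primrec_nat_mul, primrec_nat_add, primrec_nat_pow, Primrec.id, Primrec.const]
  obtain ⟨q, a, g, hrel, rfl, rfl⟩ := UniqueFactorizationMonoid.exists_reduced_factors Q hQ p
  have hq : q ≠ 0 := right_ne_zero_of_mul hQ
  have hmono : ∀ M : ℕ, M ≤ N → (M + 1) * ((2 ^ M * M) * 2 ^ M) ≤
      (N + 1) * ((2 ^ N * N) * 2 ^ N) := by
    intro M hM
    gcongr <;> norm_num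
  refine ⟨a, q, hq, dvd_mul_left _ _, by ring, fun r ha hq => ?_, fun z ⟨ha, hz⟩ => ?_, ?_, ?_⟩
  · exact isUnit_C.mp (hrel hq ha)
  · have hInt : IsIntegral ℚ z := by
      refine IsAlgebraic.isIntegral ⟨q.map (algebraMap ℤ ℚ), ?_, by rwa [aeval_map_algebraMap]⟩
      exact (Polynomial.map_ne_zero_iff (algebraMap ℤ ℚ).injective_int).mpr hq
    obtain ⟨m, hm, hdvd⟩ := exists_isPrimitive_dvd_of_root hInt
    obtain ⟨u, hu, rfl⟩ := Polynomial.isUnit_iff.mp (hrel (hdvd q hz) (hdvd a ha))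
    rw [aeval_C, map_eq_zero_iff _ (algebraMap ℤ ℂ).injective_int] at hm
    exact hu.ne_zero hm
  · rcases eq_or_ne a 0 with rfl | ha
    · rw [size_zero]
      exact Nat.zero_le _
    · exact (size_le_of_dvd (mul_ne_zero (left_ne_zero_of_mul hQ) ha)
        (dvd_mul_left a g)).trans (hmono _ hp)
  · exact (size_le_of_dvd hQ (dvd_mul_left q g)).trans (hmono _ hQN)

theorem size_derivative_le (p : ℤ[X]) : size (derivative p) ≤ size p * size p := by
  rw [derivative_apply, Polynomial.sum_def]
  refine (size_sum_le _ _).trans ?_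
  conv_rhs => rw [size_poly_eq_sum (p := p) (s := p.support) subset_rfl]
  rw [Finset.sum_mul]
  refine Finset.sum_le_sum fun i hi => ?_
  rw [C_mul_X_pow_eq_monomial, size_monomial, ← size_poly_eq_sum (p := p) subset_rfl]
  have h1 : size (p.coeff i * (i : ℤ)) ≤ size (p.coeff i) * size p := by
    refine (size_mul_le _ _).trans (Nat.mul_le_mul_left _ ?_)
    rw [size_int, Int.natAbs_natCast]
    exact (le_natDegree_of_mem_supp i hi).trans (natDegree_le_size p)
  calc size (p.coeff i * (i : ℤ)) * 2 ^ (i - 1)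
      ≤ size (p.coeff i) * size p * 2 ^ i :=
        Nat.mul_le_mul h1 (Nat.pow_le_pow_right two_pos (Nat.sub_le _ _))
    _ = _ := by ring

theorem aeval_Qbar_eq_zero_iff (φ : Qbar →+* ℂ) (z : Qbar) (p : ℤ[X]) :
    aeval (φ z) p = 0 ↔ aeval z p = 0 := by
  have : aeval (φ z) p = φ (aeval z p) := by
    rw [aeval_def, aeval_def, hom_eval₂, RingHom.ext_int (φ.comp (algebraMap ℤ Qbar))
      (algebraMap ℤ ℂ)]
  rw [this, map_eq_zero]

theorem nonempty_Qbar_ringHom : Nonempty (Qbar →+* ℂ) :=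
  ⟨(IsAlgClosed.lift (R := ℚ) (S := Qbar) (M := ℂ)).toRingHom⟩

/-- At a root of `U` the logarithmic derivative `U' / U` has a simple pole, so its reduced
denominator `s` has a simple zero there. This produces a squarefree polynomial with the roots of `U`
without factoring `U`. -/
theorem roots_simple_of_reduced_logDeriv {U a s : ℤ[X]} (hU : U ≠ 0) (hs : s ∣ U)
    (h : derivative U * s = a * U) (hz : ∀ z : Qbar, ¬ (aeval z a = 0 ∧ aeval z s = 0))
    {z : Qbar} (hr : aeval z U = 0) : aeval z s = 0 ∧ aeval z (derivative s) ≠ 0 := by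
  have hinj : Function.Injective (algebraMap ℤ Qbar) := (algebraMap ℤ Qbar).injective_int
  have hs0 : s ≠ 0 := ne_zero_of_dvd_ne_zero hU hs
  have hU' : U.map (algebraMap ℤ Qbar) ≠ 0 := (Polynomial.map_ne_zero_iff hinj).mpr hU
  have hs' : s.map (algebraMap ℤ Qbar) ≠ 0 := (Polynomial.map_ne_zero_iff hinj).mpr hs0
  have hroot : (U.map (algebraMap ℤ Qbar)).IsRoot z := by rwa [IsRoot, eval_map_algebraMap]
  have hm := derivative_rootMultiplicity_of_root hroot
  have hpos := (rootMultiplicity_pos hU').mpr hroot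
  have hd : derivative U ≠ 0 := by
    intro h0
    have h1 := derivative_eq_zero.mp h0
    rw [eq_C_of_natDegree_eq_zero h1, aeval_C, map_eq_zero_iff _ hinj] at hr
    rw [eq_C_of_natDegree_eq_zero h1, hr, C_0] at hU
    exact hU rfl
  have hd' : derivative (U.map (algebraMap ℤ Qbar)) ≠ 0 := by
    rw [derivative_map]
    exact (Polynomial.map_ne_zero_iff hinj).mpr hd
  have ha0 : a ≠ 0 := by
    rintro rfl
    rw [zero_mul] at h
    exact mul_ne_zero hd hs0 h
  have ha' : a.map (algebraMap ℤ Qbar) ≠ 0 := (Polynomial.map_ne_zero_iff hinj).mpr ha0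
  have hmul : derivative (U.map (algebraMap ℤ Qbar)) * s.map (algebraMap ℤ Qbar) =
      a.map (algebraMap ℤ Qbar) * U.map (algebraMap ℤ Qbar) := by
    rw [derivative_map, ← Polynomial.map_mul, h, Polynomial.map_mul]
  have hcount := congrArg (rootMultiplicity z) hmul
  rw [rootMultiplicity_mul (mul_ne_zero hd' hs'), rootMultiplicity_mul (mul_ne_zero ha' hU'),
    hm] at hcount
  have hsr : (s.map (algebraMap ℤ Qbar)).IsRoot z := by
    rw [← rootMultiplicity_pos hs']
    omega
  have hsz : aeval z s = 0 := by rwa [IsRoot, eval_map_algebraMap] at hsr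
  refine ⟨hsz, fun hdz => ?_⟩
  have ha1 : rootMultiplicity z (a.map (algebraMap ℤ Qbar)) = 0 := by
    refine rootMultiplicity_eq_zero fun har => hz z ⟨?_, hsz⟩
    rwa [IsRoot, eval_map_algebraMap] at har
  have : 1 < rootMultiplicity z (s.map (algebraMap ℤ Qbar)) := by
    rw [one_lt_rootMultiplicity_iff_isRoot hs']
    refine ⟨hsr, ?_⟩
    rwa [derivative_map, IsRoot, eval_map_algebraMap]
  omega

/-- A squarefree integral polynomial that vanishes at all algebraic numbers of complexity at most
`N` except `0` and `1`. -/
theorem exists_squarefree_poly : ∃ F : ℕ → ℕ, Primrec F ∧ ∀ N : ℕ, ∃ s : ℤ[X],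
    size s ≤ F N ∧ (∀ z : Qbar, IsBdd N z → z ≠ 0 → z ≠ 1 → aeval z s = 0) ∧
      s.eval 0 ≠ 0 ∧ s.eval 1 ≠ 0 ∧ ∀ z : Qbar, aeval z s = 0 → aeval z (derivative s) ≠ 0 := by
  classical
  obtain ⟨F, hF, hpoly⟩ := IsBdd.exists_poly
  obtain ⟨E, hE, hred⟩ := exists_reduced_fraction
  -- A bound for a product of at most `(2 * F N + 1) ^ (F N + 1)` factors, each of size at most `F N
  -- + 1`.
  let A : ℕ → ℕ := fun N => (F N + 1) ^ ((2 * F N + 1) ^ (F N + 1))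
  refine ⟨fun N => E (A N * A N), hE.comp ?_, fun N => ?_⟩
  · apply_rules [primrec_nat_mul, primrec_nat_add, primrec_nat_pow, Primrec.id, Primrec.const]
  obtain ⟨t, ht, hcard⟩ := exists_finset_size_le (F N)
  -- By the last two conclusions of `IsBdd.exists_poly`, every `z ≠ 0, 1` of complexity at most `N`
  -- is a root of one of these factors.
  set U : ℤ[X] := ∏ p ∈ t.filter fun p => p.eval 0 ≠ 0 ∧ p.eval 1 ≠ 0, p with hUdef
  have hU0 : U.eval 0 ≠ 0 := by
    rw [hUdef, eval_prod]
    exact Finset.prod_ne_zero_iff.mpr fun p hp => (Finset.mem_filter.mp hp).2.1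
  have hU1 : U.eval 1 ≠ 0 := by
    rw [hUdef, eval_prod]
    exact Finset.prod_ne_zero_iff.mpr fun p hp => (Finset.mem_filter.mp hp).2.2
  have hU : U ≠ 0 := by
    intro h
    rw [h, eval_zero] at hU0
    exact hU0 rfl
  have hsize : size U ≤ A N := by
    refine (size_prod_le _ _).trans ((Finset.prod_le_pow_card _ _ (F N + 1) fun p hp => ?_).trans ?_)
    · exact ((ht p).mpr (Finset.mem_filter.mp hp).1).trans (Nat.le_succ _)
    · exact Nat.pow_le_pow_right (Nat.succ_pos _) ((Finset.card_filter_le _ _).trans hcard)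
  have hA : 1 ≤ A N := Nat.pow_pos (Nat.succ_pos _)
  -- The polynomial `s` is the reduced denominator of `U' / U`.
  obtain ⟨a, s, hs0, hsU, hmul, -, hcop, -, hsize_s⟩ := hred (A N * A N) (derivative U) U hU
    ((size_derivative_le U).trans (Nat.mul_le_mul hsize hsize))
    (hsize.trans (Nat.le_mul_of_pos_left _ hA))
  have hcop' : ∀ z : Qbar, ¬ (aeval z a = 0 ∧ aeval z s = 0) := by
    obtain ⟨φ⟩ := nonempty_Qbar_ringHom
    rintro z ⟨h1, h2⟩
    exact hcop (φ z) ⟨(aeval_Qbar_eq_zero_iff φ z a).mpr h1, (aeval_Qbar_eq_zero_iff φ z s).mpr h2⟩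
  have hdvd : ∀ r : ℤ, U.eval r ≠ 0 → s.eval r ≠ 0 := by
    intro r hr h0
    obtain ⟨w, hw⟩ := hsU
    rw [hw, eval_mul, h0, zero_mul] at hr
    exact hr rfl
  refine ⟨s, hsize_s, fun z hz hz0 hz1 => ?_, hdvd 0 hU0, hdvd 1 hU1, fun z hz => ?_⟩
  · obtain ⟨p, -, hpN, hpz, h0, h1⟩ := hpoly N z hz
    refine (roots_simple_of_reduced_logDeriv hU hsU hmul hcop' ?_).1
    have hmem : p ∈ t.filter fun p => p.eval 0 ≠ 0 ∧ p.eval 1 ≠ 0 :=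
      Finset.mem_filter.mpr ⟨(ht p).mp hpN, fun h => hz0 (h0 h), fun h => hz1 (h1 h)⟩
    rw [hUdef, map_prod]
    exact Finset.prod_eq_zero hmem hpz
  · refine (roots_simple_of_reduced_logDeriv hU hsU hmul hcop' ?_).2
    obtain ⟨w, hw⟩ := hsU
    rw [hw, map_mul, hz, zero_mul]

/-! ### Images of algebraic numbers under polynomials and Möbius transformations -/

theorem norm_aeval_le (p : ℤ[X]) {z : ℂ} {R : ℝ} (hR : 1 ≤ R) (hz : ‖z‖ ≤ R) :
    ‖aeval z p‖ ≤ size p * R ^ p.natDegree := by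
  rw [aeval_eq_sum_range, size_poly_eq_sum (s := Finset.range (p.natDegree + 1)) fun i hi =>
    Finset.mem_range_succ_iff.mpr (le_natDegree_of_mem_supp i hi), Nat.cast_sum, Finset.sum_mul]
  refine norm_sum_le_of_le _ fun i hi => ?_
  rw [zsmul_eq_mul, norm_mul, norm_pow, Complex.norm_intCast]
  refine mul_le_mul ?_ ?_ (by positivity) (by positivity)
  · rw [← Int.cast_abs, Int.abs_eq_natAbs, Int.cast_natCast]
    exact_mod_cast Nat.le_mul_of_pos_right _ (by positivity)
  · exact (pow_le_pow_left₀ (norm_nonneg _) hz i).trans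
      (pow_le_pow_right₀ hR (Finset.mem_range_succ_iff.mp hi))

/-- The polynomial whose roots are the values of `p` at the roots of `l`. -/
def pushPoly (p l : ℤ[X]) : ℤ[X] :=
  resultant (l.map C) (C X - p.map C) l.natDegree p.natDegree

/-- The resultant eliminates `z` from `l(z) = 0` and `X = p(z)`; since `l` splits over `k`, it is a
product of the values of `X - p(z)` over the roots of `l`, up to a power of the leading coefficient.
-/
theorem pushPoly_map {k : Type*} [Field k] [CharZero k] [IsAlgClosed k] (p l : ℤ[X]) :
    (pushPoly p l).map (algebraMap ℤ k) = C ((l.leadingCoeff : k) ^ p.natDegree) *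
      ((l.map (algebraMap ℤ k)).roots.map fun b => X - C (aeval b p)).prod := by
  have hinj : Function.Injective (algebraMap ℤ k) := (algebraMap ℤ k).injective_int
  have hsp := IsAlgClosed.splits (l.map (algebraMap ℤ k))
  have hcomp : (mapRingHom (algebraMap ℤ k)).comp C = C.comp (algebraMap ℤ k) := by
    ext
    simp
  have hroots : ((l.map (algebraMap ℤ k)).map (C : k →+* k[X])).roots =
      (l.map (algebraMap ℤ k)).roots.map C :=
    (roots_map_of_injective_of_card_eq_natDegree C_injective
      hsp.natDegree_eq_card_roots.symm).symm
  have hdeg : l.natDegree = ((l.map (algebraMap ℤ k)).map (C : k →+* k[X])).natDegree := by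
    rw [natDegree_map_eq_of_injective C_injective, natDegree_map_eq_of_injective hinj]
  rw [← coe_mapRingHom, pushPoly, ← resultant_map_map, Polynomial.map_sub, Polynomial.map_map,
    Polynomial.map_map, hcomp, map_C, coe_mapRingHom, map_X, ← Polynomial.map_map,
    ← Polynomial.map_map, hdeg, resultant_eq_prod_eval _ _ _ ?_ (hsp.map C), hroots,
    Multiset.map_map, leadingCoeff_map_of_injective C_injective,
    leadingCoeff_map_of_injective hinj]
  · rw [C_pow]
    congr 2
    · refine Multiset.map_congr rfl fun b _ => ?_
      rw [Function.comp_apply, eval_sub, eval_C, eval_map, eval₂_hom, eval_map_algebraMap]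
  · refine (natDegree_sub_le _ _).trans ?_
    rw [natDegree_C, Nat.zero_max]
    exact natDegree_map_le.trans natDegree_map_le

theorem aeval_pushPoly_eq_zero_iff {k : Type*} [Field k] [CharZero k] [IsAlgClosed k]
    (p : ℤ[X]) {l : ℤ[X]} (hl : l ≠ 0) (w : k) :
    aeval w (pushPoly p l) = 0 ↔ ∃ z : k, aeval z l = 0 ∧ w = aeval z p := by
  have hl' : l.map (algebraMap ℤ k) ≠ 0 :=
    (Polynomial.map_ne_zero_iff (algebraMap ℤ k).injective_int).mpr hl
  rw [← eval_map_algebraMap, pushPoly_map, eval_mul, eval_C, mul_eq_zero,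
    or_iff_right (pow_ne_zero _ (Int.cast_ne_zero.mpr (leadingCoeff_ne_zero.mpr hl))),
    eval_multiset_prod, Multiset.prod_eq_zero_iff, Multiset.map_map, Multiset.mem_map]
  refine exists_congr fun z => ?_
  rw [mem_roots hl', IsRoot, eval_map_algebraMap]
  simp [sub_eq_zero]

theorem pushPoly_spec {p l : ℤ[X]} (hl : l ≠ 0) :
    pushPoly p l ≠ 0 ∧ (pushPoly p l).natDegree = l.natDegree := by
  have hinj : Function.Injective (algebraMap ℤ ℂ) := (algebraMap ℤ ℂ).injective_int
  have hc : (l.leadingCoeff : ℂ) ^ p.natDegree ≠ 0 :=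
    pow_ne_zero _ (Int.cast_ne_zero.mpr (leadingCoeff_ne_zero.mpr hl))
  have hm : ((l.map (algebraMap ℤ ℂ)).roots.map fun b => X - C (aeval b p)).prod.Monic :=
    monic_multiset_prod_of_monic _ _ fun b _ => monic_X_sub_C _
  have h := pushPoly_map (k := ℂ) p l
  constructor
  · intro h0
    rw [h0, Polynomial.map_zero] at h
    exact mul_ne_zero (C_ne_zero.mpr hc) hm.ne_zero h.symm
  · rw [← natDegree_map_eq_of_injective hinj, h, natDegree_C_mul hc,
      natDegree_multiset_prod_of_monic _ (by
        intro q hq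
        obtain ⟨b, -, rfl⟩ := Multiset.mem_map.mp hq
        exact monic_X_sub_C _), Multiset.map_map]
    simp only [Function.comp_def, natDegree_X_sub_C, Multiset.map_const', Multiset.sum_replicate,
      smul_eq_mul, mul_one]
    rw [← (IsAlgClosed.splits (l.map (algebraMap ℤ ℂ))).natDegree_eq_card_roots,
      natDegree_map_eq_of_injective hinj]

/-- The coefficients are estimated through the roots: these are the values `p(z)` with `‖z‖ ≤ N +
1`, so they are at most `N * (N + 1) ^ N` in absolute value. -/
theorem exists_size_pushPoly_le : ∃ F : ℕ → ℕ, Primrec F ∧ ∀ (N : ℕ) (p l : ℤ[X]), l ≠ 0 →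
    size p ≤ N → size l ≤ N → size (pushPoly p l) ≤ F N := by
  refine ⟨fun N => (N + 1) * (N ^ N * ((N * (N + 1) ^ N + 1) ^ N * 2 ^ N) * 2 ^ N), ?_,
    fun N p l hl hp hlN => ?_⟩
  · apply_rules [primrec_nat_mul, primrec_nat_add, primrec_nat_pow, Primrec.id, Primrec.const]
  have hN : 1 ≤ N := (size_pos hl).trans_le hlN
  have hl' : l.map (algebraMap ℤ ℂ) ≠ 0 :=
    (Polynomial.map_ne_zero_iff (algebraMap ℤ ℂ).injective_int).mpr hl
  have hdeg : (pushPoly p l).natDegree ≤ N :=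
    (pushPoly_spec hl).2.le.trans ((natDegree_le_size l).trans hlN)
  refine size_le_of_natDegree_le hdeg fun i => ?_
  set m := ((l.map (algebraMap ℤ ℂ)).roots.map fun b => X - C (aeval b p)).prod with hmdef
  have hm : m.Monic := monic_multiset_prod_of_monic _ _ fun b _ => monic_X_sub_C _
  have h := pushPoly_map (k := ℂ) p l
  rw [← hmdef] at h
  have hc : (l.leadingCoeff : ℂ) ^ p.natDegree ≠ 0 :=
    pow_ne_zero _ (Int.cast_ne_zero.mpr (leadingCoeff_ne_zero.mpr hl))
  have hmdeg : m.natDegree ≤ N := by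
    rw [← natDegree_C_mul hc, ← h]
    exact natDegree_map_le.trans hdeg
  have hb := coeff_bdd_of_roots_le (B := (N * (N + 1) ^ N + 1 : ℕ)) (d := N) (RingHom.id ℂ) hm
    (IsAlgClosed.splits _) hmdeg (by
      intro w hw
      rw [Polynomial.map_id] at hw
      have hw0 : aeval w (pushPoly p l) = 0 := by
        rw [← eval_map_algebraMap, h, eval_mul, (isRoot_of_mem_roots hw).eq_zero, mul_zero]
      obtain ⟨z, hz, rfl⟩ := (aeval_pushPoly_eq_zero_iff p hl w).mp hw0
      have hzN : ‖z‖ ≤ (N : ℝ) + 1 := (norm_le_size_of_root hl hz).trans (by gcongr)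
      refine (norm_aeval_le p (by linarith [N.cast_nonneg (α := ℝ)]) hzN).trans ?_
      push_cast
      refine le_trans (mul_le_mul (Nat.cast_le.mpr hp) (pow_le_pow_right₀
        (by linarith [N.cast_nonneg (α := ℝ)]) ((natDegree_le_size p).trans hp))
        (by positivity) (by positivity)) (by linarith)) i
  have hcoeff := congrArg (fun q => ‖q.coeff i‖) h
  simp only [coeff_map, coeff_C_mul, norm_mul, norm_pow, algebraMap_int_eq, eq_intCast,
    Complex.norm_intCast] at hcoeff
  rw [Polynomial.map_id, max_eq_left (by exact_mod_cast Nat.succ_pos _)] at hb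
  have hlc : |(l.leadingCoeff : ℝ)| ^ p.natDegree ≤ (N : ℝ) ^ N := by
    have h1 : |(l.leadingCoeff : ℝ)| ≤ N := by
      rw [← Int.cast_abs, Int.abs_eq_natAbs, Int.cast_natCast]
      exact_mod_cast (natAbs_coeff_le_size l _).trans hlN
    exact (pow_le_pow_left₀ (abs_nonneg _) h1 _).trans
      (pow_le_pow_right₀ (by exact_mod_cast hN) ((natDegree_le_size p).trans hp))
  have hch : (N.choose (N / 2) : ℝ) ≤ 2 ^ N := by exact_mod_cast Nat.choose_le_two_pow _ _
  have : |((pushPoly p l).coeff i : ℝ)| ≤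
      (N : ℝ) ^ N * (((N * (N + 1) ^ N + 1 : ℕ) : ℝ) ^ N * 2 ^ N) := by
    rw [hcoeff]
    refine mul_le_mul hlc (hb.trans ?_) (norm_nonneg _) (by positivity)
    gcongr
  rw [← Int.cast_abs, Int.abs_eq_natAbs, Int.cast_natCast] at this
  rw [size_int]
  exact_mod_cast this

/-- The numerator of `p (M X / (X - M))`. -/
def mobiusPoly (M : ℕ) (p : ℤ[X]) : ℤ[X] :=
  ∑ i ∈ Finset.range (p.natDegree + 1),
    C (p.coeff i * (M : ℤ) ^ i) * X ^ i * (X - C (M : ℤ)) ^ (p.natDegree - i)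

theorem natDegree_mobiusPoly_le (M : ℕ) (p : ℤ[X]) : (mobiusPoly M p).natDegree ≤ p.natDegree := by
  refine natDegree_sum_le_of_forall_le _ _ fun i hi => ?_
  refine natDegree_mul_le.trans ?_
  have h1 : (C (p.coeff i * (M : ℤ) ^ i) * X ^ i).natDegree ≤ i := natDegree_C_mul_X_pow_le _ _
  have h2 : ((X - C (M : ℤ)) ^ (p.natDegree - i)).natDegree ≤ p.natDegree - i := by
    rw [natDegree_pow, natDegree_X_sub_C, mul_one]
  have := Finset.mem_range_succ_iff.mp hi
  omega

/-- The transformation `z ↦ M z / (z - M)` is an involution, so this identifies the roots `w ≠ M`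
with the images of the roots of `p`. -/
theorem aeval_mobiusPoly {k : Type*} [Field k] (M : ℕ) (p : ℤ[X]) {w : k}
    (hw : w ≠ M) : aeval w (mobiusPoly M p) =
      (w - M) ^ p.natDegree * aeval (M * w / (w - M)) p := by
  have hw' : w - M ≠ 0 := sub_ne_zero.mpr hw
  rw [mobiusPoly, map_sum, aeval_eq_sum_range, Finset.mul_sum]
  refine Finset.sum_congr rfl fun i hi => ?_
  have hi' := Finset.mem_range_succ_iff.mp hi
  have : (w - M) ^ p.natDegree = (w - M) ^ (p.natDegree - i) * (w - M) ^ i := by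
    rw [← pow_add, Nat.sub_add_cancel hi']
  rw [this, div_pow, mul_pow, zsmul_eq_mul]
  simp only [map_mul, map_pow, aeval_C, aeval_X, map_sub, algebraMap_int_eq, Int.coe_castRingHom,
    Int.cast_natCast]
  field_simp

/-- Only the term of top index survives. For `M ≠ 0` and `p ≠ 0` the value is nonzero: `M` is the
image of `∞`, hence not a root. -/
theorem aeval_mobiusPoly_self {k : Type*} [Field k] (M : ℕ) (p : ℤ[X]) :
    aeval (M : k) (mobiusPoly M p) = p.leadingCoeff * (M : k) ^ p.natDegree * M ^ p.natDegree := by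
  rw [mobiusPoly, map_sum, Finset.sum_range_succ, Finset.sum_eq_zero]
  · simp
  · intro i hi
    have : p.natDegree - i ≠ 0 := by
      have := Finset.mem_range.mp hi
      omega
    simp [this]

theorem mobiusPoly_ne_zero {M : ℕ} (hM : M ≠ 0) {p : ℤ[X]} (hp : p ≠ 0) : mobiusPoly M p ≠ 0 := by
  intro h
  have := aeval_mobiusPoly_self (k := ℚ) M p
  rw [h, map_zero] at this
  simp [hp, hM] at this

theorem size_mobiusPoly_le (M : ℕ) (p : ℤ[X]) :
    size (mobiusPoly M p) ≤ size p * (M + 2) ^ size p := by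
  have key : size (mobiusPoly M p) ≤ size p * (M + 2) ^ p.natDegree := by
    conv_rhs => rw [size_poly_eq_sum (p := p) (s := Finset.range (p.natDegree + 1)) fun i hi =>
      Finset.mem_range_succ_iff.mpr (le_natDegree_of_mem_supp i hi), Finset.sum_mul]
    refine (size_sum_le _ _).trans (Finset.sum_le_sum fun i hi => ?_)
    have hi' := Finset.mem_range_succ_iff.mp hi
    rw [C_mul_X_pow_eq_monomial]
    refine (size_mul_le _ _).trans ?_
    rw [size_monomial]
    have h1 : size (p.coeff i * (M : ℤ) ^ i) ≤ size (p.coeff i) * (M + 2) ^ i := by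
      refine (size_mul_le _ _).trans (Nat.mul_le_mul_left _ ((size_pow_le _ _).trans ?_))
      rw [size_int, Int.natAbs_natCast]
      exact Nat.pow_le_pow_left (Nat.le_add_right _ _) _
    have h2 : size ((X - C (M : ℤ)) ^ (p.natDegree - i)) ≤ (M + 2) ^ (p.natDegree - i) := by
      refine (size_pow_le _ _).trans (Nat.pow_le_pow_left ((size_sub_le _ _).trans ?_) _)
      rw [size_X, size_C, size_int, Int.natAbs_natCast, add_comm]
    calc _ ≤ size (p.coeff i) * (M + 2) ^ i * 2 ^ i * (M + 2) ^ (p.natDegree - i) :=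
          Nat.mul_le_mul (Nat.mul_le_mul_right _ h1) h2
      _ = size (p.coeff i) * 2 ^ i * ((M + 2) ^ i * (M + 2) ^ (p.natDegree - i)) := by ring
      _ = _ := by rw [← pow_add, Nat.add_sub_cancel' hi']
  exact key.trans (Nat.mul_le_mul_left _
    (Nat.pow_le_pow_right (by omega) (natDegree_le_size p)))

/-! ### Polynomials with roots in a disc -/

section Disc

variable {p : ℤ[X]} {R : ℝ}

theorem norm_aeval_eq_prod (p : ℤ[X]) (z : ℂ) :
    ‖aeval z p‖ = |(p.leadingCoeff : ℝ)| *
      ((p.map (algebraMap ℤ ℂ)).roots.map fun b => ‖z - b‖).prod := by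
  have hinj : Function.Injective (algebraMap ℤ ℂ) := (algebraMap ℤ ℂ).injective_int
  rw [← eval_map_algebraMap, (IsAlgClosed.splits (p.map (algebraMap ℤ ℂ))).eval_eq_prod_roots,
    norm_mul, leadingCoeff_map_of_injective hinj]
  simp only [algebraMap_int_eq, eq_intCast, Complex.norm_intCast]
  congr 1
  have := map_multiset_prod (normHom : ℂ →*₀ ℝ)
    ((p.map (Int.castRingHom ℂ)).roots.map fun b => z - b)
  rwa [Multiset.map_map] at this

theorem card_roots_map_eq_natDegree (p : ℤ[X]) :
    (p.map (algebraMap ℤ ℂ)).roots.card = p.natDegree := by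
  rw [← (IsAlgClosed.splits (p.map (algebraMap ℤ ℂ))).natDegree_eq_card_roots,
    natDegree_map_eq_of_injective (algebraMap ℤ ℂ).injective_int]

theorem aeval_eq_zero_of_mem_roots {p : ℤ[X]} {b : ℂ} (hb : b ∈ (p.map (algebraMap ℤ ℂ)).roots) :
    aeval b p = 0 := by
  rw [← eval_map_algebraMap]
  exact isRoot_of_mem_roots hb

theorem norm_aeval_le_of_roots (h : ∀ b : ℂ, aeval b p = 0 → ‖b‖ ≤ R) {z : ℂ}
    (hz : ‖z‖ ≤ R) : ‖aeval z p‖ ≤ |(p.leadingCoeff : ℝ)| * (2 * R) ^ p.natDegree := by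
  rw [norm_aeval_eq_prod]
  gcongr
  have := Multiset.prod_map_le_prod_map₀ (s := (p.map (algebraMap ℤ ℂ)).roots)
    (fun b => ‖z - b‖) (fun _ => 2 * R) (fun b _ => norm_nonneg _) fun b hb =>
      (norm_sub_le _ _).trans (by linarith [h b (aeval_eq_zero_of_mem_roots hb)])
  rwa [Multiset.map_const', Multiset.prod_replicate, card_roots_map_eq_natDegree] at this

theorem le_norm_aeval_of_roots (h : ∀ b : ℂ, aeval b p = 0 → ‖b‖ ≤ R) {z : ℂ} {r : ℝ}
    (hr : 0 ≤ r) (hz : R + r ≤ ‖z‖) : |(p.leadingCoeff : ℝ)| * r ^ p.natDegree ≤ ‖aeval z p‖ := by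
  rw [norm_aeval_eq_prod]
  gcongr
  have := Multiset.prod_map_le_prod_map₀ (s := (p.map (algebraMap ℤ ℂ)).roots)
    (fun _ => r) (fun b => ‖z - b‖) (fun b _ => hr) fun b hb =>
      le_trans (by linarith [h b (aeval_eq_zero_of_mem_roots hb)]) (norm_sub_norm_le _ _)
  rwa [Multiset.map_const', Multiset.prod_replicate, card_roots_map_eq_natDegree] at this

/-- Gauss–Lucas: the roots of `p'` lie in the convex hull of the roots of `p`, hence in every disc
that contains the latter. -/
theorem norm_le_of_aeval_derivative_eq_zero (hd : 2 ≤ p.natDegree)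
    (h : ∀ b : ℂ, aeval b p = 0 → ‖b‖ ≤ R) {z : ℂ} (hz : aeval z (derivative p) = 0) : ‖z‖ ≤ R := by
  have hinj : Function.Injective (algebraMap ℤ ℂ) := (algebraMap ℤ ℂ).injective_int
  have hd0 : derivative p ≠ 0 := fun h0 => by
    have := derivative_eq_zero.mp h0
    omega
  have hdeg : 0 < (p.map (algebraMap ℤ ℂ)).degree := by
    rw [← natDegree_pos_iff_degree_pos, natDegree_map_eq_of_injective hinj]
    omega
  have hmem := rootSet_derivative_subset_convexHull_rootSet hdeg (a := z) (by
    rw [mem_rootSet, derivative_map, coe_aeval_eq_eval, eval_map_algebraMap]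
    exact ⟨(Polynomial.map_ne_zero_iff hinj).mpr hd0, hz⟩)
  have hsub : (p.map (algebraMap ℤ ℂ)).rootSet ℂ ⊆ Metric.closedBall 0 R := by
    intro b hb
    rw [mem_rootSet, coe_aeval_eq_eval, eval_map_algebraMap] at hb
    rw [mem_closedBall_zero_iff]
    exact h b hb.2
  have := convexHull_min hsub (convex_closedBall 0 R) hmem
  rwa [mem_closedBall_zero_iff] at this

end Disc

/-! ### The function field -/

section FunctionField

variable (n : ℕ)

/-- The coordinate function `x` in the coordinate ring. -/
def xc : CoordinateRing n := AdjoinRoot.of (equation n) X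

/-- The coordinate function `y` in the coordinate ring. -/
def yc : CoordinateRing n := AdjoinRoot.root (equation n)

theorem eval₂_equation {R : Type*} [CommRing R] (f : Qbar[X] →+* R) (b : R) :
    eval₂ f b (equation n) = b ^ n + (f X ^ n - 1) := by
  rw [equation, eval₂_add, eval₂_X_pow, eval₂_C, map_sub, map_pow, map_one]

theorem xc_pow_add_yc_pow : xc n ^ n + yc n ^ n = 1 := by
  have h := AdjoinRoot.eval₂_root (equation n)
  rw [eval₂_equation] at h
  change yc n ^ n + (xc n ^ n - 1) = 0 at h
  linear_combination h

theorem algebraMap_xc : algebraMap (CoordinateRing n) (FunctionField n) (xc n) = x n := rfl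

theorem algebraMap_yc : algebraMap (CoordinateRing n) (FunctionField n) (yc n) = y n := rfl

theorem x_pow_add_y_pow : x n ^ n + y n ^ n = 1 := by
  rw [← algebraMap_xc, ← algebraMap_yc, ← map_pow, ← map_pow, ← map_add, xc_pow_add_yc_pow, map_one]

variable {n}

theorem eval₂_equation_eq_zero {R : Type*} [CommRing R] [Algebra Qbar R] {a b : R}
    (h : a ^ n + b ^ n = 1) : eval₂ (aeval a : Qbar[X] →ₐ[Qbar] R).toRingHom b (equation n) = 0 := by
  rw [eval₂_equation, AlgHom.toRingHom_eq_coe, RingHom.coe_coe, aeval_X]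
  linear_combination h

/-- The homomorphism from the coordinate ring given by a solution of the equation. -/
def coordLift {R : Type*} [CommRing R] [Algebra Qbar R] (a b : R) (h : a ^ n + b ^ n = 1) :
    CoordinateRing n →ₐ[Qbar] R where
  toRingHom := AdjoinRoot.lift (aeval a).toRingHom b (eval₂_equation_eq_zero h)
  commutes' c := by
    have : algebraMap Qbar (CoordinateRing n) c = AdjoinRoot.of (equation n) (C c) := rfl
    simp [this]

theorem coordLift_of {R : Type*} [CommRing R] [Algebra Qbar R] (a b : R) (h : a ^ n + b ^ n = 1)
    (p : Qbar[X]) : coordLift a b h (AdjoinRoot.of (equation n) p) = aeval a p :=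
  AdjoinRoot.lift_of (eval₂_equation_eq_zero h)

theorem coordLift_xc {R : Type*} [CommRing R] [Algebra Qbar R] (a b : R) (h : a ^ n + b ^ n = 1) :
    coordLift a b h (xc n) = a := by
  rw [xc, coordLift_of, aeval_X]

theorem coordLift_yc {R : Type*} [CommRing R] [Algebra Qbar R] (a b : R) (h : a ^ n + b ^ n = 1) :
    coordLift a b h (yc n) = b :=
  AdjoinRoot.lift_root (eval₂_equation_eq_zero h)

theorem aeval_vec_one_eq_algebraMap (A : MvPolynomial (Fin 3) Qbar) :
    MvPolynomial.aeval ![x n, y n, 1] A = algebraMap (CoordinateRing n) (FunctionField n)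
      (MvPolynomial.aeval ![xc n, yc n, 1] A) := by
  rw [← MvPolynomial.aeval_algebraMap_apply]
  congr 2
  funext i
  fin_cases i
  · rfl
  · rfl
  · exact (map_one _).symm

theorem algHom_aeval_vec {R S : Type*} [CommRing R] [Algebra Qbar R] [CommRing S] [Algebra Qbar S]
    (φ : R →ₐ[Qbar] S) (a b c : R) (A : MvPolynomial (Fin 3) Qbar) :
    φ (MvPolynomial.aeval ![a, b, c] A) = MvPolynomial.aeval ![φ a, φ b, φ c] A := by
  have := congrArg (fun ψ => ψ A) (MvPolynomial.comp_aeval (R := Qbar) ![a, b, c] φ)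
  refine this.trans (congrArg (fun v => MvPolynomial.aeval v A) ?_)
  funext i
  fin_cases i <;> rfl

theorem aeval_mul_of_isHomogeneous {R : Type*} [CommRing R] [Algebra Qbar R]
    {A : MvPolynomial (Fin 3) Qbar} {m : ℕ} (hA : A.IsHomogeneous m) (r a b c : R) :
    MvPolynomial.aeval ![r * a, r * b, r * c] A = r ^ m * MvPolynomial.aeval ![a, b, c] A := by
  rw [MvPolynomial.aeval_def, MvPolynomial.aeval_def, MvPolynomial.eval₂_eq,
    MvPolynomial.eval₂_eq, Finset.mul_sum]
  refine Finset.sum_congr rfl fun d hd => ?_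
  have hdeg := hA (MvPolynomial.mem_support_iff.mp hd)
  have hv : ∀ i, ![r * a, r * b, r * c] i = r * ![a, b, c] i := by
    intro i
    fin_cases i <;> rfl
  have hsum : ∑ i ∈ d.support, d i = m := by
    simpa [Finsupp.weight_apply, Finsupp.sum] using hdeg
  simp_rw [hv, mul_pow]
  rw [Finset.prod_mul_distrib, Finset.prod_pow_eq_pow_sum, hsum]
  ring

theorem natDegree_equation : (equation n).natDegree = n := natDegree_X_pow_add_C

theorem algebraMap_coord_injective :
    Function.Injective (algebraMap (CoordinateRing n) (FunctionField n)) :=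
  IsFractionRing.injective _ _

theorem aeval_x_eq (p : Qbar[X]) : aeval (x n) p =
    algebraMap (CoordinateRing n) (FunctionField n) (AdjoinRoot.of (equation n) p) := by
  rw [← algebraMap_xc, aeval_algebraMap_apply]
  congr 1
  have : AdjoinRoot.of (equation n) p = (IsScalarTower.toAlgHom Qbar Qbar[X] (CoordinateRing n)) p :=
    rfl
  rw [this]
  conv_rhs => rw [← aeval_X_left_apply (R := Qbar) p, ← aeval_algHom_apply]
  rfl

section NeZero

variable [NeZero n]

theorem monic_equation : (equation n).Monic := monic_X_pow_add_C _ (NeZero.ne n)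

theorem of_injective : Function.Injective (AdjoinRoot.of (equation n)) := by
  refine AdjoinRoot.of.injective_of_degree_ne_zero ?_
  rw [equation, degree_X_pow_add_C (Nat.pos_of_ne_zero (NeZero.ne n))]
  exact_mod_cast NeZero.ne n

theorem aeval_x_eq_zero_iff (p : Qbar[X]) : aeval (x n) p = 0 ↔ p = 0 := by
  rw [aeval_x_eq, map_eq_zero_iff _ algebraMap_coord_injective, map_eq_zero_iff _ of_injective]

theorem aeval_int_x_eq_zero_iff (p : ℤ[X]) : aeval (x n) p = 0 ↔ p = 0 := by
  rw [← aeval_map_algebraMap Qbar, aeval_x_eq_zero_iff,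
    Polynomial.map_eq_zero_iff (algebraMap ℤ Qbar).injective_int]

theorem x_ne_zero : x n ≠ 0 := by
  have := (aeval_x_eq_zero_iff (n := n) X).not.mpr X_ne_zero
  rwa [aeval_X] at this

/-- The powers `1, y, …, y ^ (n - 1)` are linearly independent over the polynomials in `x`. -/
theorem sum_aeval_x_mul_y_pow_eq_zero {v : Fin n → ℤ[X]}
    (h : ∑ i, aeval (x n) (v i) * y n ^ (i : ℕ) = 0) : v = 0 := by
  set P : Qbar[X][X] := ∑ i : Fin n, C ((v i).map (algebraMap ℤ Qbar)) * X ^ (i : ℕ) with hP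
  have hmk : AdjoinRoot.mk (equation n) P = 0 := by
    apply algebraMap_coord_injective (n := n)
    rw [map_zero, ← h, hP, map_sum, map_sum]
    refine Finset.sum_congr rfl fun i _ => ?_
    rw [map_mul, map_mul, map_pow, map_pow, AdjoinRoot.mk_X, AdjoinRoot.mk_C, ← aeval_x_eq,
      aeval_map_algebraMap]
    rfl
  rw [AdjoinRoot.mk_eq_zero] at hmk
  have hdeg : P.degree < (equation n).degree := by
    rw [degree_eq_natDegree monic_equation.ne_zero, natDegree_equation]
    refine (degree_sum_le _ _).trans_lt ((Finset.sup_lt_iff (WithBot.bot_lt_coe n)).mpr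
      fun i _ => ?_)
    exact (degree_C_mul_X_pow_le _ _).trans_lt (WithBot.coe_lt_coe.mpr i.2)
  have hP0 := eq_zero_of_dvd_of_degree_lt hmk hdeg
  funext i
  have hc := congrArg (fun q => q.coeff (i : ℕ)) hP0
  simp only [hP, finsetSum_coeff, coeff_C_mul, coeff_X_pow, coeff_zero] at hc
  rw [Finset.sum_eq_single i] at hc
  · rw [if_pos rfl, mul_one, Polynomial.map_eq_zero_iff (algebraMap ℤ Qbar).injective_int] at hc
    exact hc
  · intro j _ hj
    rw [if_neg (fun h => hj (Fin.ext h.symm)), mul_zero]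
  · simp

theorem y_ne_zero : y n ≠ 0 := by
  intro h
  have h1 := x_pow_add_y_pow n
  rw [h, zero_pow (NeZero.ne n), add_zero] at h1
  have h2 := (aeval_x_eq_zero_iff (n := n) (X ^ n - C 1)).not.mpr
    (X_pow_sub_C_ne_zero (Nat.pos_of_ne_zero (NeZero.ne n)) 1)
  simp [h1] at h2

theorem aeval_x_inv_ne_zero {p : Qbar[X]} (hp : p ≠ 0) : aeval (x n)⁻¹ p ≠ 0 := by
  intro h
  let := invertibleOfNonzero (inv_ne_zero (x_ne_zero (n := n)))
  rw [aeval_def, ← eval₂_reverse_eq_zero_iff, invOf_eq_inv, inv_inv] at h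
  exact (aeval_x_eq_zero_iff (n := n) p.reverse).not.mpr (by simpa using hp) h

/-- This is the passage to the chart `X ≠ 0`. The kernel meets `Qbar[x]` in zero because `1 / x` is
transcendental; as the coordinate ring is a domain that is finite over `Qbar[x]`, the kernel is
zero. -/
theorem coordLift_inv_injective {z : Qbar} (h : (x n)⁻¹ ^ n +
    (algebraMap Qbar (FunctionField n) z * y n * (x n)⁻¹) ^ n = 1) :
    Function.Injective (coordLift (n := n) _ _ h) := by
  have : Module.Finite Qbar[X] (CoordinateRing n) := monic_equation.finite_adjoinRoot
  rw [injective_iff_map_eq_zero]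
  have hbot : RingHom.ker (coordLift (n := n) _ _ h) = ⊥ := by
    refine Ideal.eq_bot_of_comap_eq_bot (R := Qbar[X]) ?_
    rw [eq_bot_iff]
    intro p hp
    rw [Ideal.mem_comap, RingHom.mem_ker] at hp
    by_contra hp0
    refine aeval_x_inv_ne_zero (n := n) hp0 ?_
    rw [← hp]
    exact (coordLift_of _ _ h p).symm
  intro a ha
  have : a ∈ RingHom.ker (coordLift (n := n) _ _ h) := ha
  rwa [hbot] at this

/-- A form that vanishes on the curve vanishes at all points of the curve with values in a
`Qbar`-algebra. -/
theorem aeval_eq_zero_of_isHomogeneous {R : Type*} [CommRing R] [Algebra Qbar R]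
    {A : MvPolynomial (Fin 3) Qbar} {m : ℕ} (hA : A.IsHomogeneous m)
    (h0 : MvPolynomial.aeval ![x n, y n, 1] A = 0) {a b c : R} (h : a ^ n + b ^ n = c ^ n)
    (hu : IsUnit c ∨ IsUnit a) : MvPolynomial.aeval ![a, b, c] A = 0 := by
  have hn : n ≠ 0 := NeZero.ne n
  -- If `c` is a unit, `(a / c, b / c)` solves the affine equation, and the relation `A = 0` in the
  -- coordinate ring specializes to it.
  rcases hu with ⟨u, rfl⟩ | ⟨u, rfl⟩
  · rw [aeval_vec_one_eq_algebraMap, map_eq_zero_iff _ algebraMap_coord_injective] at h0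
    have huu : (u : R) ^ n * (↑u⁻¹ : R) ^ n = 1 := by rw [← mul_pow, Units.mul_inv, one_pow]
    have h1 : (↑u⁻¹ * a : R) ^ n + (↑u⁻¹ * b : R) ^ n = 1 := by
      rw [mul_pow, mul_pow, ← mul_add, h, mul_comm, huu]
    have h2 := congrArg (coordLift _ _ h1) h0
    rw [algHom_aeval_vec, map_zero, coordLift_xc, coordLift_yc, map_one] at h2
    have h3 := aeval_mul_of_isHomogeneous hA (u : R) (↑u⁻¹ * a) (↑u⁻¹ * b) 1
    rwa [h2, mul_zero, Units.mul_inv_cancel_left, Units.mul_inv_cancel_left, mul_one] at h3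
  -- If `a` is a unit, choose `z ^ n = -1`. Then `(c / a) ^ n + (z b / a) ^ n = 1` is again the
  -- affine equation, so the same argument applies after exchanging the roles of `X` and `Z`.
  · obtain ⟨z, hz⟩ := IsAlgClosed.exists_pow_nat_eq (-1 : Qbar) (Nat.pos_of_ne_zero hn)
    have hz0 : z ≠ 0 := by
      rintro rfl
      rw [zero_pow hn] at hz
      exact one_ne_zero (neg_eq_zero.mp hz.symm)
    have hx : x n ≠ 0 := x_ne_zero
    have h1 : (x n)⁻¹ ^ n + (algebraMap Qbar (FunctionField n) z * y n * (x n)⁻¹) ^ n = 1 := by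
      have := x_pow_add_y_pow n
      rw [mul_pow, mul_pow, ← map_pow, hz, map_neg, map_one, inv_pow]
      field_simp
      linear_combination -this
    have h2 := aeval_mul_of_isHomogeneous hA (x n)⁻¹ (x n) (y n) 1
    rw [h0, mul_zero, inv_mul_cancel₀ hx, mul_one] at h2
    have h3 : MvPolynomial.aeval ![1, algebraMap Qbar (CoordinateRing n) z⁻¹ * yc n, xc n] A = 0 := by
      apply coordLift_inv_injective h1
      rw [algHom_aeval_vec, map_one, map_mul, AlgHom.commutes, coordLift_xc, coordLift_yc, map_zero,
        ← h2]
      congr 3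
      · rw [← mul_assoc, ← mul_assoc, ← map_mul, inv_mul_cancel₀ hz0, map_one, one_mul, mul_comm]
    have huu : (u : R) ^ n * (↑u⁻¹ : R) ^ n = 1 := by rw [← mul_pow, Units.mul_inv, one_pow]
    have h4 : (↑u⁻¹ * c : R) ^ n + (algebraMap Qbar R z * (↑u⁻¹ * b)) ^ n = 1 := by
      rw [mul_pow, mul_pow, mul_pow, ← map_pow, hz, map_neg, map_one, ← h]
      linear_combination huu
    have h5 := congrArg (coordLift _ _ h4) h3
    rw [algHom_aeval_vec, map_zero, map_one, map_mul, AlgHom.commutes, coordLift_xc,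
      coordLift_yc, ← mul_assoc, ← map_mul, inv_mul_cancel₀ hz0, map_one, one_mul] at h5
    have h6 := aeval_mul_of_isHomogeneous hA (u : R) 1 (↑u⁻¹ * b) (↑u⁻¹ * c)
    rwa [h5, mul_zero, Units.mul_inv_cancel_left, Units.mul_inv_cancel_left, mul_one] at h6

end NeZero

end FunctionField

/-! ### First-order jets of rational functions -/

section Jet

variable {n : ℕ}

theorem Point.coords_eq (P : Point n) : P.coords 0 ^ n + P.coords 1 ^ n = P.coords 2 ^ n := P.2

theorem Point.coords_ne_zero (P : Point n) : P.coords ≠ 0 := P.1.rep_nonzero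

open Classical in
/-- A nonzero tangent vector at a point, as a direction in the homogeneous coordinates. -/
def Point.tangent (P : Point n) : Fin 3 → Qbar :=
  -- A tangent vector satisfies `X ^ (n - 1) dX + Y ^ (n - 1) dY = Z ^ (n - 1) dZ`. It is normalized
  -- by `dX = 0` at infinity and by `dZ = 0` elsewhere. The entry `Z ^ (n - 1)` at infinity matters
  -- for `n = 1`, where it is `1`.
  if P.coords 2 = 0 then ![0, P.coords 2 ^ (n - 1), P.coords 1 ^ (n - 1)]
  else ![P.coords 1 ^ (n - 1), -P.coords 0 ^ (n - 1), 0]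

/-- The point of the curve over the dual numbers given by the tangent vector. -/
def Point.thick (P : Point n) (i : Fin 3) : DualNumber Qbar :=
  TrivSqZeroExt.inl (P.coords i) + TrivSqZeroExt.inr (P.tangent i)

theorem Point.fst_thick (P : Point n) (i : Fin 3) : (P.thick i).fst = P.coords i := by
  simp [Point.thick]

theorem Point.snd_thick (P : Point n) (i : Fin 3) : (P.thick i).snd = P.tangent i := by
  simp [Point.thick]

theorem Point.thick_eq (P : Point n) : P.thick 0 ^ n + P.thick 1 ^ n = P.thick 2 ^ n := by
  refine TrivSqZeroExt.ext ?_ ?_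
  · simp only [TrivSqZeroExt.fst_add, TrivSqZeroExt.fst_pow, Point.fst_thick]
    exact P.coords_eq
  · simp only [TrivSqZeroExt.snd_add, TrivSqZeroExt.snd_pow, Point.fst_thick, Point.snd_thick,
      nsmul_eq_mul, smul_eq_mul, Nat.pred_eq_sub_one]
    rw [Point.tangent]
    split_ifs with h
    · simp only [Matrix.cons_val_zero, Matrix.cons_val_one, Matrix.cons_val]
      ring
    · simp only [Matrix.cons_val_zero, Matrix.cons_val_one, Matrix.cons_val]
      ring

theorem fst_aeval_thick (P : Point n) (A : MvPolynomial (Fin 3) Qbar) :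
    (MvPolynomial.aeval P.thick A).fst = MvPolynomial.eval P.coords A := by
  have := congrArg (fun ψ => ψ A)
    (MvPolynomial.comp_aeval (R := Qbar) P.thick (TrivSqZeroExt.fstHom Qbar Qbar Qbar))
  refine this.trans ?_
  rw [MvPolynomial.aeval_eq_eval]
  exact congrArg (fun v => MvPolynomial.eval v A) (funext fun i => P.fst_thick i)

/-- `g` is regular at `P`, with first-order expansion `j` along the tangent vector at `P`. -/
def HasJet (P : Point n) (g : FunctionField n) (j : DualNumber Qbar) : Prop :=
  ∃ A B, IsFractionAt P g A B ∧
    j * MvPolynomial.aeval P.thick B = MvPolynomial.aeval P.thick A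

namespace HasJet

variable {P : Point n} {g g' : FunctionField n} {j j' : DualNumber Qbar}

theorem add (h : HasJet P g j) (h' : HasJet P g' j') : HasJet P (g + g') (j + j') := by
  obtain ⟨A, B, h, hj⟩ := h
  obtain ⟨A', B', h', hj'⟩ := h'
  refine ⟨_, _, h.add h', ?_⟩
  rw [map_add, map_mul, map_mul, map_mul, ← hj, ← hj']
  ring

theorem mul (h : HasJet P g j) (h' : HasJet P g' j') : HasJet P (g * g') (j * j') := by
  obtain ⟨A, B, h, hj⟩ := h
  obtain ⟨A', B', h', hj'⟩ := h'
  refine ⟨_, _, h.mul h', ?_⟩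
  rw [map_mul, map_mul, ← hj, ← hj']
  ring

theorem const (P : Point n) (c : Qbar) :
    HasJet P (algebraMap Qbar (FunctionField n) c) (TrivSqZeroExt.inl c) := by
  refine ⟨_, _, IsFractionAt.const P c, ?_⟩
  rw [map_one, mul_one, MvPolynomial.aeval_C]
  rfl

theorem intCast (P : Point n) (c : ℤ) : HasJet P (c : FunctionField n) (c : DualNumber Qbar) := by
  have := const P (c : Qbar)
  rwa [map_intCast, TrivSqZeroExt.inl_intCast] at this

theorem natCast (P : Point n) (c : ℕ) : HasJet P (c : FunctionField n) (c : DualNumber Qbar) := by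
  exact_mod_cast intCast P c

theorem one (P : Point n) : HasJet P (1 : FunctionField n) 1 := by
  exact_mod_cast intCast P 1

theorem zero (P : Point n) : HasJet P (0 : FunctionField n) 0 := by
  exact_mod_cast intCast P 0

theorem neg (h : HasJet P g j) : HasJet P (-g) (-j) := by
  have := (intCast P (-1)).mul h
  simpa using this

theorem sub (h : HasJet P g j) (h' : HasJet P g' j') : HasJet P (g - g') (j - j') := by
  rw [sub_eq_add_neg, sub_eq_add_neg]
  exact h.add h'.neg

theorem pow (h : HasJet P g j) (k : ℕ) : HasJet P (g ^ k) (j ^ k) := by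
  induction k with
  | zero => simpa using one P
  | succ k ih =>
    rw [pow_succ, pow_succ]
    exact ih.mul h

theorem sum {ι : Type*} (s : Finset ι) {f : ι → FunctionField n} {w : ι → DualNumber Qbar}
    (h : ∀ i ∈ s, HasJet P (f i) (w i)) : HasJet P (∑ i ∈ s, f i) (∑ i ∈ s, w i) := by
  classical
  induction s using Finset.induction_on with
  | empty => simpa using zero P
  | insert a s ha ih =>
    rw [Finset.sum_insert ha, Finset.sum_insert ha]
    exact (h a (Finset.mem_insert_self _ _)).add
      (ih fun i hi => h i (Finset.mem_insert_of_mem hi))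

theorem aeval (h : HasJet P g j) (p : ℤ[X]) :
    HasJet P (Polynomial.aeval g p) (Polynomial.aeval j p) := by
  rw [aeval_eq_sum_range, aeval_eq_sum_range]
  refine sum _ fun i _ => ?_
  rw [Algebra.smul_def, Algebra.smul_def, eq_intCast, eq_intCast]
  exact (intCast P _).mul (h.pow i)

theorem mem_localRing (h : HasJet P g j) : g ∈ localRing P := by
  obtain ⟨A, B, h, -⟩ := h
  exact ⟨A, B, h⟩

theorem isUnit_aeval {B : MvPolynomial (Fin 3) Qbar} (h : MvPolynomial.eval P.coords B ≠ 0) :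
    IsUnit (MvPolynomial.aeval P.thick B) := by
  rw [TrivSqZeroExt.isUnit_iff_isUnit_fst, fst_aeval_thick]
  exact h.isUnit

theorem mem_maxIdeal (h : HasJet P g j) (hj : j.fst = 0) :
    (⟨g, h.mem_localRing⟩ : localRing P) ∈ maxIdeal P := by
  obtain ⟨A, B, h, hjA⟩ := h
  refine ⟨A, B, h, ?_⟩
  rw [← fst_aeval_thick, ← hjA, TrivSqZeroExt.fst_mul, hj, zero_mul]

theorem exists_of_isFractionAt {A B : MvPolynomial (Fin 3) Qbar} (h : IsFractionAt P g A B) :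
    ∃ j, HasJet P g j ∧ j.fst * MvPolynomial.eval P.coords B = MvPolynomial.eval P.coords A := by
  obtain ⟨u, hu⟩ := isUnit_aeval h.2.1
  refine ⟨MvPolynomial.aeval P.thick A * ↑u⁻¹, ⟨A, B, h, by rw [← hu, Units.inv_mul_cancel_right]⟩, ?_⟩
  rw [← fst_aeval_thick, ← fst_aeval_thick, ← TrivSqZeroExt.fst_mul, ← hu,
    Units.inv_mul_cancel_right]

theorem exists_of_mem_maxIdeal {f : localRing P} (hf : f ∈ maxIdeal P) :
    ∃ j, HasJet P f j ∧ j.fst = 0 := by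
  obtain ⟨A, B, h, h0⟩ := hf
  obtain ⟨j, hj, hfst⟩ := exists_of_isFractionAt h
  rw [h0] at hfst
  exact ⟨j, hj, (mul_eq_zero.mp hfst).resolve_right h.2.1⟩

/-- Jets of functions vanishing at `P` are multiples of `ε`, and `ε ^ 2 = 0`. -/
theorem of_mem_maxIdeal_sq {f : localRing P} (hf : f ∈ maxIdeal P ^ 2) : HasJet P f 0 := by
  rw [pow_two] at hf
  refine Submodule.mul_induction_on hf (fun a ha b hb => ?_) fun a b ha hb => ?_
  · obtain ⟨ja, hja, ha0⟩ := exists_of_mem_maxIdeal ha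
    obtain ⟨jb, hjb, hb0⟩ := exists_of_mem_maxIdeal hb
    have h := hja.mul hjb
    have h0 : ja * jb = 0 := by
      refine TrivSqZeroExt.ext ?_ ?_
      · rw [TrivSqZeroExt.fst_mul, ha0, zero_mul]
        rfl
      · rw [TrivSqZeroExt.snd_mul, ha0, hb0]
        simp
    rwa [h0] at h
  · have := ha.add hb
    rwa [add_zero] at this

end HasJet

theorem hasJet_x {P : Point n} (h : P.coords 2 ≠ 0) : ∃ j, HasJet P (x n) j ∧
    j.fst = P.coords 0 / P.coords 2 ∧ j.snd = P.coords 1 ^ (n - 1) / P.coords 2 := by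
  have hf : IsFractionAt P (x n) (MvPolynomial.X 0) (MvPolynomial.X 2) :=
    ⟨⟨1, MvPolynomial.isHomogeneous_X _ _, MvPolynomial.isHomogeneous_X _ _⟩, by simpa using h,
      by simp⟩
  have ht : P.tangent = ![P.coords 1 ^ (n - 1), -P.coords 0 ^ (n - 1), 0] := if_neg h
  have h2 : (P.thick 2).fst ≠ 0 := by rwa [P.fst_thick]
  refine ⟨P.thick 0 * (P.thick 2)⁻¹, ⟨_, _, hf, ?_⟩, ?_, ?_⟩
  · rw [MvPolynomial.aeval_X, MvPolynomial.aeval_X, mul_assoc, TrivSqZeroExt.inv_mul_cancel h2,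
      mul_one]
  · simp [P.fst_thick, div_eq_mul_inv]
  · simp [P.fst_thick, P.snd_thick, ht, div_eq_mul_inv, mul_comm]

theorem hasJet_y {P : Point n} (h : P.coords 2 ≠ 0) : ∃ j, HasJet P (y n) j ∧
    j.fst = P.coords 1 / P.coords 2 ∧ j.snd = -P.coords 0 ^ (n - 1) / P.coords 2 := by
  have hf : IsFractionAt P (y n) (MvPolynomial.X 1) (MvPolynomial.X 2) :=
    ⟨⟨1, MvPolynomial.isHomogeneous_X _ _, MvPolynomial.isHomogeneous_X _ _⟩, by simpa using h,
      by simp⟩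
  have ht : P.tangent = ![P.coords 1 ^ (n - 1), -P.coords 0 ^ (n - 1), 0] := if_neg h
  have h2 : (P.thick 2).fst ≠ 0 := by rwa [P.fst_thick]
  refine ⟨P.thick 1 * (P.thick 2)⁻¹, ⟨_, _, hf, ?_⟩, ?_, ?_⟩
  · rw [MvPolynomial.aeval_X, MvPolynomial.aeval_X, mul_assoc, TrivSqZeroExt.inv_mul_cancel h2,
      mul_one]
  · simp [P.fst_thick, div_eq_mul_inv]
  · simp [P.fst_thick, P.snd_thick, ht, div_eq_mul_inv, mul_comm]

variable [NeZero n]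

theorem Point.coords_zero_ne_zero {P : Point n} (h : P.coords 2 = 0) : P.coords 0 ≠ 0 := by
  intro h0
  have h1 := P.coords_eq
  rw [h, h0, zero_pow (NeZero.ne n), zero_add] at h1
  refine P.coords_ne_zero (funext fun i => ?_)
  fin_cases i
  · exact h0
  · exact pow_eq_zero_iff (NeZero.ne n) |>.mp h1
  · exact h

theorem Point.coords_one_ne_zero {P : Point n} (h : P.coords 2 = 0) : P.coords 1 ≠ 0 := by
  intro h0
  have h1 := P.coords_eq
  rw [h, h0, zero_pow (NeZero.ne n), add_zero] at h1
  exact P.coords_zero_ne_zero h (pow_eq_zero_iff (NeZero.ne n) |>.mp h1)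

theorem Point.thick_isUnit (P : Point n) : IsUnit (P.thick 2) ∨ IsUnit (P.thick 0) := by
  rw [TrivSqZeroExt.isUnit_iff_isUnit_fst, TrivSqZeroExt.isUnit_iff_isUnit_fst, P.fst_thick,
    P.fst_thick, isUnit_iff_ne_zero, isUnit_iff_ne_zero]
  by_cases h : P.coords 2 = 0
  · exact Or.inr (P.coords_zero_ne_zero h)
  · exact Or.inl h

theorem aeval_thick_eq_zero (P : Point n) {A : MvPolynomial (Fin 3) Qbar} {m : ℕ}
    (hA : A.IsHomogeneous m) (h0 : MvPolynomial.aeval ![x n, y n, 1] A = 0) :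
    MvPolynomial.aeval P.thick A = 0 := by
  have := aeval_eq_zero_of_isHomogeneous hA h0 P.thick_eq P.thick_isUnit
  have hv : P.thick = ![P.thick 0, P.thick 1, P.thick 2] := by
    funext i
    fin_cases i <;> rfl
  rwa [hv]

namespace HasJet

variable {P : Point n} {g g' : FunctionField n} {j j' : DualNumber Qbar}

/-- Two fractions for `g` give a form `A B' - A' B` that vanishes on the curve, hence also at the
point `P.thick` over the dual numbers. So values and derivatives do not depend on the fraction. -/
theorem unique (h : HasJet P g j) (h' : HasJet P g j') : j = j' := by
  obtain ⟨A, B, ⟨⟨m, hA, hB⟩, hB0, hAB⟩, hj⟩ := h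
  obtain ⟨A', B', ⟨⟨m', hA', hB'⟩, hB0', hAB'⟩, hj'⟩ := h'
  have hhom : (A * B' - A' * B).IsHomogeneous (m + m') :=
    (hA.mul hB').sub (by rw [add_comm]; exact hA'.mul hB)
  have h0 : MvPolynomial.aeval ![x n, y n, 1] (A * B' - A' * B) = 0 := by
    rw [map_sub, map_mul, map_mul, ← hAB, ← hAB']
    ring
  have h1 := aeval_thick_eq_zero P hhom h0
  rw [map_sub, map_mul, map_mul, ← hj, ← hj'] at h1
  refine (((isUnit_aeval hB0).mul (isUnit_aeval hB0')).mul_left_inj).mp ?_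
  linear_combination h1

theorem ne_zero (h : HasJet P g j) (hj : j ≠ 0) : g ≠ 0 := by
  rintro rfl
  exact hj (h.unique (zero P))

theorem inv (h : HasJet P g j) (hj : j.fst ≠ 0) : HasJet P g⁻¹ j⁻¹ := by
  have hg : g ≠ 0 := h.ne_zero fun h0 => hj (by rw [h0]; rfl)
  obtain ⟨A, B, ⟨⟨m, hA, hB⟩, hB0, hAB⟩, hjA⟩ := h
  have hA0 : MvPolynomial.eval P.coords A ≠ 0 := by
    rw [← fst_aeval_thick, ← hjA, TrivSqZeroExt.fst_mul, fst_aeval_thick]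
    exact mul_ne_zero hj hB0
  refine ⟨B, A, ⟨⟨m, hB, hA⟩, hA0, ?_⟩, ?_⟩
  · rw [← hAB, inv_mul_cancel_left₀ hg]
  · rw [← hjA, ← mul_assoc, TrivSqZeroExt.inv_mul_cancel hj, one_mul]

theorem evalAt_eq (h : HasJet P g j) : evalAt g P = ((j.fst : Qbar) : OnePoint Qbar) := by
  have hsub : HasJet P (g - algebraMap Qbar _ j.fst) (j - TrivSqZeroExt.inl j.fst) :=
    h.sub (const P _)
  have hex : ∃ c : Qbar, ∃ f ∈ maxIdeal P, (f : FunctionField n) = g - algebraMap Qbar _ c :=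
    ⟨j.fst, ⟨_, hsub.mem_localRing⟩, hsub.mem_maxIdeal (by simp), rfl⟩
  rw [evalAt, dif_pos hex]
  obtain ⟨f, hf, hfc⟩ := hex.choose_spec
  obtain ⟨j', hj', hj0⟩ := exists_of_mem_maxIdeal hf
  rw [hfc] at hj'
  have := congrArg TrivSqZeroExt.fst (hj'.unique (h.sub (const P hex.choose)))
  rw [hj0, TrivSqZeroExt.fst_sub, TrivSqZeroExt.fst_inl] at this
  rw [sub_eq_zero.mp this.symm]

theorem evalAt_eq_infty (h : HasJet P g⁻¹ j) (hj : j.fst = 0) (hg : g ≠ 0) :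
    evalAt g P = OnePoint.infty := by
  rw [evalAt, dif_neg]
  rintro ⟨c, f, hf, hfc⟩
  obtain ⟨j', hj', -⟩ := exists_of_mem_maxIdeal hf
  rw [hfc] at hj'
  have h1 := (hj'.add (const P c)).mul h
  rw [sub_add_cancel, mul_inv_cancel₀ hg] at h1
  have := congrArg TrivSqZeroExt.fst (h1.unique (one P))
  rw [TrivSqZeroExt.fst_mul, hj, mul_zero] at this
  exact zero_ne_one this

/-- If `g - g(P)` were in the square of the maximal ideal, its jet would be zero by
`of_mem_maxIdeal_sq`, including its derivative `j.snd`. -/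
theorem isUnramifiedAt (h : HasJet P g j) (hj : j.snd ≠ 0) : IsUnramifiedAt g P := by
  have hsub : HasJet P (g - algebraMap Qbar _ j.fst) (j - TrivSqZeroExt.inl j.fst) :=
    h.sub (const P _)
  refine ⟨⟨_, hsub.mem_localRing⟩, hsub.mem_maxIdeal (by simp), fun hsq => hj ?_, ?_⟩
  · have := congrArg TrivSqZeroExt.snd (hsub.unique (of_mem_maxIdeal_sq hsq))
    simpa using this
  · rw [pullbackParameter, h.evalAt_eq]
    rfl

theorem not_isConstant (h : HasJet P g j) (hj : j.snd ≠ 0) : ¬ IsConstant g := by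
  rintro ⟨c, rfl⟩
  refine hj ?_
  rw [h.unique (const P c)]
  simp

end HasJet

theorem hasJet_x_inv {P : Point n} (h : P.coords 2 = 0) :
    ∃ j, HasJet P (x n)⁻¹ j ∧ j.fst = 0 ∧ j.snd ≠ 0 := by
  have h0 := P.coords_zero_ne_zero h
  have hf : IsFractionAt P (x n)⁻¹ (MvPolynomial.X 2) (MvPolynomial.X 0) :=
    ⟨⟨1, MvPolynomial.isHomogeneous_X _ _, MvPolynomial.isHomogeneous_X _ _⟩, by simpa using h0,
      by simp [inv_mul_cancel₀ (x_ne_zero (n := n))]⟩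
  have ht : P.tangent = ![0, P.coords 2 ^ (n - 1), P.coords 1 ^ (n - 1)] := if_pos h
  have h2 : (P.thick 0).fst ≠ 0 := by rwa [P.fst_thick]
  refine ⟨P.thick 2 * (P.thick 0)⁻¹, ⟨_, _, hf, ?_⟩, ?_, ?_⟩
  · rw [MvPolynomial.aeval_X, MvPolynomial.aeval_X, mul_assoc, TrivSqZeroExt.inv_mul_cancel h2,
      mul_one]
  · simp [P.fst_thick, h]
  · simp [P.fst_thick, P.snd_thick, ht, h0, h, P.coords_one_ne_zero h]

theorem hasJet_x_div_y {P : Point n} (h : P.coords 2 = 0) : ∃ j, HasJet P (x n / y n) j := by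
  have h1 := P.coords_one_ne_zero h
  have hf : IsFractionAt P (x n / y n) (MvPolynomial.X 0) (MvPolynomial.X 1) :=
    ⟨⟨1, MvPolynomial.isHomogeneous_X _ _, MvPolynomial.isHomogeneous_X _ _⟩, by simpa using h1,
      by simp [div_mul_cancel₀ _ (y_ne_zero (n := n))]⟩
  obtain ⟨j, hj, -⟩ := HasJet.exists_of_isFractionAt hf
  exact ⟨j, hj⟩

end Jet

theorem fst_aeval_dual (j : DualNumber Qbar) (p : ℤ[X]) :
    (aeval j p).fst = aeval j.fst p := by
  have := aeval_algHom_apply ((TrivSqZeroExt.fstHom Qbar Qbar Qbar).restrictScalars ℤ) j p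
  exact this.symm

theorem snd_aeval_dual (j : DualNumber Qbar) (p : ℤ[X]) :
    (aeval j p).snd = aeval j.fst (derivative p) * j.snd := by
  induction p using Polynomial.induction_on' with
  | add p q hp hq => simp only [map_add, TrivSqZeroExt.snd_add, hp, hq, add_mul]
  | monomial k a =>
    rw [aeval_monomial, derivative_monomial, aeval_monomial, TrivSqZeroExt.snd_mul]
    simp only [eq_intCast, TrivSqZeroExt.fst_intCast, TrivSqZeroExt.snd_intCast,
      TrivSqZeroExt.snd_pow, Nat.pred_eq_sub_one, smul_zero, add_zero]
    simp
    ring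

/-! ### Fractions of bounded size -/

section Frac

variable {n : ℕ}

variable (n) in
/-- The value `P(x, y)` of a polynomial in two variables. -/
def valueXY : ℤ[X][X] →+* FunctionField n :=
  eval₂RingHom (aeval (x n) : ℤ[X] →ₐ[ℤ] FunctionField n).toRingHom (y n)

theorem valueXY_C (p : ℤ[X]) : valueXY n (C p) = aeval (x n) p := by
  simp [valueXY]

theorem valueXY_X : valueXY n X = y n := by
  simp [valueXY]

/-- `g = P(x, y) / Q(x, y)` for integral polynomials of size at most `N`. -/
def IsFrac (N : ℕ) (g : FunctionField n) : Prop :=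
  ∃ P Q : ℤ[X][X], size P ≤ N ∧ size Q ≤ N ∧ valueXY n Q ≠ 0 ∧ g * valueXY n Q = valueXY n P

theorem IsFrac.mono {M N : ℕ} {g : FunctionField n} (h : IsFrac M g) (hMN : M ≤ N) :
    IsFrac N g := by
  obtain ⟨P, Q, h1, h2, h3⟩ := h
  exact ⟨P, Q, h1.trans hMN, h2.trans hMN, h3⟩

variable [NeZero n]

namespace IsFrac

variable {M N : ℕ} {g g' : FunctionField n}

theorem add (h : IsFrac N g) (h' : IsFrac N g') : IsFrac (2 * (N * N)) (g + g') := by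
  obtain ⟨P, Q, h1, h2, h3, h4⟩ := h
  obtain ⟨P', Q', h1', h2', h3', h4'⟩ := h'
  refine ⟨P * Q' + P' * Q, Q * Q', ?_, ?_, ?_, ?_⟩
  · rw [two_mul]
    exact (size_add_le _ _).trans (add_le_add ((size_mul_le _ _).trans (Nat.mul_le_mul h1 h2'))
      ((size_mul_le _ _).trans (Nat.mul_le_mul h1' h2)))
  · exact (size_mul_le _ _).trans ((Nat.mul_le_mul h2 h2').trans (Nat.le_mul_of_pos_left _ two_pos))
  · rw [map_mul]
    exact mul_ne_zero h3 h3'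
  · rw [map_add, map_mul, map_mul, map_mul, ← h4, ← h4']
    ring

theorem mul (h : IsFrac N g) (h' : IsFrac N g') : IsFrac (N * N) (g * g') := by
  obtain ⟨P, Q, h1, h2, h3, h4⟩ := h
  obtain ⟨P', Q', h1', h2', h3', h4'⟩ := h'
  refine ⟨P * P', Q * Q', (size_mul_le _ _).trans (Nat.mul_le_mul h1 h1'),
    (size_mul_le _ _).trans (Nat.mul_le_mul h2 h2'), ?_, ?_⟩
  · rw [map_mul]
    exact mul_ne_zero h3 h3'
  · rw [map_mul, map_mul, ← h4, ← h4']
    ring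

theorem inv (h : IsFrac N g) (hg : g ≠ 0) : IsFrac N g⁻¹ := by
  obtain ⟨P, Q, h1, h2, h3, h4⟩ := h
  refine ⟨Q, P, h2, h1, ?_, ?_⟩
  · rw [← h4]
    exact mul_ne_zero hg h3
  · rw [← h4, inv_mul_cancel_left₀ hg]

theorem of_size_le {P : ℤ[X][X]} (hP : size P ≤ N) : IsFrac (N + 1) (valueXY n P) :=
  ⟨P, 1, hP.trans (Nat.le_succ _), by rw [size_one]; exact Nat.succ_pos _,
    by rw [map_one]; exact one_ne_zero, by rw [map_one, mul_one]⟩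

theorem aeval_x {p : ℤ[X]} (hp : size p ≤ N) : IsFrac (N + 1) (Polynomial.aeval (x n) p) := by
  rw [← valueXY_C]
  exact of_size_le (by rwa [size_C])

theorem y : IsFrac 3 (y n) := by
  rw [← valueXY_X]
  exact of_size_le size_X.le

/-- Homogenize: with `g = P / Q`, the value is `∑ aᵢ P ^ i Q ^ (D - i)` divided by `Q ^ D`. -/
theorem aeval (h : IsFrac N g) {p : ℤ[X]} (hp : size p ≤ M) :
    IsFrac ((M + 1) * (N + 1) ^ M) (Polynomial.aeval g p) := by
  obtain ⟨P, Q, h1, h2, h3, h4⟩ := h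
  set D := p.natDegree
  have hD : D ≤ M := (natDegree_le_size p).trans hp
  have hpow : N ^ D ≤ (N + 1) ^ M :=
    (Nat.pow_le_pow_left (Nat.le_succ N) D).trans (Nat.pow_le_pow_right (Nat.succ_pos N) hD)
  have hsz : ∑ i ∈ Finset.range (D + 1), size (p.coeff i) ≤ M := by
    refine le_trans ?_ hp
    rw [size_poly_eq_sum (p := p) (s := Finset.range (D + 1)) fun i hi =>
      Finset.mem_range_succ_iff.mpr (le_natDegree_of_mem_supp i hi)]
    exact Finset.sum_le_sum fun i _ => Nat.le_mul_of_pos_right _ (by positivity)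
  refine ⟨∑ i ∈ Finset.range (D + 1), C (C (p.coeff i)) * (P ^ i * Q ^ (D - i)), Q ^ D, ?_, ?_, ?_, ?_⟩
  · refine (size_sum_le _ _).trans ?_
    refine (Finset.sum_le_sum (g := fun i => size (p.coeff i) * N ^ D) fun i hi => ?_).trans ?_
    · refine (size_mul_le _ _).trans ?_
      rw [size_C, size_C]
      refine Nat.mul_le_mul_left _ ((size_mul_le _ _).trans ?_)
      refine (Nat.mul_le_mul ((size_pow_le _ _).trans (Nat.pow_le_pow_left h1 _))
        ((size_pow_le _ _).trans (Nat.pow_le_pow_left h2 _))).trans ?_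
      rw [← pow_add, Nat.add_sub_cancel' (Finset.mem_range_succ_iff.mp hi)]
    · rw [← Finset.sum_mul]
      exact Nat.mul_le_mul (hsz.trans (Nat.le_succ _)) hpow
  · exact (size_pow_le _ _).trans ((Nat.pow_le_pow_left h2 _).trans
      (hpow.trans (Nat.le_mul_of_pos_left _ (Nat.succ_pos _))))
  · rw [map_pow]
    exact pow_ne_zero _ h3
  · rw [aeval_eq_sum_range, Finset.sum_mul, map_sum]
    refine Finset.sum_congr rfl fun i hi => ?_
    rw [map_mul, map_mul, map_pow, map_pow, map_pow, ← h4, valueXY_C, Polynomial.aeval_C,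
      Algebra.smul_def, mul_pow, mul_assoc, mul_assoc, ← pow_add,
      Nat.add_sub_cancel' (Finset.mem_range_succ_iff.mp hi)]

theorem intCast (c : ℤ) : IsFrac (c.natAbs + 1) (c : FunctionField n) := by
  have := of_size_le (n := n) (P := C (C c)) (N := c.natAbs) (by rw [size_C, size_C, size_int])
  rwa [valueXY_C, aeval_C, eq_intCast] at this

theorem natCast (c : ℕ) : IsFrac (c + 1) (c : FunctionField n) := by
  have := intCast (n := n) c
  rwa [Int.natAbs_natCast, Int.cast_natCast] at this

theorem isDefinedOverRat (h : IsFrac N g) : IsDefinedOverRat g := by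
  have hx : FermatCurve.x n ∈ Subfield.closure {FermatCurve.x n, FermatCurve.y n} :=
    Subfield.subset_closure (by simp)
  have hy : FermatCurve.y n ∈ Subfield.closure {FermatCurve.x n, FermatCurve.y n} :=
    Subfield.subset_closure (by simp)
  have key : ∀ P : ℤ[X][X], valueXY n P ∈ Subfield.closure {FermatCurve.x n, FermatCurve.y n} := by
    intro P
    rw [valueXY, coe_eval₂RingHom, eval₂_eq_sum_range]
    refine sum_mem fun i _ => mul_mem ?_ (pow_mem hy i)
    change Polynomial.aeval (FermatCurve.x n) _ ∈ _
    rw [aeval_eq_sum_range]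
    refine sum_mem fun k _ => ?_
    rw [Algebra.smul_def, eq_intCast]
    exact mul_mem (intCast_mem _ _) (pow_mem hx k)
  obtain ⟨P, Q, -, -, h3, h4⟩ := h
  rw [eq_div_of_mul_eq h3 h4]
  exact div_mem (key P) (key Q)

end IsFrac

end Frac

/-! ### A function with simple poles at all points of bounded height -/

section PoleFunction

variable {n : ℕ}

/-- The polynomial whose roots include the `x`-coordinates of the ramification points of
`poleFunction n q`. -/
def ramificationPoly (n : ℕ) (q : ℤ[X]) : ℤ[X] :=
  (1 - X ^ n) ^ (n + 1) * (X ^ 2 * q ^ 2 - q ^ 2 - X ^ 2 * derivative q) ^ n -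
    (-1) ^ n * X ^ (n * (n + 1)) * q ^ (2 * n)

/-- At `X = 1` the first term vanishes and the second is `± q(1) ^ (2 n)`. -/
theorem ramificationPoly_ne_zero {q : ℤ[X]} (hq : q.eval 1 ≠ 0) : ramificationPoly n q ≠ 0 := by
  intro h
  have := congrArg (eval 1) h
  simp [ramificationPoly, hq] at this

theorem size_ramificationPoly_le {q : ℤ[X]} {N : ℕ} (hn : n ≤ N) (hq : size q ≤ N) :
    size (ramificationPoly n q) ≤
      (1 + 2 ^ N) ^ (N + 1) * (9 * (N * N) + 1) ^ N + 2 ^ (N * (N + 1)) * (N + 1) ^ (2 * N) := by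
  have hq2 : size (q ^ 2) ≤ N * N := by
    rw [pow_two]
    exact (size_mul_le _ _).trans (Nat.mul_le_mul hq hq)
  have hX : ∀ k, size (X ^ k : ℤ[X]) ≤ 2 ^ k := fun k => (size_pow_le _ _).trans (by rw [size_X])
  refine (size_sub_le _ _).trans (add_le_add ?_ ?_)
  · refine (size_mul_le _ _).trans (Nat.mul_le_mul ?_ ?_)
    · refine (size_pow_le _ _).trans ?_
      have h1 : size (1 - X ^ n : ℤ[X]) ≤ 1 + 2 ^ N :=
        (size_sub_le _ _).trans (add_le_add size_one.le
          ((hX n).trans (Nat.pow_le_pow_right two_pos hn)))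
      exact (Nat.pow_le_pow_left h1 _).trans (Nat.pow_le_pow_right (by positivity) (by omega))
    · refine (size_pow_le _ _).trans ?_
      have h1 : size (X ^ 2 * q ^ 2 - q ^ 2 - X ^ 2 * derivative q) ≤ 9 * (N * N) + 1 := by
        have e1 : size (X ^ 2 * q ^ 2) ≤ 4 * (N * N) :=
          (size_mul_le _ _).trans (Nat.mul_le_mul (hX 2) hq2)
        have e2 : size (X ^ 2 * derivative q) ≤ 4 * (N * N) :=
          (size_mul_le _ _).trans (Nat.mul_le_mul (hX 2) ((size_derivative_le q).trans
            (Nat.mul_le_mul hq hq)))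
        have e3 := size_sub_le (X ^ 2 * q ^ 2 - q ^ 2) (X ^ 2 * derivative q)
        have e4 := size_sub_le (X ^ 2 * q ^ 2) (q ^ 2)
        omega
      exact (Nat.pow_le_pow_left h1 _).trans (Nat.pow_le_pow_right (by positivity) hn)
  · refine (size_mul_le _ _).trans (Nat.mul_le_mul ((size_mul_le _ _).trans ?_) ?_)
    · have h1 : size ((-1 : ℤ[X]) ^ n) ≤ 1 := by
        refine (size_pow_le _ _).trans ?_
        rw [size_neg, size_one, one_pow]
      refine (Nat.mul_le_mul h1 (hX _)).trans ?_
      rw [one_mul]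
      exact Nat.pow_le_pow_right two_pos (Nat.mul_le_mul hn (by omega))
    · refine (size_pow_le _ _).trans ((Nat.pow_le_pow_left (hq.trans (Nat.le_succ N)) _).trans ?_)
      exact Nat.pow_le_pow_right (Nat.succ_pos N) (by omega)

theorem Point.affine_eq {P : Point n} (h : P.coords 2 ≠ 0) :
    (P.coords 0 / P.coords 2) ^ n + (P.coords 1 / P.coords 2) ^ n = 1 := by
  rw [div_pow, div_pow, ← add_div, P.coords_eq, div_self (pow_ne_zero _ h)]

variable [NeZero n]

/-- `g` has a simple pole at `P`. -/
def HasSimplePole (P : Point n) (g : FunctionField n) : Prop :=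
  ∃ j, HasJet P g⁻¹ j ∧ j.fst = 0 ∧ j.snd ≠ 0

/-- A regular summand does not affect a simple pole: the reciprocal `a (1 + a b)⁻¹` agrees with `a`
to first order. -/
theorem HasSimplePole.inv_add {P : Point n} {a b : FunctionField n} {j k : DualNumber Qbar}
    (ha : HasJet P a j) (h0 : j.fst = 0) (h1 : j.snd ≠ 0) (hb : HasJet P b k) :
    HasSimplePole P (a⁻¹ + b) := by
  have ha0 : a ≠ 0 := ha.ne_zero fun h => h1 (by rw [h]; rfl)
  have hfst : (1 + j * k).fst = 1 := by simp [h0]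
  have h := ha.mul (((HasJet.one P).add (ha.mul hb)).inv (by rw [hfst]; exact one_ne_zero))
  have he : (a⁻¹ + b)⁻¹ = a * (1 + a * b)⁻¹ := by
    have : a⁻¹ + b = a⁻¹ * (1 + a * b) := by field_simp
    rw [this, mul_inv, inv_inv]
  refine ⟨_, he ▸ h, by simp [h0], ?_⟩
  rw [TrivSqZeroExt.snd_mul, h0, TrivSqZeroExt.fst_inv, hfst]
  simpa using h1

/-- The function `x + 1 / x + 1 / y + 1 / q(x)`. -/
def poleFunction (n : ℕ) [NeZero n] (q : ℤ[X]) : FunctionField n :=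
  x n + (x n)⁻¹ + (y n)⁻¹ + (aeval (x n) q)⁻¹

/-- At infinity `x` has a simple pole and the other summands are regular: `1 / y = (1 / x) (x / y)`,
and `1 / q(x)` is a power of `1 / x` divided by the reversed polynomial at `1 / x`, which is nonzero
there since `q` has nonzero leading coefficient. -/
theorem hasSimplePole_of_coords_eq_zero {q : ℤ[X]} (hq : q ≠ 0) {P : Point n}
    (h : P.coords 2 = 0) : HasSimplePole P (poleFunction n q) := by
  obtain ⟨j, hj, h0, h1⟩ := hasJet_x_inv h
  obtain ⟨k, hk⟩ := hasJet_x_div_y h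
  have hr := hj.aeval q.reverse
  have hr0 : (aeval j q.reverse).fst ≠ 0 := by
    rw [fst_aeval_dual, h0, aeval_def, eval₂_at_zero, coeff_zero_reverse, eq_intCast]
    exact_mod_cast leadingCoeff_ne_zero.mpr hq
  have hx := x_ne_zero (n := n)
  have hinv : (aeval (x n) q)⁻¹ = (x n)⁻¹ ^ q.natDegree * (aeval (x n)⁻¹ q.reverse)⁻¹ := by
    let := invertibleOfNonzero hx
    have := eval₂_reverse_mul_pow (algebraMap ℤ (FunctionField n)) (x n) q
    rw [invOf_eq_inv] at this
    rw [aeval_def, aeval_def, ← this, mul_inv, mul_comm, inv_pow]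
  have := HasSimplePole.inv_add hj h0 h1 ((hj.add (hj.mul hk)).add
    ((hj.pow q.natDegree).mul (hr.inv hr0)))
  convert this using 1
  rw [poleFunction, hinv, inv_inv]
  have hy := y_ne_zero (n := n)
  field_simp
  ring

/-- The hypothesis `h` says that the derivative of `poleFunction n q` along the tangent vector
vanishes. With `u = q(a)` and `v = q'(a)` it becomes `b ^ (n + 1) (a² u² - u² - a² v) = -a ^ (n + 1)
u²`. Taking `n`-th powers and substituting `b ^ n = 1 - a ^ n` eliminates `b`. -/
theorem aeval_ramificationPoly_eq_zero {q : ℤ[X]} {a b k : Qbar} (hab : a ^ n + b ^ n = 1)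
    (ha : a ≠ 0) (hb : b ≠ 0) (hq : aeval a q ≠ 0) (hk : k ≠ 0)
    (h : k * b ^ (n - 1) - k * b ^ (n - 1) / a ^ 2 + k * a ^ (n - 1) / b ^ 2 -
      aeval a (derivative q) * (k * b ^ (n - 1)) / aeval a q ^ 2 = 0) :
    aeval a (ramificationPoly n q) = 0 := by
  obtain ⟨m, rfl⟩ : ∃ m, n = m + 1 := ⟨n - 1, (Nat.succ_pred_eq_of_ne_zero (NeZero.ne n)).symm⟩
  rw [Nat.add_sub_cancel] at h
  set u := aeval a q
  set v := aeval a (derivative q)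
  have h1 : b ^ (m + 2) * (a ^ 2 * u ^ 2 - u ^ 2 - a ^ 2 * v) = -(a ^ (m + 2) * u ^ 2) := by
    field_simp at h
    have h2 : (b ^ (m + 2) * (a ^ 2 * u ^ 2 - u ^ 2 - a ^ 2 * v) + a ^ (m + 2) * u ^ 2) = 0 := by
      refine (mul_eq_zero.mp ?_).resolve_left hk
      linear_combination h
    linear_combination h2
  have h2 := congrArg (fun z => z ^ (m + 1)) h1
  rw [mul_pow, neg_pow, mul_pow] at h2
  have hb' : 1 - a ^ (m + 1) = b ^ (m + 1) := by linear_combination -hab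
  have hr : aeval a (ramificationPoly (m + 1) q) =
      (1 - a ^ (m + 1)) ^ (m + 1 + 1) * (a ^ 2 * u ^ 2 - u ^ 2 - a ^ 2 * v) ^ (m + 1) -
        (-1) ^ (m + 1) * a ^ ((m + 1) * (m + 1 + 1)) * u ^ (2 * (m + 1)) := by
    simp [ramificationPoly, u, v]
  rw [hr, hb']
  linear_combination h2

theorem hasJet_poleFunction {q : ℤ[X]} {P : Point n} {a b : Qbar} (h : P.coords 2 ≠ 0)
    (ha : a = P.coords 0 / P.coords 2) (hb : b = P.coords 1 / P.coords 2) (ha0 : a ≠ 0)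
    (hb0 : b ≠ 0) (hq : aeval a q ≠ 0) :
    ∃ j, HasJet P (poleFunction n q) j ∧ j.fst = a + a⁻¹ + b⁻¹ + (aeval a q)⁻¹ ∧
      (j.snd = 0 → aeval a (ramificationPoly n q) = 0) := by
  have hab : a ^ n + b ^ n = 1 := by
    rw [ha, hb]
    exact Point.affine_eq h
  obtain ⟨jx, hx, hx0, hx1⟩ := hasJet_x h
  obtain ⟨jy, hy, hy0, hy1⟩ := hasJet_y h
  rw [← ha] at hx0
  rw [← hb] at hy0
  have hqx := hx.aeval q
  have hqf : (aeval jx q).fst = aeval a q := by rw [fst_aeval_dual, hx0]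
  have hqs : (aeval jx q).snd = aeval a (derivative q) * jx.snd := by rw [snd_aeval_dual, hx0]
  set k : Qbar := P.coords 2 ^ (n - 1) / P.coords 2 with hk
  have hk0 : k ≠ 0 := div_ne_zero (pow_ne_zero _ h) h
  have hx2 : jx.snd = k * b ^ (n - 1) := by
    rw [hx1, hk, hb, div_pow]
    field_simp
  have hy2 : jy.snd = -(k * a ^ (n - 1)) := by
    rw [hy1, hk, ha, div_pow]
    field_simp
  have hj := ((hx.add (hx.inv (by rwa [hx0]))).add (hy.inv (by rwa [hy0]))).add
    (hqx.inv (by rwa [hqf]))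
  refine ⟨_, hj, by simp [hx0, hy0, hqf], fun h0 => ?_⟩
  refine aeval_ramificationPoly_eq_zero hab ha0 hb0 hq hk0 ?_
  rw [← h0]
  simp [hx0, hy0, hqf, hqs, hx2, hy2]
  field_simp
  ring

/-- In each case exactly one summand has a pole: `1 / x` if `a = 0`, since then `q(a) = σ(0) ≠ 0`;
`1 / y` if `b = 0`, since then `a ^ n = 1` and `q(a) = σ(1) ≠ 0`; otherwise `1 / q(x)`. The last
pole is simple because `σ` has simple roots, `a ≠ 0`, and `x` is a local parameter where `b ≠ 0`. -/
theorem hasSimplePole_of_root {σ : ℤ[X]} {P : Point n} {a b : Qbar} (h : P.coords 2 ≠ 0)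
    (ha : a = P.coords 0 / P.coords 2) (hb : b = P.coords 1 / P.coords 2)
    (h0 : σ.eval 0 ≠ 0) (h1 : σ.eval 1 ≠ 0)
    (hσ : ∀ z : Qbar, aeval z σ = 0 → aeval z (derivative σ) ≠ 0)
    (hz : a = 0 ∨ b = 0 ∨ aeval a (expand ℤ n σ) = 0) :
    HasSimplePole P (poleFunction n (expand ℤ n σ)) := by
  have hn : n ≠ 0 := NeZero.ne n
  have hab : a ^ n + b ^ n = 1 := by
    rw [ha, hb]
    exact Point.affine_eq h
  obtain ⟨jx, hx, hx0, hx1⟩ := hasJet_x h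
  obtain ⟨jy, hy, hy0, hy1⟩ := hasJet_y h
  rw [← ha] at hx0
  rw [← hb] at hy0
  have hqx := hx.aeval (expand ℤ n σ)
  have hqf : (aeval jx (expand ℤ n σ)).fst = aeval (a ^ n) σ := by
    rw [fst_aeval_dual, hx0, expand_aeval]
  have hcast : ∀ c : ℤ, aeval (c : Qbar) σ = ((σ.eval c : ℤ) : Qbar) := fun c => by
    have := aeval_algebraMap_apply Qbar c σ
    rwa [eq_intCast, eq_intCast, coe_aeval_eq_eval] at this
  have hsx : b ≠ 0 → jx.snd ≠ 0 := fun hb0 => by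
    rw [hx1]
    refine div_ne_zero (pow_ne_zero _ fun h' => hb0 ?_) h
    rw [hb, h', zero_div]
  rw [poleFunction]
  by_cases ha0 : a = 0
  · have hb0 : b ≠ 0 := by
      rintro rfl
      rw [ha0, zero_pow hn, add_zero] at hab
      exact zero_ne_one hab
    have hq0 : (aeval jx (expand ℤ n σ)).fst ≠ 0 := by
      rw [hqf, ha0, zero_pow hn]
      have := hcast 0
      rw [Int.cast_zero] at this
      rw [this]
      exact_mod_cast h0
    have := HasSimplePole.inv_add hx (hx0.trans ha0) (hsx hb0) ((hx.add (hy.inv (by rwa [hy0]))).add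
      (hqx.inv hq0))
    convert this using 1
    ring
  by_cases hb0 : b = 0
  · have han : a ^ n = 1 := by rwa [hb0, zero_pow hn, add_zero] at hab
    have hq0 : (aeval jx (expand ℤ n σ)).fst ≠ 0 := by
      rw [hqf, han]
      have := hcast 1
      rw [Int.cast_one] at this
      rw [this]
      exact_mod_cast h1
    have hs : jy.snd ≠ 0 := by
      rw [hy1]
      refine div_ne_zero (neg_ne_zero.mpr (pow_ne_zero _ fun h' => ha0 ?_)) h
      rw [ha, h', zero_div]
    have := HasSimplePole.inv_add hy (hy0.trans hb0) hs ((hx.add (hx.inv (by rwa [hx0]))).add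
      (hqx.inv hq0))
    convert this using 1
    ring
  have hz' := (hz.resolve_left ha0).resolve_left hb0
  rw [expand_aeval] at hz'
  have hs : (aeval jx (expand ℤ n σ)).snd ≠ 0 := by
    rw [snd_aeval_dual, hx0, derivative_expand]
    refine mul_ne_zero ?_ (hsx hb0)
    rw [map_mul, expand_aeval]
    refine mul_ne_zero (hσ _ hz') ?_
    simp [hn, ha0]
  have := HasSimplePole.inv_add hqx (hqf.trans hz') hs ((hx.add (hx.inv (by rwa [hx0]))).add
    (hy.inv (by rwa [hy0])))
  convert this using 1
  ring

end PoleFunction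

/-- A function with simple poles at all points of bounded degree and height, whose finite critical
values are roots of integral polynomials of bounded size. -/
theorem exists_pole_function : ∃ F : ℕ → ℕ, Primrec F ∧ ∀ (n : ℕ) [NeZero n] (N : ℕ), n ≤ N →
    ∃ G : FunctionField n, IsFrac (F N) G ∧ ∀ P : Point n, HasSimplePole P G ∨
      ((∃ j, HasJet P G j ∧
        (j.snd = 0 → ∃ p : ℤ[X], p ≠ 0 ∧ size p ≤ F N ∧ aeval j.fst p = 0)) ∧
        ¬ (pointDegree (piMap P) ≤ N ∧ pointHeight (piMap P) ≤ N)) := by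
  obtain ⟨Fs, hFs, hsq⟩ := exists_squarefree_poly
  obtain ⟨Fe, hFe, hpoly⟩ := IsBdd.exists_poly
  obtain ⟨Fi, hFi, hinv⟩ := IsBdd.inv
  obtain ⟨Fp, hFp, hroot⟩ := IsBdd.of_pow
  -- The bounds follow a critical point `(a, b)`: `A` for `σ`, `E` for `q = σ(X ^ n)`, `W` for the
  -- ramification polynomial, `T` for `a`, `T2` for `q(a)` and `b ^ n`, `T3` for `b`, `T4` for the
  -- inverses; each application of `D` pays for one addition.
  let A : ℕ → ℕ := fun N => Fs (3 ^ (N * N) + N) + N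
  let E : ℕ → ℕ := fun N => (A N * A N + 1) * (A N * 2 ^ (A N * A N)) + N
  let W : ℕ → ℕ := fun N => (1 + 2 ^ E N) ^ (E N + 1) * (9 * (E N * E N) + 1) ^ E N +
    2 ^ (E N * (E N + 1)) * (E N + 1) ^ (2 * E N)
  let T : ℕ → ℕ := fun N => W N + 1 + (1 + 2 ^ N) + E N
  let T2 : ℕ → ℕ := fun N => T N * T N ^ T N + T N
  let T3 : ℕ → ℕ := fun N => T2 N + Fp (T2 N)
  let T4 : ℕ → ℕ := fun N => T3 N + Fi (T3 N)
  let D : ℕ → ℕ := fun N => 2 * (N * N)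
  have hA : Primrec A := primrec_nat_add (hFs.comp (by
    apply_rules [primrec_nat_mul, primrec_nat_add, primrec_nat_pow, Primrec.id, Primrec.const]))
    Primrec.id
  have hE : Primrec E := by
    apply_rules [primrec_nat_mul, primrec_nat_add, primrec_nat_pow, Primrec.id, Primrec.const]
  have hW : Primrec W := by
    apply_rules [primrec_nat_mul, primrec_nat_add, primrec_nat_pow, Primrec.id, Primrec.const]
  have hT : Primrec T := by
    apply_rules [primrec_nat_mul, primrec_nat_add, primrec_nat_pow, Primrec.id, Primrec.const]
  have hT2 : Primrec T2 := by
    apply_rules [primrec_nat_mul, primrec_nat_add, primrec_nat_pow, Primrec.id, Primrec.const]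
  have hT3 : Primrec T3 := primrec_nat_add hT2 (hFp.comp hT2)
  have hT4 : Primrec T4 := primrec_nat_add hT3 (hFi.comp hT3)
  have hD : Primrec D := by
    apply_rules [primrec_nat_mul, primrec_nat_add, primrec_nat_pow, Primrec.id, Primrec.const]
  have hDle : ∀ N, N ≤ D N := fun N => by
    rcases Nat.eq_zero_or_pos N with rfl | hN
    · exact Nat.zero_le _
    · change N ≤ 2 * (N * N)
      nlinarith
  refine ⟨fun N => Fe (D (D (D (T4 N)))) + D (D (D (E N + 3))), primrec_nat_add
    (hFe.comp (hD.comp (hD.comp (hD.comp hT4)))) (hD.comp (hD.comp (hD.comp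
      (primrec_nat_add hE (Primrec.const 3))))), fun n _ N hN => ?_⟩
  -- By `IsBdd.of_pointHeight_le`, the argument `3 ^ (N * N) + N` covers all algebraic numbers of
  -- degree and height at most `N`.
  obtain ⟨σ, hσN, hσ, h0, h1, hder⟩ := hsq (3 ^ (N * N) + N)
  have hn : n ≠ 0 := NeZero.ne n
  have hσ0 : σ ≠ 0 := by
    rintro rfl
    simp at h0
  have hq0 : expand ℤ n σ ≠ 0 := (expand_ne_zero (Nat.pos_of_ne_zero hn)).mpr hσ0
  have hqN : size (expand ℤ n σ) ≤ (A N * A N + 1) * (A N * 2 ^ (A N * A N)) :=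
    size_expand_le hn (hN.trans (Nat.le_add_left _ _)) (hσN.trans (Nat.le_add_right _ _))
  have hqE : size (expand ℤ n σ) ≤ E N := hqN.trans (Nat.le_add_right _ _)
  have hNE : N ≤ E N := Nat.le_add_left _ _
  refine ⟨poleFunction n (expand ℤ n σ), ?_, fun P => ?_⟩
  · have hx : IsFrac (E N + 3) (x n) := by
      have := IsFrac.aeval_x (n := n) (p := X) (N := 2) size_X.le
      rw [aeval_X] at this
      exact this.mono (by omega)
    have hy : IsFrac (E N + 3) (y n)⁻¹ := (IsFrac.y.inv y_ne_zero).mono (by omega)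
    have hq : IsFrac (E N + 3) (aeval (x n) (expand ℤ n σ))⁻¹ :=
      ((IsFrac.aeval_x hqE).inv ((aeval_int_x_eq_zero_iff _).not.mpr hq0)).mono (by omega)
    have hx' := hx.inv x_ne_zero
    have s1 : IsFrac (D (E N + 3)) (x n + (x n)⁻¹) := hx.add hx'
    have s2 : IsFrac (D (D (E N + 3))) (x n + (x n)⁻¹ + (y n)⁻¹) := s1.add (hy.mono (hDle _))
    have s3 : IsFrac (D (D (D (E N + 3)))) (poleFunction n (expand ℤ n σ)) :=
      s2.add (hq.mono ((hDle _).trans (hDle _)))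
    exact s3.mono (Nat.le_add_left _ _)
  by_cases h2 : P.coords 2 = 0
  · exact Or.inl (hasSimplePole_of_coords_eq_zero hq0 h2)
  by_cases hz : P.coords 0 / P.coords 2 = 0 ∨ P.coords 1 / P.coords 2 = 0 ∨
      aeval (P.coords 0 / P.coords 2) (expand ℤ n σ) = 0
  · exact Or.inl (hasSimplePole_of_root h2 rfl rfl h0 h1 hder hz)
  right
  set a : Qbar := P.coords 0 / P.coords 2 with ha
  set b : Qbar := P.coords 1 / P.coords 2 with hb
  have hab : a ^ n + b ^ n = 1 := Point.affine_eq h2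
  push Not at hz
  obtain ⟨ha0, hb0, hqa⟩ := hz
  constructor
  · obtain ⟨j, hj, hfst, hsnd⟩ := hasJet_poleFunction (q := expand ℤ n σ) h2 ha hb ha0 hb0 hqa
    refine ⟨j, hj, fun hs => ?_⟩
    have hq1 : (expand ℤ n σ).eval 1 ≠ 0 := by rwa [expand_eval, one_pow]
    -- At a critical point `a` is a root of the ramification polynomial. From `a` the bounds pass to
    -- `q(a)`, to `b ^ n = 1 - a ^ n`, to `b`, and finally to the critical value `a + 1/a + 1/b +
    -- 1/q(a)`.
    have haT : IsBdd (T N) a := by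
      refine (IsBdd.of_root (ramificationPoly_ne_zero (n := n) hq1)
        (size_ramificationPoly_le (hN.trans hNE) hqE) (hsnd hs)).mono ?_
      exact (Nat.le_add_right _ _).trans (Nat.le_add_right _ _)
    have hqT : IsBdd (T2 N) (aeval a (expand ℤ n σ)) :=
      haT.aeval (hqE.trans (Nat.le_add_left _ _))
    have hbT : IsBdd (T2 N) (b ^ n) := by
      have h3 : size (1 - X ^ n : ℤ[X]) ≤ T N := by
        refine (size_sub_le _ _).trans ((add_le_add size_one.le (((size_pow_le _ _).trans
          (by rw [size_X])).trans (Nat.pow_le_pow_right two_pos hN))).trans ?_)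
        exact (Nat.le_add_left _ _).trans (Nat.le_add_right _ _)
      have h4 := haT.aeval h3
      have h5 : aeval a (1 - X ^ n : ℤ[X]) = b ^ n := by
        rw [map_sub, map_one, map_pow, aeval_X]
        linear_combination -hab
      rwa [h5] at h4
    have hnT : n ≤ T2 N := hN.trans (hNE.trans ((Nat.le_add_left _ _).trans (Nat.le_add_left _ _)))
    have hb3 : IsBdd (T3 N) b := (hroot _ _ _ hn hnT hbT).mono (Nat.le_add_left _ _)
    have ha3 : IsBdd (T3 N) a := haT.mono ((Nat.le_add_left _ _).trans (Nat.le_add_right _ _))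
    have hq3 : IsBdd (T3 N) (aeval a (expand ℤ n σ)) := hqT.mono (Nat.le_add_right _ _)
    have ha4 : IsBdd (T4 N) a := ha3.mono (Nat.le_add_right _ _)
    have hai : IsBdd (T4 N) a⁻¹ := (hinv _ _ ha3).mono (Nat.le_add_left _ _)
    have hbi : IsBdd (T4 N) b⁻¹ := (hinv _ _ hb3).mono (Nat.le_add_left _ _)
    have hqi : IsBdd (T4 N) (aeval a (expand ℤ n σ))⁻¹ := (hinv _ _ hq3).mono (Nat.le_add_left _ _)
    have s1 : IsBdd (D (T4 N)) (a + a⁻¹) := ha4.add hai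
    have s2 : IsBdd (D (D (T4 N))) (a + a⁻¹ + b⁻¹) := s1.add (hbi.mono (hDle _))
    have s3 : IsBdd (D (D (D (T4 N)))) (a + a⁻¹ + b⁻¹ + (aeval a (expand ℤ n σ))⁻¹) :=
      s2.add (hqi.mono ((hDle _).trans (hDle _)))
    obtain ⟨p, hp0, hpN, hpr, -⟩ := hpoly _ _ s3
    exact ⟨p, hp0, hpN.trans (Nat.le_add_right _ _), by rw [hfst]; exact hpr⟩
  -- If `π(P) = a ^ n` were bounded, then `σ(a ^ n) = 0`, as `a ^ n` is neither `0` nor, because of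
  -- `b ≠ 0`, equal to `1`; but `q(a) ≠ 0` here.
  · rintro ⟨hd, hh⟩
    have hpi : piMap P = ((a ^ n : Qbar) : OnePoint Qbar) := by
      rw [piMap, if_neg h2, ha, div_pow]
    rw [hpi] at hd hh
    refine hqa ?_
    rw [expand_aeval]
    refine hσ _ (IsBdd.of_pointHeight_le hd hh) (pow_ne_zero _ ha0) fun h => ?_
    rw [h] at hab
    exact hb0 (pow_eq_zero_iff hn |>.mp (by linear_combination hab))

/-! ### Lowering the degrees of the critical values -/

section Stage

variable {n : ℕ} [NeZero n]

/-- A function `g` of bounded size whose finite critical values are roots of the polynomials in `L`,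
all of absolute value at most `R`, and which is unramified at the points of `S`, with the common
value `t` there, where `t` is much larger than `R`. The number `s` bounds the number of steps
needed to make all polynomials in `L` linear. -/
structure Stage (S : Set (Point n)) (N : ℕ) (g : FunctionField n) (L : Multiset ℤ[X]) (t R s : ℕ) :
    Prop where
  isFrac : IsFrac N g
  regular : ∀ P : Point n, (∃ j, HasJet P g j ∧ (j.snd = 0 → ∃ l ∈ L, aeval j.fst l = 0)) ∨
    (g ≠ 0 ∧ ∃ j, HasJet P g⁻¹ j ∧ j.fst = 0)
  marked : ∀ P ∈ S, ∃ j, HasJet P g j ∧ j.fst = t ∧ j.snd ≠ 0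
  ne_zero : ∀ l ∈ L, l ≠ 0
  size_le : ∀ l ∈ L, size l ≤ N
  norm_le : ∀ l ∈ L, ∀ z : ℂ, aeval z l = 0 → ‖z‖ ≤ R
  one_le : 1 ≤ R
  le_size : t ≤ N
  large : 3 ^ (s + 1) * R ≤ t
  measure : (L.map fun l => l.natDegree - 1).sum ≤ s

theorem aeval_natCast {k : Type*} [CommRing k] [Algebra ℤ k] (p : ℤ[X]) (t : ℕ) :
    aeval (t : k) p = ((p.eval (t : ℤ) : ℤ) : k) := by
  rw [aeval_def, eval₂_at_natCast, eq_intCast]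

/-- Nonconstant polynomials preserve poles: `p(g)` is `g ^ deg p` times the reversed polynomial at
`1 / g`, whose value at `P` is the leading coefficient. -/
theorem HasJet.inv_aeval {P : Point n} {g : FunctionField n} {j : DualNumber Qbar} (hg : g ≠ 0)
    (h : HasJet P g⁻¹ j) (h0 : j.fst = 0) {p : ℤ[X]} (hp : p.natDegree ≠ 0) :
    Polynomial.aeval g p ≠ 0 ∧ ∃ j', HasJet P (Polynomial.aeval g p)⁻¹ j' ∧ j'.fst = 0 := by
  have hp0 : p ≠ 0 := by
    rintro rfl
    exact hp natDegree_zero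
  have hr := h.aeval p.reverse
  have hr0 : (Polynomial.aeval j p.reverse).fst ≠ 0 := by
    rw [fst_aeval_dual, h0, aeval_def, eval₂_at_zero, coeff_zero_reverse, eq_intCast]
    exact_mod_cast leadingCoeff_ne_zero.mpr hp0
  have hrne : Polynomial.aeval g⁻¹ p.reverse ≠ 0 := hr.ne_zero fun h' => hr0 (by rw [h']; rfl)
  have heq : Polynomial.aeval g p = Polynomial.aeval g⁻¹ p.reverse * g ^ p.natDegree := by
    let := invertibleOfNonzero hg
    have := eval₂_reverse_mul_pow (algebraMap ℤ (FunctionField n)) g p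
    rw [invOf_eq_inv] at this
    rw [aeval_def, aeval_def, ← this]
  refine ⟨by rw [heq]; exact mul_ne_zero hrne (pow_ne_zero _ hg), ?_⟩
  refine ⟨(Polynomial.aeval j p.reverse)⁻¹ * j ^ p.natDegree, ?_, ?_⟩
  · rw [heq, mul_inv, ← inv_pow]
    exact (hr.inv hr0).mul (h.pow _)
  · rw [TrivSqZeroExt.fst_mul, TrivSqZeroExt.fst_pow, h0, zero_pow hp, mul_zero]

/-- Compose `g` with a polynomial `p` from `L` of degree at least two. Critical values of `p(g)` are
images of critical values of `g` or of roots of `p'`. Roots of `p` itself go to `0`, so `p` is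
replaced by `X` and by `pushPoly p p'`, while each other polynomial keeps its degree. All these
images lie in a disc whose radius is controlled by Gauss–Lucas, and `p(t)` stays far outside. -/
theorem exists_stage_step : ∃ F : ℕ → ℕ, Primrec F ∧ (∀ N, N ≤ F N) ∧
    ∀ (n : ℕ) [NeZero n] (S : Set (Point n)) (N : ℕ) (g : FunctionField n) (L : Multiset ℤ[X])
      (t R s : ℕ), Stage S N g L t R (s + 1) → (∃ p ∈ L, 2 ≤ p.natDegree) →
      ∃ g' L' t' R', Stage S (F N) g' L' t' R' s := by
  obtain ⟨E, hE, hpush⟩ := exists_size_pushPoly_le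
  refine ⟨fun N => (N + 1) * (N + 1) ^ N + E (N * N + N) + 2 + N, ?_, fun N => Nat.le_add_left _ _,
    fun n _ S N g L t R s h hp => ?_⟩
  · have h1 : Primrec fun N => E (N * N + N) := hE.comp (by
      apply_rules [primrec_nat_mul, primrec_nat_add, primrec_nat_pow, Primrec.id, Primrec.const])
    apply_rules [primrec_nat_mul, primrec_nat_add, primrec_nat_pow, Primrec.id, Primrec.const]
  obtain ⟨p₀, hp₀, hd₀⟩ := hp
  obtain ⟨L₁, rfl⟩ := Multiset.exists_cons_of_mem hp₀
  -- The sign is chosen so that the new marked value `p(t)` is a natural number.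
  obtain ⟨p, hpp, hpos⟩ : ∃ p : ℤ[X], (p = p₀ ∨ p = -p₀) ∧ 0 ≤ p.eval (t : ℤ) := by
    rcases le_total 0 (p₀.eval (t : ℤ)) with h0 | h0
    · exact ⟨p₀, Or.inl rfl, h0⟩
    · exact ⟨-p₀, Or.inr rfl, by simpa using h0⟩
  have hroot : ∀ {k : Type} [CommRing k] [Algebra ℤ k] (z : k),
      aeval z p = 0 ↔ aeval z p₀ = 0 := by
    intro k _ _ z
    rcases hpp with rfl | rfl
    · rfl
    · rw [map_neg, neg_eq_zero]
  have hdeg : p.natDegree = p₀.natDegree := by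
    rcases hpp with rfl | rfl
    · rfl
    · rw [natDegree_neg]
  have hsize : size p ≤ N := by
    refine le_trans ?_ (h.size_le p₀ hp₀)
    rcases hpp with rfl | rfl
    · rfl
    · rw [size_neg]
  have hd : 2 ≤ p.natDegree := hdeg ▸ hd₀
  have hnorm : ∀ z : ℂ, aeval z p = 0 → ‖z‖ ≤ R := fun z hz =>
    h.norm_le p₀ hp₀ z ((hroot z).mp hz)
  have hp0 : p ≠ 0 := by
    rintro rfl
    simp at hd
  have hder0 : derivative p ≠ 0 := fun h0 => by
    have := derivative_eq_zero.mp h0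
    omega
  have hR1 : (1 : ℝ) ≤ R := by exact_mod_cast h.one_le
  set t' := (p.eval (t : ℤ)).natAbs with ht'
  have ht'c : ∀ {k : Type} [CommRing k] [Algebra ℤ k], aeval (t : k) p = (t' : k) := by
    intro k _ _
    have : (t' : ℤ) = p.eval (t : ℤ) := Int.natAbs_of_nonneg hpos
    rw [aeval_natCast, ← this, Int.cast_natCast]
  have htR : 3 * 3 ^ (s + 1) * R ≤ t := by
    have := h.large
    rwa [pow_succ, mul_comm (3 ^ (s + 1)) 3] at this
  have htR' : (R : ℝ) + 2 * 3 ^ (s + 1) * R ≤ t := by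
    have h1 : ((3 * 3 ^ (s + 1) * R : ℕ) : ℝ) ≤ t := by exact_mod_cast htR
    push_cast at h1
    have h2 : (1 : ℝ) ≤ 3 ^ (s + 1) := one_le_pow₀ (by norm_num)
    nlinarith
  have ht1 : (1 : ℝ) ≤ t := by
    have h2 : (0 : ℝ) ≤ 2 * 3 ^ (s + 1) * R := by positivity
    linarith
  have htlt : (R : ℝ) < t := by
    have h2 : (0 : ℝ) < 2 * 3 ^ (s + 1) * R := by positivity
    linarith
  have hlc : 1 ≤ p.leadingCoeff.natAbs := Int.natAbs_pos.mpr (leadingCoeff_ne_zero.mpr hp0)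
  -- For `‖z‖ ≤ R` each factor `z - b` of `p(z)` has absolute value at most `2 * R`.
  set R' := p.leadingCoeff.natAbs * (2 * R) ^ p.natDegree with hR'
  have hR'c : (R' : ℝ) = |(p.leadingCoeff : ℝ)| * (2 * R) ^ p.natDegree := by
    rw [hR']
    push_cast [Nat.cast_natAbs]
    rfl
  have hbound : ∀ z : ℂ, ‖z‖ ≤ R → ‖aeval z p‖ ≤ R' := fun z hz => by
    rw [hR'c]
    exact norm_aeval_le_of_roots hnorm hz
  have hcrit : ∀ z : ℂ, aeval z (derivative p) = 0 → ‖z‖ ≤ R := fun z hz =>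
    norm_le_of_aeval_derivative_eq_zero hd hnorm hz
  -- Since `t > R`, it is not a critical point of `p`, and the marked points stay unramified.
  have hder_t : (derivative p).eval (t : ℤ) ≠ 0 := fun h0 => by
    have h1 := hcrit (t : ℂ) (by rw [aeval_natCast, h0, Int.cast_zero])
    rw [Complex.norm_natCast] at h1
    linarith
  have hsz : ∀ l ∈ L₁, size l ≤ N := fun l hl => h.size_le l (Multiset.mem_cons_of_mem hl)
  have hne : ∀ l ∈ L₁, l ≠ 0 := fun l hl => h.ne_zero l (Multiset.mem_cons_of_mem hl)
  refine ⟨aeval g p, X ::ₘ pushPoly p (derivative p) ::ₘ L₁.map (pushPoly p), t', R', ?_⟩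
  beta_reduce
  refine ⟨?_, fun P => ?_, fun P hP => ?_, ?_, ?_, ?_, ?_, ?_, ?_, ?_⟩
  · exact (h.isFrac.aeval hsize).mono (by omega)
  · rcases h.regular P with ⟨j, hj, hcr⟩ | ⟨hg, j, hj, h0⟩
    · refine Or.inl ⟨_, hj.aeval p, fun hs => ?_⟩
      rw [snd_aeval_dual] at hs
      rw [fst_aeval_dual]
      rcases mul_eq_zero.mp hs with hs | hs
      · refine ⟨pushPoly p (derivative p), by simp, ?_⟩
        exact (aeval_pushPoly_eq_zero_iff p hder0 _).mpr ⟨_, hs, rfl⟩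
      · obtain ⟨l, hl, hl0⟩ := hcr hs
        rcases Multiset.mem_cons.mp hl with rfl | hl
        · refine ⟨X, by simp, ?_⟩
          rw [aeval_X]
          exact (hroot _).mpr hl0
        · refine ⟨pushPoly p l, ?_, ?_⟩
          · exact Multiset.mem_cons_of_mem (Multiset.mem_cons_of_mem (Multiset.mem_map_of_mem _ hl))
          · exact (aeval_pushPoly_eq_zero_iff p (hne l hl) _).mpr ⟨_, hl0, rfl⟩
    · exact Or.inr (HasJet.inv_aeval hg hj h0 (by omega))
  · obtain ⟨j, hj, h0, h1⟩ := h.marked P hP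
    refine ⟨_, hj.aeval p, ?_, ?_⟩
    · rw [fst_aeval_dual, h0, ht'c]
    · rw [snd_aeval_dual, h0, aeval_natCast]
      exact mul_ne_zero (Int.cast_ne_zero.mpr hder_t) h1
  · intro l hl
    rcases Multiset.mem_cons.mp hl with rfl | hl
    · exact X_ne_zero
    rcases Multiset.mem_cons.mp hl with rfl | hl
    · exact (pushPoly_spec hder0).1
    obtain ⟨m, hm, rfl⟩ := Multiset.mem_map.mp hl
    exact (pushPoly_spec (hne m hm)).1
  · intro l hl
    rcases Multiset.mem_cons.mp hl with rfl | hl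
    · rw [size_X]
      omega
    have hb : ∀ l : ℤ[X], l ≠ 0 → size l ≤ N * N + N →
        size (pushPoly p l) ≤ (N + 1) * (N + 1) ^ N + E (N * N + N) + 2 + N := fun l hl0 hl => by
      have := hpush (N * N + N) p l hl0 (hsize.trans (Nat.le_add_left _ _)) hl
      omega
    rcases Multiset.mem_cons.mp hl with rfl | hl
    · exact hb _ hder0 (((size_derivative_le p).trans (Nat.mul_le_mul hsize hsize)).trans
        (Nat.le_add_right _ _))
    obtain ⟨m, hm, rfl⟩ := Multiset.mem_map.mp hl
    exact hb m (hne m hm) ((hsz m hm).trans (Nat.le_add_left _ _))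
  · intro l hl z hz
    rcases Multiset.mem_cons.mp hl with rfl | hl
    · rw [aeval_X] at hz
      rw [hz, norm_zero]
      exact Nat.cast_nonneg _
    rcases Multiset.mem_cons.mp hl with rfl | hl
    · obtain ⟨w, hw, rfl⟩ := (aeval_pushPoly_eq_zero_iff p hder0 _).mp hz
      exact hbound w (hcrit w hw)
    obtain ⟨m, hm, rfl⟩ := Multiset.mem_map.mp hl
    obtain ⟨w, hw, rfl⟩ := (aeval_pushPoly_eq_zero_iff p (hne m hm) _).mp hz
    exact hbound w (h.norm_le m (Multiset.mem_cons_of_mem hm) w hw)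
  · have := h.one_le
    exact Nat.mul_pos hlc (Nat.pow_pos (by omega))
  · have h1 := norm_aeval_le p ht1 (z := (t : ℂ)) (by rw [Complex.norm_natCast])
    rw [ht'c, Complex.norm_natCast] at h1
    have h2 : t' ≤ size p * t ^ p.natDegree := by exact_mod_cast h1
    have h3 : size p * t ^ p.natDegree ≤ (N + 1) * (N + 1) ^ N := by
      refine Nat.mul_le_mul (hsize.trans (Nat.le_succ N)) ?_
      exact (Nat.pow_le_pow_left (h.le_size.trans (Nat.le_succ N)) _).trans
        (Nat.pow_le_pow_right (Nat.succ_pos N) ((natDegree_le_size p).trans hsize))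
    omega
  -- From `t ≥ 3 ^ (s + 2) * R` the distance of `t` to each root is at least `2 * 3 ^ (s + 1) * R`.
  -- Hence `p(t)` is at least `(3 ^ (s + 1)) ^ deg p * R'`; the separation loses at most one factor
  -- `3` in each step.
  · have h1 := le_norm_aeval_of_roots hnorm (z := (t : ℂ)) (r := 2 * 3 ^ (s + 1) * R)
      (by positivity) (by rw [Complex.norm_natCast]; exact htR')
    rw [ht'c, Complex.norm_natCast] at h1
    have h2 : ((3 ^ (s + 1) * R' : ℕ) : ℝ) ≤ t' := by
      refine le_trans ?_ h1
      rw [Nat.cast_mul, hR'c]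
      have e : (2 * 3 ^ (s + 1) * (R : ℝ)) ^ p.natDegree =
          (3 ^ (s + 1)) ^ p.natDegree * (2 * R) ^ p.natDegree := by
        rw [← mul_pow]
        ring
      rw [e]
      have h3 : (3 ^ (s + 1) : ℝ) ≤ (3 ^ (s + 1)) ^ p.natDegree :=
        le_self_pow₀ (one_le_pow₀ (by norm_num)) (by omega)
      push_cast
      calc (3 : ℝ) ^ (s + 1) * (|(p.leadingCoeff : ℝ)| * (2 * R) ^ p.natDegree)
          = |(p.leadingCoeff : ℝ)| * (3 ^ (s + 1) * (2 * R) ^ p.natDegree) := by ring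
        _ ≤ _ := by gcongr
    exact_mod_cast h2
  -- The contribution `deg p - 1` of `p` is replaced by `0` for `X` and at most `deg p - 2` for
  -- `pushPoly p p'`.
  · have h1 := h.measure
    rw [Multiset.map_cons, Multiset.sum_cons] at h1
    rw [Multiset.map_cons, Multiset.sum_cons, Multiset.map_cons, Multiset.sum_cons,
      Multiset.map_map, natDegree_X, (pushPoly_spec hder0).2]
    have h2 : (derivative p).natDegree - 1 ≤ p₀.natDegree - 2 := by
      have := natDegree_derivative_le p
      omega
    have h3 : (L₁.map ((fun l => l.natDegree - 1) ∘ pushPoly p)).sum =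
        (L₁.map fun l => l.natDegree - 1).sum := by
      refine congrArg _ (Multiset.map_congr rfl fun l hl => ?_)
      rw [Function.comp_apply, (pushPoly_spec (hne l hl)).2]
    rw [h3]
    omega

/-- The starting point of the iteration: the poles of `G` are moved to a large integer. -/
theorem exists_stage : ∃ F s : ℕ → ℕ, Primrec F ∧ Primrec s ∧ ∀ (n : ℕ) [NeZero n]
    (S : Set (Point n)) (N : ℕ) (G : FunctionField n), S.Nonempty → IsFrac N G →
    (∀ P, HasSimplePole P G ∨ ((∃ j, HasJet P G j ∧
      (j.snd = 0 → ∃ p : ℤ[X], p ≠ 0 ∧ size p ≤ N ∧ aeval j.fst p = 0)) ∧ P ∉ S)) →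
    ∃ g L t R, Stage S (F N) g L t R (s N) := by
  -- There are at most `(2 * N + 1) ^ (N + 1)` polynomials of size at most `N`, each of degree at
  -- most `N`. The integer `M N` is exactly the separation `3 ^ (s + 1) * R` required of a stage
  -- with `R = 2 * (N + 1)`.
  let s : ℕ → ℕ := fun N => (2 * N + 1) ^ (N + 1) * N
  let M : ℕ → ℕ := fun N => 3 ^ (s N + 1) * (2 * (N + 1))
  let A : ℕ → ℕ := fun N => (M N + 3) * (N + 1) ^ (M N + 2) + (M N + N + 1) * (M N + N + 1)
  have hs : Primrec s := by
    apply_rules [primrec_nat_mul, primrec_nat_add, primrec_nat_pow, Primrec.id, Primrec.const]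
  have hM : Primrec M := by
    apply_rules [primrec_nat_mul, primrec_nat_add, primrec_nat_pow, Primrec.id, Primrec.const]
  have hA : Primrec A := by
    apply_rules [primrec_nat_mul, primrec_nat_add, primrec_nat_pow, Primrec.id, Primrec.const]
  refine ⟨fun N => A N * A N + N * (M N + 2) ^ N + M N, s, by
    apply_rules [primrec_nat_mul, primrec_nat_add, primrec_nat_pow, Primrec.id, Primrec.const], hs,
    fun n _ S N G hS hfrac hG => ?_⟩
  beta_reduce
  obtain ⟨T, hT, hcard⟩ := exists_finset_size_le N
  have hMR : 2 * (2 * (N + 1)) ≤ M N := by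
    refine Nat.mul_le_mul_right _ ?_
    calc 2 ≤ 3 ^ 1 := by norm_num
      _ ≤ 3 ^ (s N + 1) := Nat.pow_le_pow_right (by norm_num) (by omega)
  have hM0 : M N ≠ 0 := by omega
  generalize hm : M N = m at *
  have : CharZero (FunctionField n) :=
    charZero_of_injective_algebraMap (algebraMap Qbar (FunctionField n)).injective
  have hmK : (m : FunctionField n) ≠ 0 := Nat.cast_ne_zero.mpr hM0
  have hmQ : (m : Qbar) ≠ 0 := Nat.cast_ne_zero.mpr hM0
  -- Near a pole the new function is `m / (1 - m / G)`: its value is `m`, and it is unramified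
  -- because `1 / G` is a local parameter.
  have hpole : ∀ P, HasSimplePole P G → ∃ j, HasJet P (m * G * (G - m)⁻¹) j ∧ j.fst = m ∧
      j.snd ≠ 0 := by
    rintro P ⟨j, hj, h0, h1⟩
    have hG0 : G⁻¹ ≠ 0 := hj.ne_zero fun h => h1 (by rw [h]; rfl)
    have hmj : HasJet P (m : FunctionField n) (m : DualNumber Qbar) := HasJet.natCast P m
    have hd := (HasJet.one P).sub (hmj.mul hj)
    have hd0 : ((1 : DualNumber Qbar) - m * j).fst = 1 := by simp [h0]
    have hd' : (1 : FunctionField n) - m * G⁻¹ ≠ 0 := hd.ne_zero fun h => by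
      rw [h] at hd0
      exact zero_ne_one hd0
    have hres := hmj.mul (hd.inv (by rw [hd0]; exact one_ne_zero))
    have he : (m : FunctionField n) * G * (G - m)⁻¹ = m * (1 - m * G⁻¹)⁻¹ := by
      have hG1 : G ≠ 0 := fun h => hG0 (by rw [h, inv_zero])
      have h2 : G - m = G * (1 - m * G⁻¹) := by field_simp
      rw [h2, mul_inv]
      field_simp
    refine ⟨_, he ▸ hres, ?_, ?_⟩
    · rw [TrivSqZeroExt.fst_mul, TrivSqZeroExt.fst_inv, hd0]
      simp
    · simp [h0, hmQ, h1]
  have hsize : ∀ l ∈ (T.erase 0).val.map (mobiusPoly m), ∃ p : ℤ[X], p ≠ 0 ∧ size p ≤ N ∧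
      mobiusPoly m p = l := by
    intro l hl
    obtain ⟨p, hp, rfl⟩ := Multiset.mem_map.mp hl
    have hp' := Finset.mem_erase.mp (Finset.mem_val.mp hp)
    exact ⟨p, hp'.1, (hT p).mpr hp'.2, rfl⟩
  refine ⟨m * G * (G - m)⁻¹, (T.erase 0).val.map (mobiusPoly m), m, 2 * (N + 1), ?_⟩
  -- A marked point shows that the new function is nonzero; in particular `G ≠ m`.
  obtain ⟨P₀, hP₀⟩ := hS
  have hP₀' := (hG P₀).resolve_right fun h => h.2 hP₀
  obtain ⟨j₀, hj₀, hj₀m, -⟩ := hpole P₀ hP₀'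
  have hg0 : (m : FunctionField n) * G * (G - m)⁻¹ ≠ 0 := hj₀.ne_zero fun h => by
    rw [h] at hj₀m
    exact hmQ hj₀m.symm
  refine ⟨?_, fun P => ?_, fun P hP => ?_, ?_, ?_, ?_, ?_, ?_, ?_, ?_⟩
  · have h1 : IsFrac (A N) ((m : FunctionField n) * G) := by
      refine ((((IsFrac.natCast m).mono (by omega : m + 1 ≤ m + N + 1)).mul
        (hfrac.mono (by omega : N ≤ m + N + 1)))).mono ?_
      change _ ≤ (M N + 3) * (N + 1) ^ (M N + 2) + (M N + N + 1) * (M N + N + 1)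
      rw [hm]
      exact Nat.le_add_left _ _
    have h2 : IsFrac (A N) (G - (m : FunctionField n))⁻¹ := by
      have h3 : size (X - C (m : ℤ)) ≤ m + 2 := by
        refine (size_sub_le _ _).trans ?_
        rw [size_X, size_C, size_int, Int.natAbs_natCast, add_comm]
      have h4 := hfrac.aeval h3
      have h5 : aeval G (X - C (m : ℤ)) = G - m := by simp
      rw [h5] at h4
      refine (h4.inv ?_).mono ?_
      · intro h6
        rw [h6, inv_zero, mul_zero] at hg0
        exact hg0 rfl
      · change _ ≤ (M N + 3) * (N + 1) ^ (M N + 2) + (M N + N + 1) * (M N + N + 1)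
        rw [hm]
        exact Nat.le_add_right _ _
    exact (h1.mul h2).mono (by omega)
  · rcases hG P with hP | ⟨⟨j, hj, hcr⟩, -⟩
    · obtain ⟨j, hj, h0, h1⟩ := hpole P hP
      exact Or.inl ⟨j, hj, fun h => absurd h h1⟩
    have hmj : HasJet P (m : FunctionField n) (m : DualNumber Qbar) := HasJet.natCast P m
    -- Where `G` takes the value `m` the new function has a pole; elsewhere its critical points are
    -- those of `G`.
    by_cases hc : j.fst = m
    · right
      refine ⟨hg0, (j - m) * (m * j)⁻¹, ?_, ?_⟩
      · have := (hj.sub hmj).mul ((hmj.mul hj).inv (by simp [hc, hmQ]))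
        convert this using 1
        rw [mul_inv, inv_inv, mul_comm]
      · simp [hc]
    · left
      have hc' : j.fst - m ≠ 0 := sub_ne_zero.mpr hc
      refine ⟨m * j * (j - m)⁻¹, (hmj.mul hj).mul ((hj.sub hmj).inv (by simpa using hc')),
        fun hs => ?_⟩
      have hs' : (m * j * (j - m)⁻¹).snd = -(m * m * j.snd) / (j.fst - m) ^ 2 := by
        simp
        field_simp
        ring
      rw [hs', div_eq_zero_iff, neg_eq_zero] at hs
      have hjs : j.snd = 0 := by simpa [hmQ, hc'] using hs
      obtain ⟨p, hp0, hpN, hpr⟩ := hcr hjs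
      refine ⟨mobiusPoly m p, Multiset.mem_map_of_mem _ (Finset.mem_val.mpr
        (Finset.mem_erase.mpr ⟨hp0, (hT p).mp hpN⟩)), ?_⟩
      have hf : (m * j * (j - m)⁻¹).fst = m * j.fst / (j.fst - m) := by
        simp [div_eq_mul_inv]
      have hw : (m * j.fst / (j.fst - m)) - m = m * m / (j.fst - m) := by
        field_simp
        ring
      have hw0 : m * j.fst / (j.fst - m) ≠ (m : Qbar) := by
        rw [← sub_ne_zero, hw]
        exact div_ne_zero (mul_ne_zero hmQ hmQ) hc'
      have he : m * (m * j.fst / (j.fst - m)) / (m * m / (j.fst - m)) = j.fst := by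
        field_simp
      rw [hf]
      refine (aeval_mobiusPoly m p hw0).trans ?_
      rw [hw, he]
      exact mul_eq_zero_of_right _ hpr
  · exact hpole P ((hG P).resolve_right fun h => h.2 hP)
  · intro l hl
    obtain ⟨p, hp0, -, rfl⟩ := hsize l hl
    exact mobiusPoly_ne_zero hM0 hp0
  · intro l hl
    obtain ⟨p, hp0, hpN, rfl⟩ := hsize l hl
    have h1 := size_mobiusPoly_le m p
    have h2 : size p * (m + 2) ^ size p ≤ N * (m + 2) ^ N :=
      Nat.mul_le_mul hpN (Nat.pow_le_pow_right (by omega) hpN)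
    omega
  · intro l hl w hw
    obtain ⟨p, hp0, hpN, rfl⟩ := hsize l hl
    have hmC : (m : ℂ) ≠ 0 := Nat.cast_ne_zero.mpr hM0
    have hwm : w ≠ m := by
      rintro rfl
      rw [aeval_mobiusPoly_self] at hw
      simp [hp0, hM0] at hw
    have hwm' : w - m ≠ 0 := sub_ne_zero.mpr hwm
    rw [aeval_mobiusPoly m p hwm] at hw
    -- The preimage `m w / (w - m)` has absolute value at most `N + 1`, so `m ‖w‖ ≤ (N + 1) (‖w‖ +
    -- m)`; as `m ≥ 4 (N + 1)`, this yields `‖w‖ ≤ 2 (N + 1)`.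
    have hz := norm_le_size_of_root hp0 ((mul_eq_zero.mp hw).resolve_left (pow_ne_zero _ hwm'))
    have hz' : ‖m * w / (w - m)‖ ≤ N + 1 := hz.trans (by
      have : (size p : ℝ) ≤ N := by exact_mod_cast hpN
      linarith)
    rw [norm_div, norm_mul, Complex.norm_natCast, div_le_iff₀ (norm_pos_iff.mpr hwm')] at hz'
    have h1 : ‖w - m‖ ≤ ‖w‖ + m := (norm_sub_le _ _).trans (by rw [Complex.norm_natCast])
    have h2 : (2 * (2 * (N + 1)) : ℝ) ≤ m := by exact_mod_cast hMR
    have h3 : (m : ℝ) * ‖w‖ ≤ (N + 1) * (‖w‖ + m) := hz'.trans (by gcongr)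
    have hm0 : (0 : ℝ) < m := by
      have : (0 : ℝ) ≤ N := Nat.cast_nonneg _
      linarith
    have h4 : (m : ℝ) * ‖w‖ ≤ m * (2 * (N + 1)) := by
      have h5 : (2 * (N + 1) : ℝ) * ‖w‖ ≤ m * ‖w‖ := by
        refine mul_le_mul_of_nonneg_right ?_ (norm_nonneg _)
        have : (0 : ℝ) ≤ N := Nat.cast_nonneg _
        linarith
      linarith
    have h5 := le_of_mul_le_mul_left h4 hm0
    exact_mod_cast h5
  · omega
  · omega
  · exact hm.le
  · refine (Multiset.sum_le_card_nsmul _ N ?_).trans ?_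
    · intro k hk
      obtain ⟨l, hl, rfl⟩ := Multiset.mem_map.mp hk
      obtain ⟨p, hp0, hpN, rfl⟩ := hsize l hl
      have h1 := natDegree_mobiusPoly_le m p
      have h2 := natDegree_le_size p
      omega
    · rw [Multiset.card_map, Multiset.card_map, smul_eq_mul]
      exact Nat.mul_le_mul_right _ ((Finset.card_le_card (Finset.erase_subset _ _)).trans hcard)

end Stage

/-- Exactly `s` steps are made, so that the final bound depends on `s` and `N` only. Once all
polynomials have degree at most one, the remaining steps are idle: they only weaken the bounds. -/
theorem Stage.exists_linear {F : ℕ → ℕ} (hF : ∀ N, N ≤ F N)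
    (hstep : ∀ (n : ℕ) [NeZero n] (S : Set (Point n)) (N : ℕ) (g : FunctionField n)
      (L : Multiset ℤ[X]) (t R s : ℕ), Stage S N g L t R (s + 1) → (∃ p ∈ L, 2 ≤ p.natDegree) →
      ∃ g' L' t' R', Stage S (F N) g' L' t' R' s)
    {n : ℕ} [NeZero n] {S : Set (Point n)} (s : ℕ) : ∀ {N : ℕ} {g : FunctionField n}
      {L : Multiset ℤ[X]} {t R : ℕ}, Stage S N g L t R s →
      ∃ g' L' t' R', Stage S (F^[s] N) g' L' t' R' 0 := by
  induction s with
  | zero => exact fun h => ⟨_, _, _, _, h⟩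
  | succ s ih =>
    intro N g L t R h
    rw [Function.iterate_succ_apply]
    by_cases hp : ∃ p ∈ L, 2 ≤ p.natDegree
    · obtain ⟨g', L', t', R', h'⟩ := hstep n S N g L t R s h hp
      exact ih h'
    · push Not at hp
      refine ih (N := F N) (g := g) (L := L) (t := t) (R := R) ?_
      refine ⟨h.isFrac.mono (hF N), h.regular, h.marked, h.ne_zero,
        fun l hl => (h.size_le l hl).trans (hF N), h.norm_le, h.one_le, h.le_size.trans (hF N),
        le_trans ?_ h.large, ?_⟩
      · exact Nat.mul_le_mul_right _ (Nat.pow_le_pow_right (by norm_num) (Nat.le_succ _))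
      · rw [Multiset.sum_eq_zero]
        · exact Nat.zero_le _
        · intro k hk
          obtain ⟨l, hl, rfl⟩ := Multiset.mem_map.mp hk
          have := hp l hl
          omega

/-! ### Rational functions ramified only over three points -/

section NodePoly

/-- The polynomial `∏ j ≤ k, (X - j) ^ m j`. -/
def nodePoly (k : ℕ) (m : ℕ → ℕ) : ℤ[X] :=
  ∏ j ∈ Finset.range (k + 1), (X - C (j : ℤ)) ^ m j

theorem monic_nodePoly (k : ℕ) (m : ℕ → ℕ) : (nodePoly k m).Monic :=
  monic_prod_of_monic _ _ fun _ _ => (monic_X_sub_C _).pow _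

theorem natDegree_nodePoly (k : ℕ) (m : ℕ → ℕ) :
    (nodePoly k m).natDegree = ∑ j ∈ Finset.range (k + 1), m j := by
  rw [nodePoly, natDegree_prod_of_monic _ _ fun _ _ => (monic_X_sub_C _).pow _]
  exact Finset.sum_congr rfl fun j _ => by
    rw [(monic_X_sub_C _).natDegree_pow, natDegree_X_sub_C, mul_one]

theorem size_nodePoly_le {k : ℕ} {m : ℕ → ℕ} (hm : ∀ j, m j ≤ 2 ^ k) :
    size (nodePoly k m) ≤ (k + 2) ^ (2 ^ k * (k + 1)) := by
  refine (size_prod_le _ _).trans ?_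
  refine (Finset.prod_le_pow_card _ _ ((k + 2) ^ 2 ^ k) fun j hj => ?_).trans ?_
  · refine (size_pow_le _ _).trans ?_
    have h1 : size (X - C (j : ℤ)) ≤ k + 2 := by
      refine (size_sub_le _ _).trans ?_
      rw [size_X, size_C, size_int, Int.natAbs_natCast]
      have := Finset.mem_range.mp hj
      omega
    exact (Nat.pow_le_pow_left h1 _).trans (Nat.pow_le_pow_right (by omega) (hm j))
  · rw [Finset.card_range, ← pow_mul]

variable {K : Type*} [Field K] [Algebra ℤ K]

theorem aeval_nodePoly (k : ℕ) (m : ℕ → ℕ) (z : K) :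
    aeval z (nodePoly k m) = ∏ j ∈ Finset.range (k + 1), (z - j) ^ m j := by
  rw [nodePoly, map_prod]
  refine Finset.prod_congr rfl fun j _ => ?_
  rw [map_pow, map_sub, aeval_X, aeval_C, eq_intCast, Int.cast_natCast]

theorem aeval_nodePoly_ne_zero {k : ℕ} {m : ℕ → ℕ} {z : K} (hz : ∀ j ≤ k, m j ≠ 0 → z ≠ j) :
    aeval z (nodePoly k m) ≠ 0 := by
  rw [aeval_nodePoly, Finset.prod_ne_zero_iff]
  intro j hj
  by_cases hm : m j = 0
  · rw [hm, pow_zero]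
    exact one_ne_zero
  · exact pow_ne_zero _ (sub_ne_zero.mpr (hz j (Finset.mem_range_succ_iff.mp hj) hm))

theorem aeval_nodePoly_eq_zero {k j : ℕ} {m : ℕ → ℕ} (hj : j ≤ k) (hm : m j ≠ 0) :
    aeval (j : K) (nodePoly k m) = 0 := by
  rw [aeval_nodePoly]
  refine Finset.prod_eq_zero (Finset.mem_range_succ_iff.mpr hj) ?_
  rw [sub_self, zero_pow hm]

theorem aeval_derivative_nodePoly {k : ℕ} (m : ℕ → ℕ) {z : K} (hz : ∀ j ≤ k, z ≠ j) :
    aeval z (derivative (nodePoly k m)) =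
      aeval z (nodePoly k m) * ∑ j ∈ Finset.range (k + 1), (m j : K) / (z - j) := by
  have key : ∀ s : Finset ℕ, (∀ j ∈ s, z - (j : K) ≠ 0) →
      aeval z (derivative (∏ j ∈ s, (X - C (j : ℤ)) ^ m j)) =
        aeval z (∏ j ∈ s, (X - C (j : ℤ)) ^ m j) * ∑ j ∈ s, (m j : K) / (z - j) := by
    intro s
    induction s using Finset.induction_on with
    | empty => simp
    | insert a s ha ih =>
      intro hs
      have h1 := ih fun j hj => hs j (Finset.mem_insert_of_mem hj)
      have h2 : z - (a : K) ≠ 0 := hs a (Finset.mem_insert_self _ _)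
      rw [Finset.prod_insert ha, Finset.sum_insert ha, derivative_mul, map_add, map_mul, map_mul,
        map_mul, h1, derivative_X_sub_C_pow]
      have h3 : aeval z (X - C (a : ℤ)) = z - a := by
        rw [map_sub, aeval_X, aeval_C, eq_intCast, Int.cast_natCast]
      rw [map_mul, map_pow, map_pow, h3, aeval_C, eq_intCast, Int.cast_natCast]
      rcases Nat.eq_zero_or_pos (m a) with h0 | h0
      · rw [h0]
        simp
      · obtain ⟨e, he⟩ : ∃ e, m a = e + 1 := ⟨m a - 1, by omega⟩
        rw [he, Nat.add_sub_cancel]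
        field_simp
        ring
  exact key _ fun j hj => sub_ne_zero.mpr (hz j (Finset.mem_range_succ_iff.mp hj))

/-- The partial fraction expansion of `k! / ∏ j ≤ k, (z - j)`. -/
theorem sum_alternating_choose_div {K : Type*} [Field K] (k : ℕ) :
    ∀ z : K, (∀ j ≤ k, z ≠ (j : ℕ)) →
      ∑ j ∈ Finset.range (k + 1), (-1) ^ j * (k.choose j : K) / (z - j) =
        (-1) ^ k * k.factorial / ∏ j ∈ Finset.range (k + 1), (z - j) := by
  induction k with
  | zero => simp
  | succ k ih =>
    intro z hz
    have hz0 : z ≠ 0 := by simpa using hz 0 (Nat.zero_le _)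
    have h1 := ih z fun j hj => hz j (hj.trans (Nat.le_succ k))
    have h2 := ih (z - 1) fun j hj h => hz (j + 1) (Nat.succ_le_succ hj) (by
      push_cast
      linear_combination h)
    -- Pascal's rule turns the sum for `k + 1` into the sum for `k` at `z` minus the sum for `k` at
    -- `z - 1`; the products over `k + 2` nodes then serve as common denominator.
    have hsplit : ∑ j ∈ Finset.range (k + 1 + 1), (-1) ^ j * ((k + 1).choose j : K) / (z - j) =
        ∑ j ∈ Finset.range (k + 1), (-1) ^ j * (k.choose j : K) / (z - j) -
          ∑ j ∈ Finset.range (k + 1), (-1) ^ j * (k.choose j : K) / (z - 1 - j) := by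
      have e1 : ∑ j ∈ Finset.range (k + 1), (-1) ^ j * (k.choose j : K) / (z - j) =
          ∑ j ∈ Finset.range (k + 1), (-1) ^ (j + 1) * (k.choose (j + 1) : K) / (z - (j + 1 : ℕ)) +
            (-1) ^ 0 * (k.choose 0 : K) / (z - (0 : ℕ)) := by
        rw [← Finset.sum_range_succ' (fun j => (-1) ^ j * (k.choose j : K) / (z - j)),
          Finset.sum_range_succ _ (k + 1), Nat.choose_succ_self]
        simp
      rw [Finset.sum_range_succ', e1, add_sub_right_comm, ← Finset.sum_sub_distrib]
      congr 1
      · refine Finset.sum_congr rfl fun j _ => ?_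
        rw [Nat.choose_succ_succ]
        push_cast
        rw [show z - 1 - (j : K) = z - (j + 1) by ring]
        ring
      · simp
    have hp1 : ∏ j ∈ Finset.range (k + 1 + 1), (z - (j : K)) =
        (∏ j ∈ Finset.range (k + 1), (z - (j : K))) * (z - (k + 1)) := by
      rw [Finset.prod_range_succ]
      push_cast
      rfl
    have hp2 : ∏ j ∈ Finset.range (k + 1 + 1), (z - (j : K)) =
        (∏ j ∈ Finset.range (k + 1), (z - 1 - (j : K))) * z := by
      rw [Finset.prod_range_succ']
      congr 1
      · refine Finset.prod_congr rfl fun j _ => ?_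
        push_cast
        ring
      · simp
    have hp0 : ∏ j ∈ Finset.range (k + 1 + 1), (z - (j : K)) ≠ 0 :=
      Finset.prod_ne_zero_iff.mpr fun j hj =>
        sub_ne_zero.mpr (hz j (Finset.mem_range_succ_iff.mp hj))
    rw [hsplit, h1, h2]
    set p := ∏ j ∈ Finset.range (k + 1 + 1), (z - (j : K))
    set p₁ := ∏ j ∈ Finset.range (k + 1), (z - (j : K))
    set p₂ := ∏ j ∈ Finset.range (k + 1), (z - 1 - (j : K))
    have hp₁ : p₁ ≠ 0 := left_ne_zero_of_mul (hp1 ▸ hp0)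
    have hp₂ : p₂ ≠ 0 := left_ne_zero_of_mul (hp2 ▸ hp0)
    have e1 : p₁⁻¹ = (z - (k + 1)) * p⁻¹ := by
      have : z - (k + 1 : K) ≠ 0 := right_ne_zero_of_mul (hp1 ▸ hp0)
      rw [hp1]
      field_simp
    have e2 : p₂⁻¹ = z * p⁻¹ := by
      rw [hp2]
      field_simp
    rw [div_eq_mul_inv, div_eq_mul_inv, div_eq_mul_inv, e1, e2, Nat.factorial_succ]
    push_cast
    ring

/-- The multiplicities of the zeros of the function `∏ j ≤ k, (z - j) ^ ((-1) ^ j * choose k j)`. -/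
def evenMult (k j : ℕ) : ℕ := if Even j then k.choose j else 0

/-- The multiplicities of the poles of the function `∏ j ≤ k, (z - j) ^ ((-1) ^ j * choose k j)`. -/
def oddMult (k j : ℕ) : ℕ := if Even j then 0 else k.choose j

theorem evenMult_sub_oddMult {R : Type*} [Ring R] (k j : ℕ) :
    (evenMult k j : R) - oddMult k j = (-1) ^ j * k.choose j := by
  rw [evenMult, oddMult]
  split_ifs with h
  · simp [h.neg_one_pow]
  · simp [(Nat.not_even_iff_odd.mp h).neg_one_pow]

theorem evenMult_le (k j : ℕ) : evenMult k j ≤ 2 ^ k := by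
  rw [evenMult]
  split_ifs
  · exact Nat.choose_le_two_pow k j
  · exact Nat.zero_le _

theorem oddMult_le (k j : ℕ) : oddMult k j ≤ 2 ^ k := by
  rw [oddMult]
  split_ifs
  · exact Nat.zero_le _
  · exact Nat.choose_le_two_pow k j

/-- The alternating sum of the binomial coefficients vanishes. So numerator and denominator, both
monic, have equal degree, and the quotient takes the value `1` at `∞`. -/
theorem natDegree_evenMult_eq {k : ℕ} (hk : k ≠ 0) :
    (nodePoly k (evenMult k)).natDegree = (nodePoly k (oddMult k)).natDegree := by
  rw [natDegree_nodePoly, natDegree_nodePoly]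
  have h := Int.alternating_sum_range_choose_of_ne hk
  simp_rw [← evenMult_sub_oddMult] at h
  rw [Finset.sum_sub_distrib, sub_eq_zero] at h
  exact_mod_cast h

/-- The left side is the numerator of the derivative of the quotient. By the partial fraction
expansion the logarithmic derivative is `k! / ∏ (z - j)`, which has no zeros; the parity of `k`
fixes the sign, needed for monotonicity in `eval_nodePoly_ne`. -/
theorem aeval_wronskian_nodePoly {k : ℕ} (hk : Even k) {z : K} (hz : ∀ j ≤ k, z ≠ (j : ℕ)) :
    aeval z (derivative (nodePoly k (evenMult k))) * aeval z (nodePoly k (oddMult k)) -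
      aeval z (nodePoly k (evenMult k)) * aeval z (derivative (nodePoly k (oddMult k))) =
    aeval z (nodePoly k (evenMult k)) * aeval z (nodePoly k (oddMult k)) *
      (k.factorial / ∏ j ∈ Finset.range (k + 1), (z - j)) := by
  rw [aeval_derivative_nodePoly _ hz, aeval_derivative_nodePoly _ hz]
  have h := sum_alternating_choose_div k z hz
  simp_rw [← evenMult_sub_oddMult, sub_div] at h
  rw [Finset.sum_sub_distrib, hk.neg_one_pow, one_mul] at h
  rw [← h]
  ring

/-- On `(k, ∞)` the quotient has positive derivative and tends to `1`, so it increases strictly and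
never attains `1`. -/
theorem eval_nodePoly_ne {k t : ℕ} (hk : Even k) (hk0 : k ≠ 0) (ht : k < t) :
    (nodePoly k (evenMult k)).eval (t : ℤ) ≠ (nodePoly k (oddMult k)).eval (t : ℤ) := by
  intro heq
  set A := nodePoly k (evenMult k)
  set B := nodePoly k (oddMult k)
  have hpos : ∀ (m : ℕ → ℕ) (u : ℝ), (k : ℝ) < u → 0 < aeval u (nodePoly k m) := by
    intro m u hu
    rw [aeval_nodePoly]
    refine Finset.prod_pos fun j hj => pow_pos ?_ _
    have : (j : ℝ) ≤ k := by exact_mod_cast Finset.mem_range_succ_iff.mp hj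
    linarith
  let φ : ℝ → ℝ := fun u => aeval u A / aeval u B
  have hder : ∀ u : ℝ, (k : ℝ) < u → ∃ c, 0 < c ∧ HasDerivAt φ c u := by
    intro u hu
    have hB : aeval u B ≠ 0 := (hpos _ u hu).ne'
    have hz : ∀ j ≤ k, u ≠ (j : ℕ) := fun j hj h => by
      have : (j : ℝ) ≤ k := by exact_mod_cast hj
      linarith
    refine ⟨_, ?_, (A.hasDerivAt_aeval u).div (B.hasDerivAt_aeval u) hB⟩
    rw [aeval_wronskian_nodePoly hk hz]
    have h1 : (0 : ℝ) < ∏ j ∈ Finset.range (k + 1), (u - j) := by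
      refine Finset.prod_pos fun j hj => ?_
      have : (j : ℝ) ≤ k := by exact_mod_cast Finset.mem_range_succ_iff.mp hj
      linarith
    have h2 := hpos (evenMult k) u hu
    have h3 := hpos (oddMult k) u hu
    positivity
  have hmono : StrictMonoOn φ (Set.Ioi (k : ℝ)) := by
    refine strictMonoOn_of_deriv_pos (convex_Ioi _) (fun u hu => ?_) fun u hu => ?_
    · obtain ⟨c, -, hc⟩ := hder u hu
      exact hc.continuousAt.continuousWithinAt
    · rw [interior_Ioi] at hu
      obtain ⟨c, hc0, hc⟩ := hder u hu
      rw [hc.deriv]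
      exact hc0
  have htk : (k : ℝ) < t := by exact_mod_cast ht
  have hφt : φ t = 1 := by
    have hB : aeval (t : ℝ) B ≠ 0 := (hpos _ _ htk).ne'
    change aeval (t : ℝ) A / aeval (t : ℝ) B = 1
    rw [div_eq_one_iff_eq hB, aeval_natCast, aeval_natCast, heq]
  have h1 : 1 < φ (t + 1) := by
    rw [← hφt]
    exact hmono htk (by simp only [Set.mem_Ioi]; linarith) (by linarith)
  have hlim : Filter.Tendsto φ Filter.atTop (nhds 1) := by
    have hdeg : (A.map (Int.castRingHom ℝ)).degree = (B.map (Int.castRingHom ℝ)).degree := by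
      rw [(monic_nodePoly _ _).degree_map, (monic_nodePoly _ _).degree_map,
        degree_eq_natDegree (monic_nodePoly _ _).ne_zero,
        degree_eq_natDegree (monic_nodePoly _ _).ne_zero, natDegree_evenMult_eq hk0]
    have := div_tendsto_atTop_leadingCoeff_div_of_degree_eq _ _ hdeg
    rw [((monic_nodePoly _ _).map _).leadingCoeff, ((monic_nodePoly _ _).map _).leadingCoeff,
      div_one] at this
    refine this.congr fun u => ?_
    change _ = aeval u A / aeval u B
    rw [← eval_map_algebraMap, ← eval_map_algebraMap]
    rfl
  have h2 : φ (t + 1) ≤ 1 := by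
    refine ge_of_tendsto hlim ?_
    filter_upwards [Filter.eventually_ge_atTop ((t : ℝ) + 1)] with u hu
    exact hmono.monotoneOn (by simp only [Set.mem_Ioi]; linarith)
      (by simp only [Set.mem_Ioi]; linarith) hu
  linarith

end NodePoly

/-! ### Composition with the function ramified only over three points -/

section Belyi

variable {n : ℕ} [NeZero n]

/-- The composition of `g` with the function `∏ j ≤ k, (z - j) ^ ((-1) ^ j * choose k j)`. -/
def belyiComp (k : ℕ) (g : FunctionField n) : FunctionField n :=
  aeval g (nodePoly k (evenMult k)) * (aeval g (nodePoly k (oddMult k)))⁻¹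

theorem HasJet.belyiComp {P : Point n} {g : FunctionField n} {j : DualNumber Qbar} {k : ℕ}
    (hk : Even k) (h : HasJet P g j) (hz : ∀ i ≤ k, j.fst ≠ (i : ℕ)) :
    ∃ j', HasJet P (belyiComp k g) j' ∧
      j'.fst * Polynomial.aeval j.fst (nodePoly k (oddMult k)) =
        Polynomial.aeval j.fst (nodePoly k (evenMult k)) ∧ (j.snd ≠ 0 → j'.snd ≠ 0) := by
  set A := nodePoly k (evenMult k) with hA
  set B := nodePoly k (oddMult k) with hB
  have hA0 : Polynomial.aeval j.fst A ≠ 0 := aeval_nodePoly_ne_zero fun i hi _ => hz i hi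
  have hB0 : Polynomial.aeval j.fst B ≠ 0 := aeval_nodePoly_ne_zero fun i hi _ => hz i hi
  have hBf : (Polynomial.aeval j B).fst = Polynomial.aeval j.fst B := fst_aeval_dual j B
  refine ⟨_, (h.aeval A).mul ((h.aeval B).inv (by rwa [hBf])), ?_, fun hs => ?_⟩
  · rw [TrivSqZeroExt.fst_mul, TrivSqZeroExt.fst_inv, fst_aeval_dual, fst_aeval_dual,
      inv_mul_cancel_right₀ hB0]
  · have hW := aeval_wronskian_nodePoly hk hz
    rw [← hA, ← hB] at hW
    have hW0 : Polynomial.aeval j.fst (derivative A) * Polynomial.aeval j.fst B -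
        Polynomial.aeval j.fst A * Polynomial.aeval j.fst (derivative B) ≠ 0 := by
      rw [hW]
      refine mul_ne_zero (mul_ne_zero hA0 hB0) (div_ne_zero ?_ ?_)
      · exact_mod_cast Nat.factorial_ne_zero k
      · exact Finset.prod_ne_zero_iff.mpr fun i hi =>
          sub_ne_zero.mpr (hz i (Finset.mem_range_succ_iff.mp hi))
    have he : (Polynomial.aeval j A * (Polynomial.aeval j B)⁻¹).snd =
        (Polynomial.aeval j.fst (derivative A) * Polynomial.aeval j.fst B -
          Polynomial.aeval j.fst A * Polynomial.aeval j.fst (derivative B)) * j.snd /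
            Polynomial.aeval j.fst B ^ 2 := by
      rw [TrivSqZeroExt.snd_mul, TrivSqZeroExt.snd_inv, TrivSqZeroExt.fst_inv, fst_aeval_dual,
        fst_aeval_dual, snd_aeval_dual, snd_aeval_dual]
      simp only [smul_eq_mul, MulOpposite.smul_eq_mul_unop, MulOpposite.unop_op]
      field_simp
      ring
    rw [he]
    exact div_ne_zero (mul_ne_zero hW0 hs) (pow_ne_zero _ hB0)

/-- The quotient of two monic polynomials of equal degree is `1` at `∞`; hence nothing has to be
known about the ramification of `g` at its poles. -/
theorem evalAt_belyiComp_of_pole {P : Point n} {g : FunctionField n} {j : DualNumber Qbar} {k : ℕ}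
    (hk : k ≠ 0) (hg : g ≠ 0) (h : HasJet P g⁻¹ j) (h0 : j.fst = 0) :
    evalAt (belyiComp k g) P = ((1 : Qbar) : OnePoint Qbar) := by
  have hrev : ∀ p : ℤ[X], aeval g p = aeval g⁻¹ p.reverse * g ^ p.natDegree := fun p => by
    let := invertibleOfNonzero hg
    have := eval₂_reverse_mul_pow (algebraMap ℤ (FunctionField n)) g p
    rw [invOf_eq_inv] at this
    rw [aeval_def, aeval_def, ← this]
  have hone : ∀ m, (aeval j (nodePoly k m).reverse).fst = 1 := fun m => by
    rw [fst_aeval_dual, h0, aeval_def, eval₂_at_zero, coeff_zero_reverse,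
      (monic_nodePoly k m).leadingCoeff, map_one]
  have hj := (h.aeval (nodePoly k (evenMult k)).reverse).mul
    ((h.aeval (nodePoly k (oddMult k)).reverse).inv (by rw [hone]; exact one_ne_zero))
  have he : belyiComp k g = aeval g⁻¹ (nodePoly k (evenMult k)).reverse *
      (aeval g⁻¹ (nodePoly k (oddMult k)).reverse)⁻¹ := by
    rw [belyiComp, hrev, hrev (nodePoly k (oddMult k)), natDegree_evenMult_eq hk, mul_inv,
      mul_mul_mul_comm, mul_inv_cancel₀ (pow_ne_zero _ hg), mul_one]
  rw [he, hj.evalAt_eq, TrivSqZeroExt.fst_mul, TrivSqZeroExt.fst_inv, hone, hone, inv_one, mul_one]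

/-- Binomial coefficients `choose k i` with `i ≤ k` are nonzero, so every even node is a zero and
every odd node a pole. -/
theorem evalAt_belyiComp_of_node {P : Point n} {g : FunctionField n} {j : DualNumber Qbar}
    {k i : ℕ} (h : HasJet P g j) (hi : i ≤ k) (hj : j.fst = i)
    (hB : aeval g (nodePoly k (oddMult k)) ≠ 0) :
    evalAt (belyiComp k g) P ∈ threePoints := by
  have hch : k.choose i ≠ 0 := (Nat.choose_pos hi).ne'
  have hA := h.aeval (nodePoly k (evenMult k))
  have hB' := h.aeval (nodePoly k (oddMult k))
  by_cases he : Even i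
  · have h1 : (aeval j (nodePoly k (oddMult k))).fst ≠ 0 := by
      rw [fst_aeval_dual, hj]
      refine aeval_nodePoly_ne_zero fun i' _ hm heq => hm ?_
      rw [← Nat.cast_injective heq, oddMult, if_pos he]
    have h2 : (aeval j (nodePoly k (evenMult k))).fst = 0 := by
      rw [fst_aeval_dual, hj]
      exact aeval_nodePoly_eq_zero hi (by rwa [evenMult, if_pos he])
    rw [belyiComp, (hA.mul (hB'.inv h1)).evalAt_eq, TrivSqZeroExt.fst_mul, h2, zero_mul]
    exact Or.inl rfl
  · have h1 : (aeval j (nodePoly k (evenMult k))).fst ≠ 0 := by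
      rw [fst_aeval_dual, hj]
      refine aeval_nodePoly_ne_zero fun i' _ hm heq => hm ?_
      rw [← Nat.cast_injective heq, evenMult, if_neg he]
    have h2 : (aeval j (nodePoly k (oddMult k))).fst = 0 := by
      rw [fst_aeval_dual, hj]
      exact aeval_nodePoly_eq_zero hi (by rwa [oddMult, if_neg he])
    have hA0 : aeval g (nodePoly k (evenMult k)) ≠ 0 := hA.ne_zero fun h0 => h1 (by rw [h0]; rfl)
    have h3 := hB'.mul (hA.inv h1)
    have h4 : (belyiComp k g)⁻¹ = aeval g (nodePoly k (oddMult k)) *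
        (aeval g (nodePoly k (evenMult k)))⁻¹ := by
      rw [belyiComp, mul_inv, inv_inv, mul_comm]
    rw [← h4] at h3
    rw [h3.evalAt_eq_infty (by rw [TrivSqZeroExt.fst_mul, h2, zero_mul])
      (mul_ne_zero hA0 (inv_ne_zero hB))]
    exact Or.inr (Or.inr rfl)

/-- A rational root of an integral polynomial of degree at most one becomes an integer between
`0` and `2 * R * D` after multiplication by `D` and a shift. -/
theorem exists_nat_of_root {l : ℤ[X]} {z : Qbar} {D R : ℕ} (hl0 : l ≠ 0) (hl : l.natDegree ≤ 1)
    (hz : aeval z l = 0) (hD : l.leadingCoeff ∣ D)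
    (hR : ∀ w : ℂ, aeval w l = 0 → ‖w‖ ≤ R) : ∃ i ≤ 2 * R * D, (D : Qbar) * (z + R) = (i : ℕ) := by
  obtain ⟨φ⟩ := nonempty_Qbar_ringHom
  have hnorm : ‖φ z‖ ≤ R := hR _ ((aeval_Qbar_eq_zero_iff φ z l).mpr hz)
  obtain ⟨e, he⟩ := hD
  have hd1 : l.natDegree = 1 := by
    refine le_antisymm hl (Nat.one_le_iff_ne_zero.mpr fun h0 => hl0 ?_)
    rw [eq_C_of_natDegree_eq_zero h0, aeval_C, eq_intCast, Int.cast_eq_zero] at hz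
    rw [eq_C_of_natDegree_eq_zero h0, hz, C_0]
  have hlz : (l.leadingCoeff : Qbar) * z = -(l.coeff 0 : Qbar) := by
    rw [eq_X_add_C_of_natDegree_le_one hl] at hz
    rw [map_add, map_mul, aeval_C, aeval_C, aeval_X, eq_intCast, eq_intCast] at hz
    rw [leadingCoeff, hd1]
    linear_combination hz
  have hDz : (D : Qbar) * (z + R) = ((-(l.coeff 0 * e) + D * R : ℤ) : Qbar) := by
    have : (D : Qbar) = l.leadingCoeff * e := by exact_mod_cast congrArg (Int.cast (R := Qbar)) he
    push_cast
    linear_combination (z : Qbar) * this + (e : Qbar) * hlz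
  set c : ℤ := -(l.coeff 0 * e) + D * R with hc
  have hφ : (D : ℂ) * (φ z + R) = (c : ℂ) := by
    have := congrArg φ hDz
    simpa only [map_mul, map_add, map_natCast, map_intCast] using this
  -- The integer `c` differs from `D * R` by `D * φ z`, and `‖φ z‖ ≤ R`; so `c` lies between `0` and
  -- `2 * R * D`.
  have habs : |(c : ℝ) - D * R| ≤ D * R := by
    have h1 : ‖((c - D * R : ℤ) : ℂ)‖ ≤ D * R := by
      have : ((c - D * R : ℤ) : ℂ) = D * φ z := by
        push_cast
        linear_combination -hφ
      rw [this, norm_mul, Complex.norm_natCast]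
      gcongr
    rw [Complex.norm_intCast] at h1
    exact_mod_cast h1
  rw [abs_le] at habs
  have h0 : 0 ≤ c := by
    have : (0 : ℝ) ≤ c := by linarith [habs.1]
    exact_mod_cast this
  have h1 : c ≤ 2 * R * D := by
    have : (c : ℝ) ≤ 2 * R * D := by linarith [habs.2]
    exact_mod_cast this
  refine ⟨c.toNat, Int.toNat_le.mpr (by exact_mod_cast h1), ?_⟩
  rw [hDz]
  have : ((c.toNat : ℤ) : Qbar) = c := by rw [Int.toNat_of_nonneg h0]
  rw [← this, Int.cast_natCast]

/-- A point at infinity. -/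
theorem exists_point_at_infinity : ∃ P : Point n, P.coords 2 = 0 := by
  obtain ⟨z, hz⟩ := IsAlgClosed.exists_pow_nat_eq (-1 : Qbar) (Nat.pos_of_ne_zero (NeZero.ne n))
  have hv : ![(1 : Qbar), z, 0] ≠ 0 := fun h => one_ne_zero (congrFun h 0)
  obtain ⟨a, ha⟩ := Projectivization.exists_smul_eq_mk_rep Qbar ![(1 : Qbar), z, 0] hv
  have h0 : (Projectivization.mk Qbar ![(1 : Qbar), z, 0] hv).rep 2 = 0 := by
    rw [← ha]
    simp
  refine ⟨⟨Projectivization.mk Qbar ![(1 : Qbar), z, 0] hv, ?_⟩, h0⟩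
  rw [h0, zero_pow (NeZero.ne n), ← ha]
  simp [Units.smul_def, mul_pow, hz]

end Belyi

/-- A function of bounded size that is unramified outside `0, 1, ∞`, and at all points of bounded
degree and height, where its value is not one of `0, 1, ∞`. -/
theorem exists_belyi_function : ∃ F : ℕ → ℕ, Primrec F ∧ ∀ (n : ℕ) [NeZero n] (N : ℕ), n ≤ N →
    ∃ f : FunctionField n, IsFrac (F N) f ∧ ¬ IsConstant f ∧
      (∀ P : Point n, evalAt f P ∉ threePoints → IsUnramifiedAt f P) ∧
      ∀ P : Point n, pointDegree (piMap P) ≤ N → pointHeight (piMap P) ≤ N →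
        evalAt f P ∉ threePoints := by
  obtain ⟨F₁, hF₁, hpole⟩ := exists_pole_function
  obtain ⟨F₂, s, hF₂, hs, hstart⟩ := exists_stage
  obtain ⟨F₃, hF₃, hF₃le, hstep⟩ := exists_stage_step
  -- `E` bounds the last stage; `κ` bounds the number `k` of the last node, `W` the rescaled
  -- function, `V` the polynomials `nodePoly`, and `U` their values at that function.
  let E : ℕ → ℕ := fun N => F₃^[s (F₁ N)] (F₂ (F₁ N))
  have hE : Primrec E := primrec_nat_iterate hF₃ (hs.comp hF₁) (hF₂.comp hF₁)
  let κ : ℕ → ℕ := fun N => 2 * E N * E N ^ E N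
  have hκ : Primrec κ := by
    apply_rules [primrec_nat_mul, primrec_nat_add, primrec_nat_pow, Primrec.id, Primrec.const]
  let W : ℕ → ℕ := fun N => (κ N * 3 + 1) * (E N + 1) ^ (κ N * 3)
  have hW : Primrec W := by
    apply_rules [primrec_nat_mul, primrec_nat_add, primrec_nat_pow, Primrec.id, Primrec.const]
  let V : ℕ → ℕ := fun N => (κ N + 2) ^ (2 ^ κ N * (κ N + 1))
  have hV : Primrec V := by
    apply_rules [primrec_nat_mul, primrec_nat_add, primrec_nat_pow, Primrec.id, Primrec.const]
  let U : ℕ → ℕ := fun N => (V N + 1) * (W N + 1) ^ V N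
  have hU : Primrec U := by
    apply_rules [primrec_nat_mul, primrec_nat_add, primrec_nat_pow, Primrec.id, Primrec.const]
  refine ⟨fun N => U N * U N, primrec_nat_mul hU hU, fun n _ N hN => ?_⟩
  obtain ⟨G, hG, hGP⟩ := hpole n N hN
  let S : Set (Point n) := {P | pointDegree (piMap P) ≤ N ∧ pointHeight (piMap P) ≤ N}
  have hN1 : 1 ≤ N := (Nat.one_le_iff_ne_zero.mpr (NeZero.ne n)).trans hN
  obtain ⟨P₀, hP₀⟩ := exists_point_at_infinity (n := n)
  -- A point at infinity is always marked: `∞` has degree `1` and height `0`, and `N ≥ n ≥ 1`.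
  have hP₀S : P₀ ∈ S := by
    have : piMap P₀ = OnePoint.infty := by rw [piMap, if_pos hP₀]
    change pointDegree (piMap P₀) ≤ N ∧ pointHeight (piMap P₀) ≤ N
    rw [this]
    exact ⟨hN1, Nat.cast_nonneg N⟩
  obtain ⟨g₀, L₀, t₀, R₀, hst₀⟩ := hstart n S (F₁ N) G ⟨P₀, hP₀S⟩ hG hGP
  obtain ⟨g, L, t, R, hst⟩ := Stage.exists_linear hF₃le hstep _ hst₀
  change Stage S (E N) g L t R 0 at hst
  have hlin : ∀ l ∈ L, l.natDegree ≤ 1 := fun l hl => by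
    have h1 := Multiset.single_le_sum (fun _ _ => Nat.zero_le _) _
      (Multiset.mem_map_of_mem (fun l => l.natDegree - 1) hl)
    have h2 := hst.measure
    omega
  -- A common multiple of the leading coefficients of all polynomials in `L`, as these are nonzero
  -- and at most `E N` in absolute value.
  set D := (E N).factorial with hDdef
  have hD0 : D ≠ 0 := Nat.factorial_ne_zero _
  have hDQ : (D : Qbar) ≠ 0 := Nat.cast_ne_zero.mpr hD0
  have hR1 := hst.one_le
  have hRt : 3 * R ≤ t := by simpa using hst.large
  set k := 2 * R * D with hk
  have hkeven : Even k := by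
    rw [hk, mul_assoc]
    exact even_two_mul _
  have hk0 : k ≠ 0 := by positivity
  have hDle : D ≤ E N ^ E N := Nat.factorial_le_pow _
  have htN := hst.le_size
  have hkκ : k ≤ κ N := by
    rw [hk]
    exact Nat.mul_le_mul (Nat.mul_le_mul_left _ (by omega)) hDle
  set T := D * (t + R) with hT
  have hkT : k < T := by
    rw [hk, hT]
    have : 2 * R < t + R := by omega
    calc 2 * R * D < (t + R) * D := Nat.mul_lt_mul_of_pos_right this (Nat.pos_of_ne_zero hD0)
      _ = D * (t + R) := mul_comm _ _
  -- The map `z ↦ D (z + R)` sends the critical values to integers in `[0, k]`, and `t ≥ 3 R > R` to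
  -- the integer `T > k`.
  let a : ℤ[X] := C (D : ℤ) * (X + C (R : ℤ))
  set g₁ := aeval g a with hg₁
  have haz : ∀ z : Qbar, aeval z a = D * (z + R) := fun z => by simp [a]
  have hader : ∀ z : Qbar, aeval z (derivative a) = D := fun z => by simp [a]
  have hadeg : a.natDegree ≠ 0 := by
    have : a.natDegree = 1 := by
      simp only [a]
      rw [natDegree_C_mul (by exact_mod_cast hD0), natDegree_X_add_C]
    omega
  have hreg : ∀ P, (∃ j, HasJet P g₁ j ∧ (j.snd = 0 → ∃ i ≤ k, j.fst = (i : ℕ))) ∨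
      (g₁ ≠ 0 ∧ ∃ j, HasJet P g₁⁻¹ j ∧ j.fst = 0) := by
    intro P
    rcases hst.regular P with ⟨j, hj, hcr⟩ | ⟨hg, j, hj, h0⟩
    · refine Or.inl ⟨_, hj.aeval a, fun hs => ?_⟩
      rw [snd_aeval_dual, hader] at hs
      obtain ⟨l, hl, hlz⟩ := hcr ((mul_eq_zero.mp hs).resolve_left hDQ)
      rw [fst_aeval_dual, haz]
      have hl0 := hst.ne_zero l hl
      refine exists_nat_of_root hl0 (hlin l hl) hlz ?_ (hst.norm_le l hl)
      rw [← Int.natAbs_dvd_natAbs, Int.natAbs_natCast, hDdef]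
      exact Nat.dvd_factorial (Int.natAbs_pos.mpr (leadingCoeff_ne_zero.mpr hl0))
        ((natAbs_coeff_le_size l _).trans (hst.size_le l hl))
    · exact Or.inr (HasJet.inv_aeval hg hj h0 hadeg)
  have hmarked : ∀ P ∈ S, ∃ j, HasJet P g₁ j ∧ j.fst = T ∧ j.snd ≠ 0 := by
    intro P hP
    obtain ⟨j, hj, h0, h1⟩ := hst.marked P hP
    refine ⟨_, hj.aeval a, ?_, ?_⟩
    · rw [fst_aeval_dual, haz, h0, hT]
      push_cast
      rfl
    · rw [snd_aeval_dual, hader]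
      exact mul_ne_zero hDQ h1
  have hTz : ∀ i ≤ k, (T : Qbar) ≠ (i : ℕ) := fun i hi h => by
    have := Nat.cast_injective h
    omega
  have hTA : aeval (T : Qbar) (nodePoly k (evenMult k)) ≠ 0 :=
    aeval_nodePoly_ne_zero fun i hi _ => hTz i hi
  have hTB : aeval (T : Qbar) (nodePoly k (oddMult k)) ≠ 0 :=
    aeval_nodePoly_ne_zero fun i hi _ => hTz i hi
  have hB0 : aeval g₁ (nodePoly k (oddMult k)) ≠ 0 := by
    obtain ⟨j, hj, h0, -⟩ := hmarked P₀ hP₀S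
    refine (hj.aeval _).ne_zero fun h => hTB ?_
    rw [← h0, ← fst_aeval_dual, h]
    rfl
  have hgood : ∀ P ∈ S, ∃ j, HasJet P (belyiComp k g₁) j ∧ j.fst ≠ 0 ∧ j.fst ≠ 1 ∧ j.snd ≠ 0 := by
    intro P hP
    obtain ⟨j, hj, h0, h1⟩ := hmarked P hP
    obtain ⟨j', hj', hf, hs⟩ := hj.belyiComp hkeven (by rw [h0]; exact hTz)
    rw [h0] at hf
    refine ⟨j', hj', fun h => ?_, fun h => ?_, hs h1⟩
    · rw [h, zero_mul] at hf
      exact hTA hf.symm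
    · rw [h, one_mul, aeval_natCast, aeval_natCast] at hf
      exact eval_nodePoly_ne hkeven hk0 hkT (by exact_mod_cast hf.symm)
  refine ⟨belyiComp k g₁, ?_, ?_, fun P hP => ?_, fun P hd hh => ?_⟩
  · have hasz : size a ≤ κ N * 3 := by
      have h1 : size a ≤ D * (2 + R) := by
        refine (size_mul_le _ _).trans (Nat.mul_le_mul ?_ ((size_add_le _ _).trans ?_))
        · rw [size_C, size_int, Int.natAbs_natCast]
        · rw [size_X, size_C, size_int, Int.natAbs_natCast]
      refine h1.trans (le_trans ?_ (Nat.mul_le_mul_right 3 hkκ))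
      rw [hk, mul_comm D, mul_right_comm]
      exact Nat.mul_le_mul_right _ (by omega)
    have h1 : IsFrac (W N) g₁ := hst.isFrac.aeval hasz
    have hsz : ∀ m, (∀ j, m j ≤ 2 ^ k) → size (nodePoly k m) ≤ V N := fun m hm =>
      (size_nodePoly_le hm).trans ((Nat.pow_le_pow_left (by omega) _).trans
        (Nat.pow_le_pow_right (by omega) (Nat.mul_le_mul
          (Nat.pow_le_pow_right two_pos hkκ) (by omega))))
    exact (h1.aeval (hsz _ (evenMult_le k))).mul ((h1.aeval (hsz _ (oddMult_le k))).inv hB0)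
  · obtain ⟨j, hj, -, -, hs⟩ := hgood P₀ hP₀S
    exact hj.not_isConstant hs
  · rcases hreg P with ⟨j, hj, hcr⟩ | ⟨hg, j, hj, h0⟩
    · by_cases hz : ∃ i ≤ k, j.fst = (i : ℕ)
      · obtain ⟨i, hi, hji⟩ := hz
        exact absurd (evalAt_belyiComp_of_node hj hi hji hB0) hP
      · have hs : j.snd ≠ 0 := fun h => hz (hcr h)
        push Not at hz
        obtain ⟨j', hj', -, hs'⟩ := hj.belyiComp hkeven hz
        exact hj'.isUnramifiedAt (hs' hs)
    · refine absurd ?_ hP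
      rw [evalAt_belyiComp_of_pole hk0 hg hj h0]
      exact Or.inr (Or.inl rfl)
  · obtain ⟨j, hj, h0, h1, -⟩ := hgood P ⟨hd, hh⟩
    rw [hj.evalAt_eq]
    rintro (h | h | h)
    · exact h0 (OnePoint.coe_injective h)
    · exact h1 (OnePoint.coe_injective h)
    · exact OnePoint.coe_ne_infty _ h

/-! ### Multiplication matrices -/

section Matrix

open scoped Matrix

variable (n : ℕ)

/-- The matrix of multiplication by `y` in the basis `1, y, …, y ^ (n - 1)`. -/
def yMatrix : Matrix (Fin n) (Fin n) ℤ[X] := Matrix.of fun k i =>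
  if (i : ℕ) + 1 < n then (if (k : ℕ) = i + 1 then 1 else 0)
  else if (k : ℕ) = 0 then 1 - X ^ n else 0

/-- The matrix of multiplication by `P(x, y)` in the basis `1, y, …, y ^ (n - 1)`. -/
def mulMatrix (P : ℤ[X][X]) : Matrix (Fin n) (Fin n) ℤ[X] := aeval (yMatrix n) P

variable {n}

theorem mulMatrix_apply (P : ℤ[X][X]) (k l : Fin n) : mulMatrix n P k l =
    ∑ i ∈ Finset.range (P.natDegree + 1), P.coeff i * (yMatrix n ^ i) k l := by
  rw [mulMatrix, aeval_eq_sum_range, Matrix.sum_apply]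
  exact Finset.sum_congr rfl fun i _ => by rw [Matrix.smul_apply, smul_eq_mul]

section VecMul

variable {K : Type*} [CommRing K]

/-- The last column encodes `y ^ n = 1 - x ^ n`. Consequently, at every solution of the equation the
row `(1, b, …, b ^ (n - 1))` is a left eigenvector, with eigenvalue `b`; the properties of
`mulMatrix` below are all derived from this vector. -/
theorem vecMul_yMatrix [NeZero n] (φ : ℤ[X] →+* K) {b : K} (h : φ X ^ n + b ^ n = 1) :
    (fun k : Fin n => b ^ (k : ℕ)) ᵥ* φ.mapMatrix (yMatrix n) = b • fun k : Fin n => b ^ (k : ℕ) := by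
  funext i
  rw [Matrix.vecMul, dotProduct, Pi.smul_apply, smul_eq_mul, ← pow_succ']
  simp only [RingHom.mapMatrix_apply, Matrix.map_apply, yMatrix, Matrix.of_apply]
  by_cases hi : (i : ℕ) + 1 < n
  · rw [Finset.sum_eq_single ⟨i + 1, hi⟩]
    · simp [hi]
    · intro k _ hk
      have : (k : ℕ) ≠ i + 1 := fun h' => hk (Fin.ext h')
      simp [hi, this]
    · simp
  · rw [Finset.sum_eq_single (0 : Fin n)]
    · have hin : (i : ℕ) + 1 = n := by omega
      simp [hin]
      linear_combination -h
    · intro k _ hk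
      have : k ≠ 0 := hk
      simp [hi, this]
    · simp

theorem vecMul_mulMatrix [NeZero n] (φ : ℤ[X] →+* K) {b : K} (h : φ X ^ n + b ^ n = 1)
    (P : ℤ[X][X]) : (fun k : Fin n => b ^ (k : ℕ)) ᵥ* φ.mapMatrix (mulMatrix n P) =
      eval₂ φ b P • fun k : Fin n => b ^ (k : ℕ) := by
  induction P using Polynomial.induction_on' with
  | add P Q hP hQ =>
    rw [mulMatrix, map_add, map_add, Matrix.vecMul_add, eval₂_add, add_smul, ← hP, ← hQ]
    rfl
  | monomial i p =>
    have hpow : (fun k : Fin n => b ^ (k : ℕ)) ᵥ* φ.mapMatrix (yMatrix n ^ i) =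
        b ^ i • fun k : Fin n => b ^ (k : ℕ) := by
      induction i with
      | zero => simp
      | succ i ih =>
        rw [pow_succ, map_mul, ← Matrix.vecMul_vecMul, ih, Matrix.smul_vecMul, vecMul_yMatrix φ h,
          smul_smul, pow_succ]
    have hsm : φ.mapMatrix (mulMatrix n (monomial i p)) = φ p • φ.mapMatrix (yMatrix n ^ i) := by
      rw [mulMatrix, aeval_monomial, ← Algebra.smul_def]
      ext k l
      simp
    rw [hsm, Matrix.vecMul_smul, hpow, eval₂_monomial, smul_smul]

/-- The determinant is the norm of `P(x, y)` to the polynomials in `x`; where `P` vanishes, the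
eigenvector has eigenvalue zero. -/
theorem map_det_mulMatrix_eq_zero [NeZero n] [IsDomain K] (φ : ℤ[X] →+* K) {b : K}
    (h : φ X ^ n + b ^ n = 1) {P : ℤ[X][X]} (hP : eval₂ φ b P = 0) :
    φ (mulMatrix n P).det = 0 := by
  rw [RingHom.map_det, ← Matrix.exists_vecMul_eq_zero_iff]
  refine ⟨fun k : Fin n => b ^ (k : ℕ), fun h0 => ?_, ?_⟩
  · have := congrFun h0 0
    simp at this
  · rw [vecMul_mulMatrix φ h, hP, zero_smul]

end VecMul

section Size

theorem size_mul_apply_le {R : Type*} [CommRing R] [SizeRing R] {A B : Matrix (Fin n) (Fin n) R}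
    {a b : ℕ} (hA : ∀ i j, size (A i j) ≤ a) (hB : ∀ i j, size (B i j) ≤ b) (i j : Fin n) :
    size ((A * B) i j) ≤ n * (a * b) := by
  rw [Matrix.mul_apply]
  refine (size_sum_le _ _).trans ((Finset.sum_le_card_nsmul _ _ (a * b) fun k _ =>
    (size_mul_le _ _).trans (Nat.mul_le_mul (hA _ _) (hB _ _))).trans ?_)
  rw [Finset.card_univ, Fintype.card_fin, smul_eq_mul]

theorem size_yMatrix_le {N : ℕ} (hn : n ≤ N) (i j : Fin n) : size (yMatrix n i j) ≤ 1 + 2 ^ N := by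
  rw [yMatrix, Matrix.of_apply]
  split_ifs
  · rw [size_one]
    exact Nat.le_add_right _ _
  · rw [size_zero]
    exact Nat.zero_le _
  · refine (size_sub_le _ _).trans (add_le_add size_one.le ((size_pow_le _ _).trans ?_))
    rw [size_X]
    exact Nat.pow_le_pow_right two_pos hn
  · rw [size_zero]
    exact Nat.zero_le _

theorem size_yMatrix_pow_le {N : ℕ} (hn : n ≤ N) (e : ℕ) (i j : Fin n) :
    size ((yMatrix n ^ e) i j) ≤ (N * (1 + 2 ^ N)) ^ e := by
  induction e generalizing i j with
  | zero =>
    rw [pow_zero, pow_zero, Matrix.one_apply]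
    split_ifs
    · rw [size_one]
    · rw [size_zero]
      exact Nat.zero_le _
  | succ e ih =>
    rw [pow_succ]
    refine (size_mul_apply_le ih (size_yMatrix_le hn) i j).trans ?_
    rw [pow_succ, mul_left_comm]
    exact Nat.mul_le_mul_left _ (Nat.mul_le_mul_right _ hn)

theorem natDegree_le_size_bivariate (P : ℤ[X][X]) : P.natDegree ≤ size P := by
  rcases eq_or_ne P 0 with rfl | hP
  · simp
  have h := size_coeff_mul_le P P.natDegree
  have h1 : 1 ≤ size (P.coeff P.natDegree) := size_pos (leadingCoeff_ne_zero.mpr hP)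
  calc P.natDegree ≤ 2 ^ P.natDegree := Nat.lt_two_pow_self.le
    _ ≤ size (P.coeff P.natDegree) * 2 ^ P.natDegree := Nat.le_mul_of_pos_left _ h1
    _ ≤ size P := h

/-- A bound for the sizes of the entries of multiplication matrices. -/
def entryBound (N : ℕ) : ℕ := (N + 1) * ((N + 1) * (1 + 2 ^ N)) ^ N

theorem primrec_entryBound : Primrec entryBound := by
  unfold entryBound
  apply_rules [primrec_nat_mul, primrec_nat_add, primrec_nat_pow, Primrec.id, Primrec.const]

theorem size_mulMatrix_le {N : ℕ} (hn : n ≤ N) {P : ℤ[X][X]} (hP : size P ≤ N) (i j : Fin n) :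
    size (mulMatrix n P i j) ≤ entryBound N := by
  rw [mulMatrix_apply]
  refine (size_sum_le _ _).trans ((Finset.sum_le_sum (g := fun e =>
    size (P.coeff e) * ((N + 1) * (1 + 2 ^ N)) ^ N) fun e he => ?_).trans ?_)
  · refine (size_mul_le _ _).trans (Nat.mul_le_mul_left _ ((size_yMatrix_pow_le hn e i j).trans ?_))
    refine (Nat.pow_le_pow_left (Nat.mul_le_mul_right _ (Nat.le_succ N)) _).trans
      (Nat.pow_le_pow_right (by positivity) ?_)
    exact (Finset.mem_range_succ_iff.mp he).trans ((natDegree_le_size_bivariate P).trans hP)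
  · rw [← Finset.sum_mul]
    refine Nat.mul_le_mul_right _ (le_trans ?_ (hP.trans (Nat.le_succ N)))
    rw [size_poly_eq_sum (p := P) (s := Finset.range (P.natDegree + 1)) fun e he =>
      Finset.mem_range_succ_iff.mpr (le_natDegree_of_mem_supp e he)]
    exact Finset.sum_le_sum fun e _ => Nat.le_mul_of_pos_right _ (by positivity)

theorem one_le_entryBound (N : ℕ) : 1 ≤ entryBound N := Nat.succ_le_iff.mpr (by
  unfold entryBound
  positivity)

theorem size_det_le_pow {R : Type*} [CommRing R] [SizeRing R] {N c : ℕ} (hn : n ≤ N) (hc : 1 ≤ c)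
    {A : Matrix (Fin n) (Fin n) R} (hA : ∀ i j, size (A i j) ≤ c) :
    size A.det ≤ (N + 1) ^ N * c ^ N := by
  refine (size_det_le A hA).trans (Nat.mul_le_mul ?_ (Nat.pow_le_pow_right hc hn))
  refine (Nat.factorial_le_pow n).trans ?_
  exact (Nat.pow_le_pow_left (hn.trans (Nat.le_succ N)) n).trans
    (Nat.pow_le_pow_right (Nat.succ_pos N) hn)

theorem size_adjugate_le {R : Type*} [CommRing R] [SizeRing R] {N c : ℕ} (hn : n ≤ N) (hc : 1 ≤ c)
    {A : Matrix (Fin n) (Fin n) R} (hA : ∀ i j, size (A i j) ≤ c) (i j : Fin n) :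
    size (A.adjugate i j) ≤ (N + 1) ^ N * c ^ N := by
  rw [Matrix.adjugate_apply]
  refine size_det_le_pow hn hc fun k l => ?_
  rw [Matrix.updateRow_apply]
  split_ifs
  · rw [Pi.single_apply]
    split_ifs
    · rwa [size_one]
    · rw [size_zero]
      exact Nat.zero_le _
  · exact hA k l

end Size

section FunctionField

theorem valueXY_eq (P : ℤ[X][X]) :
    valueXY n P = eval₂ (aeval (x n) : ℤ[X] →ₐ[ℤ] FunctionField n).toRingHom (y n) P := rfl

theorem aeval_x_X_pow : (aeval (x n) : ℤ[X] →ₐ[ℤ] FunctionField n).toRingHom X ^ n + y n ^ n = 1 := by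
  rw [AlgHom.toRingHom_eq_coe, RingHom.coe_coe, aeval_X, x_pow_add_y_pow]

variable [NeZero n]

/-- A kernel vector `w` would give `P(x, y) * ∑ wₖ(x) y ^ k = 0`, against the independence of the
powers of `y`. -/
theorem det_mulMatrix_ne_zero {P : ℤ[X][X]} (hP : valueXY n P ≠ 0) : (mulMatrix n P).det ≠ 0 := by
  intro h
  obtain ⟨w, hw0, hw⟩ := Matrix.exists_mulVec_eq_zero_iff.mpr h
  refine hw0 (sum_aeval_x_mul_y_pow_eq_zero ?_)
  set φ := (aeval (x n) : ℤ[X] →ₐ[ℤ] FunctionField n).toRingHom with hφ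
  have h1 : φ.mapMatrix (mulMatrix n P) *ᵥ (φ ∘ w) = 0 := by
    funext i
    have := RingHom.map_mulVec φ (mulMatrix n P) w i
    rw [hw] at this
    exact this.symm.trans (map_zero φ)
  have h2 := Matrix.dotProduct_mulVec (fun k : Fin n => y n ^ (k : ℕ)) (φ.mapMatrix (mulMatrix n P))
    (φ ∘ w)
  rw [h1, dotProduct_zero, vecMul_mulMatrix φ aeval_x_X_pow, smul_dotProduct, smul_eq_mul] at h2
  have h3 := (mul_eq_zero.mp h2.symm).resolve_left hP
  rw [← h3, dotProduct]
  exact Finset.sum_congr rfl fun i _ => mul_comm _ _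

/-- Cramer's rule for `f = P / Q`: the matrix `adj(M_Q) M_P` represents multiplication by `det(M_Q)
f`, and its first column is the expansion of the image of `1`. -/
theorem mul_det_eq_sum {f : FunctionField n} {P Q : ℤ[X][X]} (hQ : valueXY n Q ≠ 0)
    (hf : f * valueXY n Q = valueXY n P) :
    f * aeval (x n) (mulMatrix n Q).det =
      ∑ k, aeval (x n) (((mulMatrix n Q).adjugate * mulMatrix n P) k 0) * y n ^ (k : ℕ) := by
  set φ := (aeval (x n) : ℤ[X] →ₐ[ℤ] FunctionField n).toRingHom with hφ
  set v : Fin n → FunctionField n := fun k => y n ^ (k : ℕ) with hv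
  have hvQ := vecMul_mulMatrix φ (aeval_x_X_pow (n := n)) Q
  have hvP := vecMul_mulMatrix φ (aeval_x_X_pow (n := n)) P
  rw [← valueXY_eq] at hvQ hvP
  have h1 : valueXY n Q • (v ᵥ* φ.mapMatrix (mulMatrix n Q).adjugate) =
      φ (mulMatrix n Q).det • v := by
    rw [← Matrix.smul_vecMul, ← hvQ, Matrix.vecMul_vecMul, ← map_mul, Matrix.mul_adjugate]
    have : φ.mapMatrix ((mulMatrix n Q).det • (1 : Matrix (Fin n) (Fin n) ℤ[X])) =
        φ (mulMatrix n Q).det • 1 := by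
      ext k l
      simp only [RingHom.mapMatrix_apply, Matrix.map_apply, Matrix.smul_apply, Matrix.one_apply]
      split_ifs <;> simp
    rw [this, Matrix.vecMul_smul, Matrix.vecMul_one]
  have h2 : valueXY n Q • (v ᵥ* φ.mapMatrix ((mulMatrix n Q).adjugate * mulMatrix n P)) =
      (φ (mulMatrix n Q).det * valueXY n P) • v := by
    rw [map_mul, ← Matrix.vecMul_vecMul, ← Matrix.smul_vecMul, h1, Matrix.smul_vecMul, hvP,
      smul_smul]
  have h3 := congrFun h2 0
  rw [Pi.smul_apply, Pi.smul_apply, smul_eq_mul, smul_eq_mul] at h3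
  have hv0 : v 0 = 1 := by simp [hv]
  have h4 : (v ᵥ* φ.mapMatrix ((mulMatrix n Q).adjugate * mulMatrix n P)) 0 =
      ∑ k, aeval (x n) (((mulMatrix n Q).adjugate * mulMatrix n P) k 0) * y n ^ (k : ℕ) := by
    rw [Matrix.vecMul, dotProduct]
    exact Finset.sum_congr rfl fun k _ => mul_comm _ _
  rw [h4, hv0, mul_one, ← hf] at h3
  refine mul_left_cancel₀ hQ (Eq.trans ?_ h3.symm)
  change _ = aeval (x n) (mulMatrix n Q).det * _
  ring

end FunctionField

end Matrix

/-- A function of bounded size has a presentation of bounded complexity. -/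
theorem exists_presentation : ∃ F : ℕ → ℕ, Primrec F ∧ ∀ (n : ℕ) [NeZero n] (N : ℕ)
    (f : FunctionField n), n ≤ N → IsFrac N f →
    ∃ a q : Fin n → ℤ[X], IsPresentation f a q ∧ ComplexityLE a q (F N) := by
  obtain ⟨E, hE, hred⟩ := exists_reduced_fraction
  let A : ℕ → ℕ := fun N => (N + 1) ^ N * entryBound N ^ N
  let W : ℕ → ℕ := fun N => N * (A N * entryBound N) + A N
  have hB := primrec_entryBound
  have hA : Primrec A := by
    apply_rules [primrec_nat_mul, primrec_nat_add, primrec_nat_pow, Primrec.id, Primrec.const]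
  have hW : Primrec W := by
    apply_rules [primrec_nat_mul, primrec_nat_add, primrec_nat_pow, Primrec.id, Primrec.const]
  refine ⟨fun N => E (W N), hE.comp hW, fun n _ N f hn hf => ?_⟩
  obtain ⟨P, Q, hP, hQ, hQ0, hfP⟩ := hf
  have hdet := det_mulMatrix_ne_zero hQ0
  have hdetx : aeval (x n) (mulMatrix n Q).det ≠ 0 := (aeval_int_x_eq_zero_iff _).not.mpr hdet
  have hb := one_le_entryBound N
  have hdetN : size (mulMatrix n Q).det ≤ W N :=
    (size_det_le_pow hn hb (size_mulMatrix_le hn hQ)).trans (Nat.le_add_left _ _)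
  have hnum : ∀ k : Fin n, size (((mulMatrix n Q).adjugate * mulMatrix n P) k 0) ≤ W N := fun k =>
    ((size_mul_apply_le (size_adjugate_le hn hb (size_mulMatrix_le hn hQ))
      (size_mulMatrix_le hn hP) k 0).trans (Nat.mul_le_mul_right _ hn)).trans (Nat.le_add_right _ _)
  -- Each coordinate of `f` is an entry of `adj(M_Q) M_P` over `det M_Q`, reduced to lowest terms.
  choose a q hq0 hqdvd hcross hprim hroot haN hqN using fun k => hred (W N) _ _ hdet (hnum k) hdetN
  refine ⟨a, q, ⟨hq0, hprim, hroot, ?_⟩, ?_, ?_, ?_, ?_, ?_⟩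
  · have h := mul_det_eq_sum hQ0 hfP
    rw [eq_div_of_mul_eq hdetx h, Finset.sum_div]
    refine Finset.sum_congr rfl fun k _ => ?_
    have h1 := congrArg (aeval (x n)) (hcross k)
    rw [map_mul, map_mul] at h1
    have h2 : aeval (x n) (q k) ≠ 0 := (aeval_int_x_eq_zero_iff _).not.mpr (hq0 k)
    rw [div_mul_eq_mul_div, div_eq_div_iff hdetx h2]
    linear_combination y n ^ (k : ℕ) * h1
  · exact fun k => by exact_mod_cast (natDegree_le_size _).trans (haN k)
  · exact fun k => by exact_mod_cast (natDegree_le_size _).trans (hqN k)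
  · exact fun k => polyHeight_le (haN k)
  · exact fun k => polyHeight_le (hqN k)
  · exact fun k => pairHeight_le (haN k) (hqN k)

/-! ### Degrees and heights of functions of bounded size -/

section Heights

variable {n : ℕ}

theorem exists_hasJet_valueXY {P : Point n} (h : P.coords 2 ≠ 0) (A : ℤ[X][X]) :
    ∃ j, HasJet P (valueXY n A) j ∧
      j.fst = eval₂ (aeval (P.coords 0 / P.coords 2) : ℤ[X] →ₐ[ℤ] Qbar).toRingHom
        (P.coords 1 / P.coords 2) A := by
  obtain ⟨jx, hx, hx0, -⟩ := hasJet_x h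
  obtain ⟨jy, hy, hy0, -⟩ := hasJet_y h
  induction A using Polynomial.induction_on' with
  | add A B hA hB =>
    obtain ⟨j, hj, h1⟩ := hA
    obtain ⟨j', hj', h1'⟩ := hB
    refine ⟨j + j', by rw [map_add]; exact hj.add hj', ?_⟩
    rw [TrivSqZeroExt.fst_add, eval₂_add, h1, h1']
  | monomial i p =>
    refine ⟨aeval jx p * jy ^ i, ?_, ?_⟩
    · rw [← C_mul_X_pow_eq_monomial, map_mul, map_pow, valueXY_C, valueXY_X]
      exact (hx.aeval p).mul (hy.pow i)
    · rw [TrivSqZeroExt.fst_mul, TrivSqZeroExt.fst_pow, fst_aeval_dual, hx0, hy0, eval₂_monomial]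
      rfl

variable [NeZero n]

theorem aeval_det_mulMatrix_eq_zero {P : Point n} (h : P.coords 2 ≠ 0) {A : ℤ[X][X]}
    (hA : eval₂ (aeval (P.coords 0 / P.coords 2) : ℤ[X] →ₐ[ℤ] Qbar).toRingHom
      (P.coords 1 / P.coords 2) A = 0) :
    aeval (P.coords 0 / P.coords 2) (mulMatrix n A).det = 0 := by
  refine map_det_mulMatrix_eq_zero
    (aeval (P.coords 0 / P.coords 2) : ℤ[X] →ₐ[ℤ] Qbar).toRingHom ?_ hA
  rw [AlgHom.toRingHom_eq_coe, RingHom.coe_coe, aeval_X]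
  exact Point.affine_eq h

end Heights

/-- The points where a function of bounded size takes one of the values `0, 1, ∞` have bounded
height. -/
theorem exists_height_bound : ∃ F : ℕ → ℕ, Primrec F ∧ ∀ (n : ℕ) [NeZero n] (N : ℕ)
    (f : FunctionField n), n ≤ N → IsFrac N f → ¬ IsConstant f →
    ∀ P : Point n, evalAt f P ∈ threePoints → pointHeight (piMap P) ≤ F N := by
  let A : ℕ → ℕ := fun N => (2 * N + 1) ^ (2 * N) * entryBound (2 * N) ^ (2 * N) + 1
  have hB : Primrec fun N => entryBound (2 * N) := primrec_entryBound.comp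
    (primrec_nat_mul (Primrec.const 2) Primrec.id)
  have hA : Primrec A := by
    apply_rules [primrec_nat_mul, primrec_nat_add, primrec_nat_pow, Primrec.id, Primrec.const]
  refine ⟨fun N => 3 * (A N ^ N + A N), by
    apply_rules [primrec_nat_mul, primrec_nat_add, primrec_nat_pow, Primrec.id, Primrec.const],
    fun n _ N f hn hf hconst P hP => ?_⟩
  beta_reduce
  by_cases h2 : P.coords 2 = 0
  · rw [piMap, if_pos h2]
    exact Nat.cast_nonneg (α := ℝ) (3 * (A N ^ N + A N))
  obtain ⟨R, Q, hR, hQ, hQ0, hfR⟩ := hf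
  -- A zero of `T(x, y)` at the point makes its `x`-coordinate a root of the norm of `T`, a nonzero
  -- polynomial of bounded size. The values `0, 1, ∞` of `f = R / Q` lead to `T = R`, `R - Q`, `Q`;
  -- the factor `2` is for the difference.
  have key : ∀ T : ℤ[X][X], size T ≤ 2 * N → valueXY n T ≠ 0 →
      eval₂ (aeval (P.coords 0 / P.coords 2) : ℤ[X] →ₐ[ℤ] Qbar).toRingHom
        (P.coords 1 / P.coords 2) T = 0 →
      pointHeight (piMap P) ≤ ((3 * (A N ^ N + A N) : ℕ) : ℝ) := by
    intro T hT hT0 hz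
    have h1 : IsBdd (A N) (P.coords 0 / P.coords 2) :=
      IsBdd.of_root (det_mulMatrix_ne_zero hT0)
        (size_det_le_pow (by omega) (one_le_entryBound _) (size_mulMatrix_le (by omega) hT))
        (aeval_det_mulMatrix_eq_zero h2 hz)
    have h3 : IsBdd (A N ^ N + A N) ((P.coords 0 / P.coords 2) ^ n) :=
      (h1.pow n).mono (Nat.add_le_add_right (Nat.pow_le_pow_right h1.pos hn) _)
    rw [piMap, if_neg h2, ← div_pow]
    exact h3.pointHeight_le.trans (by push_cast; rfl)
  obtain ⟨jR, hjR, hjR0⟩ := exists_hasJet_valueXY h2 R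
  obtain ⟨jQ, hjQ, hjQ0⟩ := exists_hasJet_valueXY h2 Q
  -- If `Q` vanishes at the point, the height is bounded whatever the value of `f`; otherwise `f` is
  -- regular and its value is not `∞`.
  by_cases hq : jQ.fst = 0
  · exact key Q (by omega) hQ0 (hjQ0 ▸ hq)
  have hfj : HasJet P f (jR * jQ⁻¹) := by
    rw [eq_div_of_mul_eq hQ0 hfR, div_eq_mul_inv]
    exact hjR.mul (hjQ.inv hq)
  have hfst : (jR * jQ⁻¹).fst = jR.fst * jQ.fst⁻¹ := by
    rw [TrivSqZeroExt.fst_mul, TrivSqZeroExt.fst_inv]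
  rw [hfj.evalAt_eq, hfst] at hP
  rcases hP with hP | hP | hP
  · have h3 := OnePoint.coe_injective hP
    have h4 : jR.fst = 0 := (mul_eq_zero.mp h3).resolve_right (inv_ne_zero hq)
    refine key R (by omega) ?_ (hjR0 ▸ h4)
    rw [← hfR]
    refine mul_ne_zero (fun h => hconst ?_) hQ0
    rw [h]
    exact ⟨0, map_zero _⟩
  · have h3 := OnePoint.coe_injective hP
    have h4 : jR.fst = jQ.fst := by
      have : jR.fst * jQ.fst⁻¹ = 1 := h3
      rwa [mul_inv_eq_one₀ hq] at this
    refine key (R - Q) ((size_sub_le _ _).trans (by omega)) ?_ ?_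
    · rw [map_sub, ← hfR]
      intro h
      refine hconst ⟨1, ?_⟩
      rw [map_one]
      refine mul_right_cancel₀ hQ0 ?_
      linear_combination -h
    · rw [eval₂_sub, ← hjR0, ← hjQ0, h4, sub_self]
  · exact absurd hP (OnePoint.coe_ne_infty _)

/-! ### The degree of a function of bounded size -/

section Field

variable {k L : Type*} [Field k] [Field L] [Algebra k L]

/-- An equation for `c` over the polynomials in `φ X` is read as an equation for `φ X` over `k`. It
remains nontrivial: the coefficient at the degree `m` of the leading coefficient of `p` is a nonzero
integral polynomial in `c`, which does not vanish by `hc`. -/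
theorem exists_poly_of_equation (c : k) (hc : ∀ r : ℤ[X], r ≠ 0 → eval₂ (Int.castRingHom k) c r ≠ 0)
    {p : ℤ[X][X]} (hp : p ≠ 0) {φ : ℤ[X] →+* L} (h : eval₂ φ (algebraMap k L c) p = 0) :
    ∃ q : k[X], q ≠ 0 ∧ q.natDegree ≤ size p ∧ aeval (φ X) q = 0 := by
  refine ⟨∑ i ∈ Finset.range (p.natDegree + 1), C (c ^ i) * (p.coeff i).map (Int.castRingHom k),
    fun h0 => ?_, ?_, ?_⟩
  · set m := p.leadingCoeff.natDegree
    let r : ℤ[X] := ∑ i ∈ Finset.range (p.natDegree + 1), C ((p.coeff i).coeff m) * X ^ i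
    have hr : r ≠ 0 := fun hr => by
      have h1 := congrArg (fun r => r.coeff p.natDegree) hr
      simp only [r, finsetSum_coeff, coeff_C_mul, coeff_X_pow, coeff_zero] at h1
      rw [Finset.sum_eq_single p.natDegree] at h1
      · rw [if_pos rfl, mul_one] at h1
        exact leadingCoeff_ne_zero.mpr (leadingCoeff_ne_zero.mpr hp) h1
      · intro i _ hi
        rw [if_neg hi.symm, mul_zero]
      · simp
    refine hc r hr ?_
    have h1 := congrArg (fun q => q.coeff m) h0
    simp only [finsetSum_coeff, coeff_zero] at h1
    rw [← h1, eval₂_finsetSum]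
    refine Finset.sum_congr rfl fun i _ => ?_
    rw [coeff_C_mul, coeff_map, eval₂_mul, eval₂_C, eval₂_X_pow, mul_comm]
  · refine natDegree_sum_le_of_forall_le _ _ fun i _ => ?_
    refine (natDegree_C_mul_le _ _).trans (natDegree_map_le.trans ?_)
    exact (natDegree_le_size _).trans (size_coeff_le p i)
  · rw [← h, eval₂_eq_sum_range, map_sum]
    refine Finset.sum_congr rfl fun i _ => ?_
    have h1 : aeval (φ X) ((p.coeff i).map (Int.castRingHom k)) = φ (p.coeff i) := by
      rw [aeval_def, eval₂_map]
      have : (eval₂RingHom ((algebraMap k L).comp (Int.castRingHom k)) (φ X)) = φ :=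
        Polynomial.ringHom_ext' (RingHom.ext_int _ _) (by simp)
      exact RingHom.congr_fun this _
    rw [map_mul, h1, aeval_C, map_pow, mul_comm]

/-- In the tower `k ⊆ k(a) ⊆ k(a, b) = L` the steps have degree at most `D` and `n`. -/
theorem finrank_le_of_pow_add_pow {a b : L} {n D : ℕ} (hn : n ≠ 0) {q : k[X]} (hq : q ≠ 0)
    (hqa : aeval a q = 0) (hqD : q.natDegree ≤ D) (hab : a ^ n + b ^ n = 1)
    (htop : ∀ E : IntermediateField k L, a ∈ E → b ∈ E → E = ⊤) : Module.finrank k L ≤ D * n := by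
  have haint : IsIntegral k a := isAlgebraic_iff_isIntegral.mp ⟨q, hq, hqa⟩
  let E := IntermediateField.adjoin k {a}
  have haE : a ∈ E := IntermediateField.mem_adjoin_simple_self k a
  let r : E[X] := X ^ n + C (⟨a, haE⟩ ^ n - 1)
  have hr : r.Monic := monic_X_pow_add_C _ hn
  have hrb : aeval b r = 0 := by
    simp only [r, map_add, map_pow, aeval_X, aeval_C, map_sub, map_one,
      IntermediateField.algebraMap_apply]
    linear_combination hab
  have hbint : IsIntegral E b := ⟨r, hr, hrb⟩
  have hbtop : IntermediateField.adjoin E {b} = ⊤ := by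
    rw [← IntermediateField.restrictScalars_eq_top_iff (K := k)]
    refine htop _ ?_ (IntermediateField.mem_adjoin_simple_self E b)
    exact (IntermediateField.adjoin E {b}).algebraMap_mem ⟨a, haE⟩
  have h1 : Module.finrank E L ≤ n := by
    rw [← IntermediateField.finrank_top', ← hbtop, IntermediateField.adjoin.finrank hbint]
    exact (natDegree_le_of_dvd (minpoly.dvd E _ hrb) hr.ne_zero).trans natDegree_X_pow_add_C.le
  have h2 : Module.finrank k E ≤ D := by
    rw [IntermediateField.adjoin.finrank haint]
    exact (natDegree_le_of_dvd (minpoly.dvd k _ hqa) hq).trans hqD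
  rw [← Module.finrank_mul_finrank k E L]
  exact Nat.mul_le_mul h2 h1

end Field

section Degree

variable {n : ℕ} [NeZero n]

theorem eq_top_of_x_mem_of_y_mem {k : Type*} [Field k] [Algebra k (FunctionField n)]
    (E : IntermediateField k (FunctionField n))
    (hc : ∀ c : Qbar, algebraMap Qbar (FunctionField n) c ∈ E) (hx : x n ∈ E) (hy : y n ∈ E) :
    E = ⊤ := by
  have key : ∀ a : CoordinateRing n, algebraMap (CoordinateRing n) (FunctionField n) a ∈ E := by
    intro a
    obtain ⟨p, rfl⟩ := AdjoinRoot.mk_surjective a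
    induction p using Polynomial.induction_on' with
    | add p q hp hq =>
      rw [map_add, map_add]
      exact add_mem hp hq
    | monomial i p =>
      rw [← C_mul_X_pow_eq_monomial, map_mul, map_pow, AdjoinRoot.mk_X, AdjoinRoot.mk_C, map_mul,
        map_pow, ← aeval_x_eq]
      refine mul_mem ?_ (pow_mem hy i)
      rw [aeval_eq_sum_range]
      refine sum_mem fun e _ => ?_
      rw [Algebra.smul_def]
      exact mul_mem (hc _) (pow_mem hx e)
  rw [eq_top_iff]
  intro z _
  obtain ⟨a, b, -, rfl⟩ := IsFractionRing.div_surjective (CoordinateRing n) z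
  exact div_mem (key a) (key b)

/-- A function algebraic over the algebraically closed field `Qbar` lies in `Qbar`. -/
theorem isConstant_of_aeval_eq_zero {f : FunctionField n} {p : ℤ[X]} (hp : p ≠ 0)
    (h : aeval f p = 0) : IsConstant f := by
  have halg : IsIntegral Qbar f := by
    rw [← isAlgebraic_iff_isIntegral]
    refine ⟨p.map (algebraMap ℤ Qbar),
      (Polynomial.map_ne_zero_iff (algebraMap ℤ Qbar).injective_int).mpr hp, ?_⟩
    rwa [aeval_map_algebraMap]
  exact minpoly.mem_range_of_degree_eq_one Qbar f
    (IsAlgClosed.degree_eq_one_of_irreducible Qbar (minpoly.irreducible halg))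

/-- A function of bounded size satisfies an equation `p(x, f) = 0`, where the coefficient of the
highest power of `f` is a nonzero polynomial in `x`. -/
theorem exists_equation {N : ℕ} {f : FunctionField n} (hn : n ≤ N) (hf : IsFrac N f) :
    ∃ p : ℤ[X][X], p ≠ 0 ∧ size p ≤ (N + 1) ^ N * (3 * entryBound N) ^ N ∧
      eval₂ (aeval (x n) : ℤ[X] →ₐ[ℤ] FunctionField n).toRingHom f p = 0 := by
  obtain ⟨P, Q, hP, hQ, hQ0, hfP⟩ := hf
  set φ := (aeval (x n) : ℤ[X] →ₐ[ℤ] FunctionField n).toRingHom with hφ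
  -- The pencil `X M_Q - M_P`. The coefficient of `X ^ n` in its determinant is `det M_Q ≠ 0`, and
  -- at `X = f = P / Q` it annihilates the vector of powers of `y`.
  let M : Matrix (Fin n) (Fin n) ℤ[X][X] :=
    (X : ℤ[X][X]) • (mulMatrix n Q).map C + (-mulMatrix n P).map C
  refine ⟨M.det, fun h => det_mulMatrix_ne_zero hQ0 ?_, ?_, ?_⟩
  · rw [← coeff_det_X_add_C_card (mulMatrix n Q) (-mulMatrix n P)]
    change M.det.coeff _ = 0
    rw [h, coeff_zero]
  · refine size_det_le_pow hn ?_ fun i j => ?_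
    · have := one_le_entryBound N
      omega
    · have h1 : M i j = X * C (mulMatrix n Q i j) + C (-mulMatrix n P i j) := rfl
      have h2 := size_mulMatrix_le hn hQ i j
      have h3 := size_mulMatrix_le hn hP i j
      rw [h1]
      refine (size_add_le _ _).trans ((add_le_add ((size_mul_le _ _).trans
        (Nat.mul_le_mul size_X.le (size_C _).le)) (size_C _).le).trans ?_)
      rw [size_neg]
      omega
  · have h1 : (eval₂RingHom φ f).mapMatrix M =
        f • φ.mapMatrix (mulMatrix n Q) - φ.mapMatrix (mulMatrix n P) := by
      ext i j
      simp [M, sub_eq_add_neg, mul_comm f]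
    rw [← coe_eval₂RingHom, RingHom.map_det, ← Matrix.exists_vecMul_eq_zero_iff]
    refine ⟨fun k : Fin n => y n ^ (k : ℕ), fun h0 => ?_, ?_⟩
    · have := congrFun h0 0
      simp at this
    · rw [h1, Matrix.vecMul_sub, Matrix.vecMul_smul, vecMul_mulMatrix φ aeval_x_X_pow,
        vecMul_mulMatrix φ aeval_x_X_pow, smul_smul, ← sub_smul, ← valueXY_eq, ← valueXY_eq, hfP,
        sub_self, zero_smul]

theorem degree_le_of_equation {f : FunctionField n} (hconst : ¬ IsConstant f) {p : ℤ[X][X]}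
    (hp : p ≠ 0) (h : eval₂ (aeval (x n) : ℤ[X] →ₐ[ℤ] FunctionField n).toRingHom f p = 0) :
    degree f ≤ size p * n := by
  have hff := IntermediateField.AdjoinSimple.algebraMap_gen Qbar f
  have htr : ∀ r : ℤ[X], r ≠ 0 →
      eval₂ (Int.castRingHom _) (IntermediateField.AdjoinSimple.gen Qbar f) r ≠ 0 := by
    refine fun r hr h0 => hconst (isConstant_of_aeval_eq_zero hr ?_)
    have h1 := congrArg (algebraMap _ (FunctionField n)) h0
    rw [hom_eval₂, map_zero, hff] at h1
    rw [← h1, aeval_def]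
    congr 1
    exact RingHom.ext_int _ _
  obtain ⟨q, hq0, hqdeg, hqx⟩ := exists_poly_of_equation
    (IntermediateField.AdjoinSimple.gen Qbar f) htr hp (L := FunctionField n)
    (φ := (aeval (x n) : ℤ[X] →ₐ[ℤ] FunctionField n).toRingHom) (by rwa [hff])
  rw [AlgHom.toRingHom_eq_coe, RingHom.coe_coe, aeval_X] at hqx
  refine finrank_le_of_pow_add_pow (NeZero.ne n) hq0 hqx hqdeg (x_pow_add_y_pow n)
    fun E hx hy => eq_top_of_x_mem_of_y_mem E (fun c => ?_) hx hy
  exact E.algebraMap_mem (algebraMap Qbar (IntermediateField.adjoin Qbar {f}) c)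

end Degree

theorem exists_degree_bound : ∃ F : ℕ → ℕ, Primrec F ∧ ∀ (n : ℕ) [NeZero n] (N : ℕ)
    (f : FunctionField n), n ≤ N → IsFrac N f → ¬ IsConstant f → degree f ≤ F N := by
  refine ⟨fun N => (N + 1) ^ N * (3 * entryBound N) ^ N * N, ?_, fun n _ N f hn hf hconst => ?_⟩
  · have hB := primrec_entryBound
    apply_rules [primrec_nat_mul, primrec_nat_add, primrec_nat_pow, Primrec.id, Primrec.const]
  · obtain ⟨p, hp0, hpN, hp⟩ := exists_equation hn hf
    exact (degree_le_of_equation hconst hp0 hp).trans (Nat.mul_le_mul hpN hn)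

end FermatCurve

end

/-! ### The main theorem -/

theorem mainTheorem2 :
    ∃ B : ℕ × ℕ × ℕ → ℕ, Computable B ∧
      ∀ (n : ℕ) [NeZero n] (d : ℕ) (H : ℝ) (S : Set (OnePoint FermatCurve.Qbar)),
        (∀ P ∈ S, FermatCurve.pointDegree P ≤ d) →
        (∀ P ∈ S, FermatCurve.pointHeight P ≤ H) →
        ∃ f : FermatCurve.FunctionField n,
          ¬ FermatCurve.IsConstant f ∧
          FermatCurve.IsDefinedOverRat f ∧
          (∀ Q : FermatCurve.Point n, FermatCurve.evalAt f Q ∉ FermatCurve.threePoints →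
            FermatCurve.IsUnramifiedAt f Q) ∧
          (∀ Q : FermatCurve.Point n, FermatCurve.piMap Q ∈ S →
            FermatCurve.evalAt f Q ∉ FermatCurve.threePoints) ∧
          (∃ a q : Fin n → Polynomial ℤ, FermatCurve.IsPresentation f a q ∧
            FermatCurve.ComplexityLE a q (B (n, d, ⌈H⌉₊))) ∧
          FermatCurve.degree f ≤ B (n, d, ⌈H⌉₊) ∧
          (∀ Q : FermatCurve.Point n, FermatCurve.evalAt f Q ∈ FermatCurve.threePoints →
            FermatCurve.pointHeight (FermatCurve.piMap Q) ≤ B (n, d, ⌈H⌉₊)) := by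
  obtain ⟨F, hF, hbelyi⟩ := FermatCurve.exists_belyi_function
  obtain ⟨F₁, hF₁, hpres⟩ := FermatCurve.exists_presentation
  obtain ⟨F₂, hF₂, hdeg⟩ := FermatCurve.exists_degree_bound
  obtain ⟨F₃, hF₃, hheight⟩ := FermatCurve.exists_height_bound
  -- The summand `N` ensures `n ≤ E N`, which the three bounds applied to `f` require.
  let E : ℕ → ℕ := fun N => F N + N
  have hE : Primrec E := FermatCurve.primrec_nat_add hF Primrec.id
  let T : ℕ → ℕ := fun N => F₁ (E N) + F₂ (E N) + F₃ (E N)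
  have hT : Primrec T := FermatCurve.primrec_nat_add
    (FermatCurve.primrec_nat_add (hF₁.comp hE) (hF₂.comp hE)) (hF₃.comp hE)
  refine ⟨fun v => T (v.1 + v.2.1 + v.2.2), ?_, fun n _ d H S hSd hSH => ?_⟩
  · exact (hT.comp (Primrec.nat_add.comp (Primrec.nat_add.comp Primrec.fst
      (Primrec.fst.comp Primrec.snd)) (Primrec.snd.comp Primrec.snd))).to_comp
  -- The natural ceiling is `max(0, ⌈H⌉)`. The function found for `N` is good at all points of
  -- degree and height at most `N`, hence at those over `S`.
  set N := n + d + ⌈H⌉₊ with hN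
  change ∃ f : FermatCurve.FunctionField n, _ ∧ _ ∧ _ ∧ _ ∧
    (∃ a q : Fin n → Polynomial ℤ, _ ∧ FermatCurve.ComplexityLE a q (T N : ℕ)) ∧ _ ≤ T N ∧
      ∀ Q : FermatCurve.Point n, _ → _ ≤ ((T N : ℕ) : ℝ)
  obtain ⟨f, hfrac, hconst, hunr, hgood⟩ := hbelyi n N (by omega)
  have hfE : FermatCurve.IsFrac (E N) f := hfrac.mono (Nat.le_add_right _ _)
  have hnE : n ≤ E N := le_trans (by omega) (Nat.le_add_left N (F N))
  have h₁ : F₁ (E N) ≤ T N := (Nat.le_add_right _ _).trans (Nat.le_add_right _ _)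
  have h₂ : F₂ (E N) ≤ T N := (Nat.le_add_left _ _).trans (Nat.le_add_right _ _)
  have h₃ : F₃ (E N) ≤ T N := Nat.le_add_left _ _
  refine ⟨f, hconst, hfrac.isDefinedOverRat, hunr, fun Q hQ => hgood Q ?_ ?_, ?_,
    (hdeg n (E N) f hnE hfE hconst).trans h₂, fun Q hQ =>
      (hheight n (E N) f hnE hfE hconst Q hQ).trans (by exact_mod_cast h₃)⟩
  · exact (hSd _ hQ).trans (by omega)
  · refine (hSH _ hQ).trans ((Nat.le_ceil H).trans ?_)
    exact_mod_cast (by omega : ⌈H⌉₊ ≤ N)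
  · obtain ⟨a, q, hpr, hc⟩ := hpres n (E N) f hnE hfE
    have hle : ((F₁ (E N) : ℕ) : ℝ) ≤ (T N : ℕ) := by exact_mod_cast h₁
    exact ⟨a, q, hpr, fun i => (hc.natDegree_num i).trans hle,
      fun i => (hc.natDegree_den i).trans hle, fun i => (hc.height_num i).trans hle,
      fun i => (hc.height_den i).trans hle, fun i => (hc.height_pair i).trans hle⟩
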